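/- Let $\alpha>0$. On $\mathbb{R}^2$ write $B(w)(x)=\frac1{2\pi}\int_{\mathbb{R}^2}\frac{(x-y)^\perp}{|x-y|^2}\,w(y)\,dy$ with $z^\perp=(-z_2,z_1)$ for the Biot–Savart operator, $H_\alpha(f)$ for the solution $g\in L^1(\mathbb{R}^2)$ of the Helmholtz equation $g-\alpha^2\Delta g=f$ (in the sense of distributions, for $f\in L^1$), $\Phi(x,t)=\frac1{4\pi t}e^{-|x|^2/(4t)}$ for the heat kernel, and $\|f\|_{L^2(2)}=\big(\int_{\mathbb{R}^2}(1+|\xi|^2)^{2}|f(\xi)|^2\,d\xi\big)^{1/2}$, $L^2(2)=\{f\in L^2(\mathbb{R}^2):\|f\|_{L^2(2)}<\infty\}$. Consider the vorticity form of the two-dimensional viscous Camassa–Holm equations, $$\tilde v_t+u\cdot\nabla\tilde v=\Delta\tilde v,\qquad u=B(H_\alpha(\tilde v)),\qquad \tilde v(0)=\tilde v_0 .$$ A (global mild) solution is a $\tilde v\in L^\infty([0,\infty);L^1(\mathbb{R}^2))$ with $\tilde v(0)=\tilde v_0$ and, for every $t>0$, $$\tilde v(t)=\Phi(t)*\tilde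 v_0-\int_0^t\nabla\Phi(t-s)*\big[u(s)\,\tilde v(s)\big]\,ds ,$$ where the convolution of the two vector fields is taken with the Euclidean scalar product. **Theorem.** For every $\mu\in(0,\tfrac12)$ there are $r_0>0$ and $C$, depending only on $\mu$ and $\alpha$, such that for all initial data $\tilde v_0\in L^2(2)$ with $\|\tilde v_0\|_{L^2(2)}\le r_0$ a solution exists, and every solution $\tilde v$ satisfies, for all $p\in[1,2]$ and all $t\ge0$, $$\big\|\tilde v(\cdot,t)-a\big(\Omega(\cdot,t)-\alpha^2\Delta\Omega(\cdot,t)\big)\big\|_{L^p(\mathbb{R}^2)}\le C\,(1+t)^{-1-\mu+\frac1p},$$ where $a=\int_{\mathbb{R}^2}\tilde v_0\,dx$ and $\Omega(x,t)=\frac{1}{4\pi(1+t)}e^{-|x|^2/(4(1+t))}$. -/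

import Mathlib

open MeasureTheory
open scoped ContDiff Laplacian ENNReal

noncomputable section

namespace VCHE

/-- The plane `ℝ²` with its Euclidean norm. -/
abbrev Plane : Type := EuclideanSpace ℝ (Fin 2)

/-- `x^⊥ = (-x₂, x₁)`. -/
def perp (x : Plane) : Plane := !₂[-x 1, x 0]

/-- The Biot-Savart operator
`B(w)(x) = (1 / 2π) ∫ (x - y)^⊥ / |x - y|² w(y) dy`. -/
def biotSavart (w : Plane → ℝ) (x : Plane) : Plane :=
  (1 / (2 * Real.pi)) • ∫ y : Plane, (w y / ‖x - y‖ ^ 2) • perp (x - y)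

/-- `g = H_α(f)`: the function `g ∈ L¹(ℝ²)` solves the Helmholtz equation `g - α² Δ g = f`
in the sense of distributions. -/
def IsHelmholtzFilter (α : ℝ) (f g : Plane → ℝ) : Prop :=
  Integrable g ∧
    ∀ φ : Plane → ℝ, ContDiff ℝ ∞ φ → HasCompactSupport φ →
      ∫ x, g x * (φ x - α ^ 2 * (Δ φ) x) = ∫ x, f x * φ x

/-- The fundamental solution of the heat equation in the plane, for `t > 0`. -/
def heatKernel (t : ℝ) (x : Plane) : ℝ :=
  1 / (4 * Real.pi * t) * Real.exp (-‖x‖ ^ 2 / (4 * t))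

/-- `v` is a global mild solution, in `L^∞([0,∞); L¹(ℝ²))`, of the vorticity equation
`v_t + u · ∇v = Δv`, `u = B(H_α(v))`, with initial value `v₀`: for every `t > 0`,
`v(t) = e^{tΔ} v₀ - ∫₀ᵗ ∇Φ(t - s) * [u(s) v(s)] ds`.
The values `v t` for `t < 0` play no role. -/
structure IsMildSolution (α : ℝ) (v₀ : Plane → ℝ) (v : ℝ → Plane → ℝ) : Prop where
  aestronglyMeasurable :
    AEStronglyMeasurable (fun q : ℝ × Plane => v q.1 q.2)
      ((volume.restrict (Set.Ici (0 : ℝ))).prod volume)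
  integrable : ∀ t : ℝ, 0 ≤ t → Integrable (v t)
  bounded : ∃ M : ℝ, ∀ t : ℝ, 0 ≤ t → ∫ x, |v t x| ≤ M
  initial : v 0 =ᵐ[volume] v₀
  duhamel : ∃ w : ℝ → Plane → ℝ,
    (∀ t : ℝ, 0 ≤ t → IsHelmholtzFilter α (v t) (w t)) ∧
    ∀ t : ℝ, 0 < t → ∀ᵐ x : Plane,
      v t x = (∫ y, heatKernel t (x - y) * v₀ y) -
        ∫ s in (0 : ℝ)..t, ∫ y : Plane,
          inner ℝ (gradient (heatKernel (t - s)) (x - y)) (v s y • biotSavart (w s) y)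

/-- The weight `b(ξ) = (1 + |ξ|²)^{1/2}`. -/
def weight (ξ : Plane) : ℝ := √(1 + ‖ξ‖ ^ 2)

/-- Membership in the weighted space `L²(m)` of scalar functions on the plane. -/
def MemWeightedL2 (m : ℕ) (f : Plane → ℝ) : Prop :=
  MemLp f 2 volume ∧ Integrable (fun ξ => weight ξ ^ (2 * m) * |f ξ| ^ 2)

/-- The norm `‖f‖_m = (∫ b^{2m} |f|²)^{1/2}` of `L²(m)`. -/
def weightedNorm (m : ℕ) (f : Plane → ℝ) : ℝ :=
  √(∫ ξ, weight ξ ^ (2 * m) * |f ξ| ^ 2)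

/-- The Oseen vortex `Ω(x,t) = (4π(1+t))⁻¹ exp(-|x|² / (4(1+t)))`, as `oseen t x`. -/
def oseen (t : ℝ) (x : Plane) : ℝ :=
  1 / (4 * Real.pi * (1 + t)) * Real.exp (-‖x‖ ^ 2 / (4 * (1 + t)))

/-- The "un-filtered" Oseen vortex `Ω - α² ΔΩ`. -/
def unfilteredOseen (α t : ℝ) (x : Plane) : ℝ :=
  oseen t x - α ^ 2 * (Δ (oseen t)) x

end VCHE

end

namespace VCHE

/-! ### The heat kernel -/

/-! The filtered Biot–Savart law `f ↦ B(H_α(f))` is convolution with `velocityKernel`, which is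
bounded because the Helmholtz kernel has a bounded Riesz potential
(`lintegral_helmholtzKernel_mul_inv_norm_le`). An `L¹` vorticity therefore produces a bounded
velocity. If the vorticity is also bounded, discarding the filter gives the decaying velocity bound
of the unfiltered law (`enorm_velocity_le_of_bounded`).

Write a solution as `E + ρ` with `E = aΩ`. The vortex `E` is radial, so its velocity is tangential
and its self-interaction in the Duhamel term vanishes; `integral_gradient_heatKernel_radial` proves
this by a reflection. Since `Ω` is itself a heat flow, `ρ` solves the Duhamel equation whose linear
part is the heat flow of the mean-zero data `meanFree v₀` and whose nonlinear part contains only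
products with at least one factor `ρ`.

The mean-zero condition together with a moment of order `2μ`, which the norm of `L²(2)` controls
exactly when `μ < 1/2`, makes the linear part decay by an extra factor `(1+t)^{-μ}`
(`decays_heatFlow_meanFree`). The classes `Decays ν N` record such decay in `L¹` and in sup norm.
The bilinear estimate `Decays.duhamel` adds the exponents of the two factors as long as their sum is
below `1/2`. Pairing `ρ` (exponent `μ`) with `E` (exponent `0`) thus loses no decay, and for small
data a contraction argument gives a remainder in the class of exponent `μ`
(`exists_picard_fixedPoint`).

The estimate must hold for every mild solution, about which only a uniform `L¹` bound is known. The
bounded velocity kernel and the integrable singularity `(t-s)^{-1/2}` suffice for uniqueness in that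
class (`duhamel_solution_unique`), so any solution coincides with the constructed one. The mild
formulation supplies some filtered function `w`; `IsHelmholtzFilter.ae_eq` shows by Fourier analysis
that `w` is determined.

The `L^p` bounds come from interpolation. Near `t = 0` the heat flow of the data is controlled only
in `L¹` and `L²`, so the interpolation stops at `p = 2`. The correction `α²ΔΩ` is smaller than `Ω`
by a factor of order `1/(1+t)` and is absorbed in the error. -/

lemma heatKernel_nonneg {t : ℝ} (ht : 0 ≤ t) (x : Plane) : 0 ≤ heatKernel t x := by
  unfold heatKernel; positivity

lemma heatKernel_le {t : ℝ} (ht : 0 < t) (x : Plane) : heatKernel t x ≤ 1 / (4 * Real.pi * t) := by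
  unfold heatKernel
  refine mul_le_of_le_one_right (by positivity) (Real.exp_le_one_iff.2 ?_)
  exact div_nonpos_of_nonpos_of_nonneg (by simp) (by positivity)

lemma heatKernel_congr (t : ℝ) {x y : Plane} (h : ‖x‖ = ‖y‖) : heatKernel t x = heatKernel t y := by
  simp [heatKernel, h]

lemma measurable_heatKernel_uncurry : Measurable fun q : ℝ × Plane => heatKernel q.1 q.2 := by
  unfold heatKernel; fun_prop

lemma continuous_heatKernel (t : ℝ) : Continuous (heatKernel t) := by
  unfold heatKernel; fun_prop

lemma integral_exp_neg_mul_sq_norm {b : ℝ} (hb : 0 < b) :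
    ∫ x : Plane, Real.exp (-b * ‖x‖ ^ 2) = Real.pi / b := by
  rw [GaussianFourier.integral_rexp_neg_mul_sq_norm hb]; simp

lemma integrable_exp_neg_mul_sq_norm {b : ℝ} (hb : 0 < b) :
    Integrable fun x : Plane => Real.exp (-b * ‖x‖ ^ 2) := by
  refine Integrable.of_integral_ne_zero ?_
  rw [integral_exp_neg_mul_sq_norm hb]; positivity

lemma heatKernel_eq {t : ℝ} (x : Plane) :
    heatKernel t x = 1 / (4 * Real.pi * t) * Real.exp (-(1 / (4 * t)) * ‖x‖ ^ 2) := by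
  unfold heatKernel; congr 2; ring

lemma integrable_heatKernel {t : ℝ} (ht : 0 < t) : Integrable (heatKernel t) := by
  have := (integrable_exp_neg_mul_sq_norm (b := 1 / (4 * t)) (by positivity)).const_mul
    (1 / (4 * Real.pi * t))
  exact this.congr (.of_forall fun x => (heatKernel_eq x).symm)

lemma integral_heatKernel {t : ℝ} (ht : 0 < t) : ∫ x, heatKernel t x = 1 := by
  simp_rw [heatKernel_eq, integral_const_mul]
  rw [integral_exp_neg_mul_sq_norm (by positivity)]
  field_simp

lemma lintegral_heatKernel {t : ℝ} (ht : 0 < t) : ∫⁻ x, ENNReal.ofReal (heatKernel t x) = 1 := by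
  rw [← ofReal_integral_eq_lintegral_ofReal (integrable_heatKernel ht)
    (.of_forall fun x => heatKernel_nonneg ht.le x), integral_heatKernel ht, ENNReal.ofReal_one]

lemma lintegral_heatKernel_sub {t : ℝ} (ht : 0 < t) (y : Plane) :
    ∫⁻ x, ENNReal.ofReal (heatKernel t (x - y)) = 1 := by
  rw [lintegral_sub_right_eq_self (fun x => ENNReal.ofReal (heatKernel t x)),
    lintegral_heatKernel ht]

lemma lintegral_heatKernel_sub_left {t : ℝ} (ht : 0 < t) (x : Plane) :
    ∫⁻ y, ENNReal.ofReal (heatKernel t (x - y)) = 1 := by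
  rw [lintegral_sub_left_eq_self (fun x => ENNReal.ofReal (heatKernel t x)),
    lintegral_heatKernel ht]

/-- Semigroup property of the heat kernel. -/
lemma integral_heatKernel_mul_heatKernel {t s : ℝ} (ht : 0 < t) (hs : 0 < s) (x : Plane) :
    ∫ y, heatKernel t (x - y) * heatKernel s y = heatKernel (t + s) x := by
  have key : ∀ y : Plane, heatKernel t (x - y) * heatKernel s y =
      (1 / (4 * Real.pi * t) * (1 / (4 * Real.pi * s)) * Real.exp (-‖x‖ ^ 2 / (4 * (t + s)))) *
        Real.exp (-((t + s) / (4 * t * s)) * ‖y - (s / (t + s)) • x‖ ^ 2) := by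
    intro y
    -- Completing the square in `y`; what remains is a Gaussian centred at `(s / (t + s)) • x`.
    have e : -‖x - y‖ ^ 2 / (4 * t) + -‖y‖ ^ 2 / (4 * s) = -‖x‖ ^ 2 / (4 * (t + s)) +
        -((t + s) / (4 * t * s)) * ‖y - (s / (t + s)) • x‖ ^ 2 := by
      rw [norm_sub_sq_real, norm_sub_sq_real, norm_smul, inner_smul_right, real_inner_comm,
        Real.norm_eq_abs, mul_pow, sq_abs]
      field_simp
      ring
    unfold heatKernel
    calc _ = 1 / (4 * Real.pi * t) * (1 / (4 * Real.pi * s)) *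
          (Real.exp (-‖x - y‖ ^ 2 / (4 * t)) * Real.exp (-‖y‖ ^ 2 / (4 * s))) := by ring
      _ = _ := by rw [← Real.exp_add, e, Real.exp_add]; ring
  simp_rw [key, integral_const_mul]
  rw [integral_sub_right_eq_self (fun y : Plane => Real.exp (-((t + s) / (4 * t * s)) * ‖y‖ ^ 2)),
    integral_exp_neg_mul_sq_norm (by positivity)]
  unfold heatKernel
  field_simp

lemma hasFDerivAt_heatKernel (t : ℝ) (x : Plane) :
    HasFDerivAt (heatKernel t) (-(heatKernel t x / (2 * t)) • innerSL ℝ x) x := by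
  have h1 : HasFDerivAt (fun y : Plane => ‖y‖ ^ 2) (2 • innerSL ℝ x) x :=
    (hasStrictFDerivAt_norm_sq x).hasFDerivAt
  have h2 := (((h1.const_mul (-1 / (4 * t))).exp).const_mul (1 / (4 * Real.pi * t)))
  have e : heatKernel t =
      fun y : Plane => 1 / (4 * Real.pi * t) * Real.exp (-1 / (4 * t) * ‖y‖ ^ 2) := by
    funext y; unfold heatKernel; congr 2; ring
  rw [e]
  refine h2.congr_fderiv ?_
  ext v
  simp
  ring

lemma gradient_heatKernel (t : ℝ) (x : Plane) :
    gradient (heatKernel t) x = -(heatKernel t x / (2 * t)) • x := by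
  refine HasGradientAt.gradient ?_
  rw [hasGradientAt_iff_hasFDerivAt]
  refine (hasFDerivAt_heatKernel t x).congr_fderiv ?_
  ext v
  simp

lemma measurable_gradient_heatKernel :
    Measurable fun q : ℝ × Plane => gradient (heatKernel q.1) q.2 := by
  simp_rw [gradient_heatKernel]
  exact ((measurable_heatKernel_uncurry.div (by fun_prop)).neg).smul measurable_snd

lemma mul_exp_neg_sq_le {y : ℝ} : y * Real.exp (-y ^ 2 / 8) ≤ 2 := by
  have h := Real.add_one_le_exp (y ^ 2 / 8)
  have h2 : Real.exp (y ^ 2 / 8) * Real.exp (-y ^ 2 / 8) = 1 := by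
    rw [← Real.exp_add]; ring_nf; simp
  have h3 := Real.exp_pos (-y ^ 2 / 8)
  have : y ≤ 2 * Real.exp (y ^ 2 / 8) := by nlinarith [sq_nonneg (y - 2)]
  nlinarith

/-- One half of the Gaussian exponent is kept to absorb polynomial factors; the other half is the
exponential of the heat kernel at time `2t`. -/
lemma exp_heat_split {t : ℝ} (x : Plane) :
    Real.exp (-‖x‖ ^ 2 / (4 * t)) =
      Real.exp (-‖x‖ ^ 2 / (8 * t)) * Real.exp (-‖x‖ ^ 2 / (4 * (2 * t))) := by
  rw [← Real.exp_add]; congr 1; ring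

/-- The factor `‖x‖ / √t` is absorbed by half of the Gaussian. Estimates of `∇Φ * h` thereby reduce
to those of the heat semigroup at time `2t`, at the price of `2 / √t`. -/
lemma norm_gradient_heatKernel_le {t : ℝ} (ht : 0 < t) (x : Plane) :
    ‖gradient (heatKernel t) x‖ ≤ 2 / √t * heatKernel (2 * t) x := by
  rw [gradient_heatKernel, norm_smul, norm_neg, Real.norm_eq_abs,
    abs_of_nonneg (div_nonneg (heatKernel_nonneg ht.le x) (by positivity))]
  have hs : 0 < √t := Real.sqrt_pos.2 ht
  have hs2 : √t ^ 2 = t := Real.sq_sqrt ht.le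
  have h := mul_exp_neg_sq_le (y := ‖x‖ / √t)
  rw [show -(‖x‖ / √t) ^ 2 / 8 = -‖x‖ ^ 2 / (8 * t) by rw [div_pow, hs2]; field_simp] at h
  unfold heatKernel
  rw [exp_heat_split]
  set A := Real.exp (-‖x‖ ^ 2 / (8 * t))
  set E := Real.exp (-‖x‖ ^ 2 / (4 * (2 * t)))
  have hE : 0 < E := Real.exp_pos _
  have : 1 / (4 * Real.pi * t) * (A * E) / (2 * t) * ‖x‖ =
      (‖x‖ / √t * A) * (1 / (4 * Real.pi * t) * E * √t / (2 * t)) := by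
    field_simp
  rw [this]
  refine (mul_le_mul_of_nonneg_right h (by positivity)).trans (le_of_eq ?_)
  field_simp
  nlinarith

lemma contDiff_heatKernel (t : ℝ) : ContDiff ℝ ∞ (heatKernel t) := by
  unfold heatKernel
  exact contDiff_const.mul (((contDiff_norm_sq ℝ).neg.div_const _).exp)

lemma laplacian_heatKernel (t : ℝ) (x : Plane) :
    (Δ (heatKernel t)) x = (‖x‖ ^ 2 / (2 * t) - 2) * (heatKernel t x / (2 * t)) := by
  have hd : DifferentiableAt ℝ (fderiv ℝ (heatKernel t)) x :=
    ((contDiff_heatKernel t).fderiv_right (m := 1) (by norm_cast)).differentiable (by simp) x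
  have h2 : ∀ e : Plane, (fderiv ℝ (fderiv ℝ (heatKernel t)) x e) e =
      -(heatKernel t x / (2 * t)) * inner ℝ e e +
        (heatKernel t x / (2 * t)) / (2 * t) * (inner ℝ e x) ^ 2 := by
    intro e
    have h3 : (fderiv ℝ (fderiv ℝ (heatKernel t)) x e) e =
        fderiv ℝ (fun y => fderiv ℝ (heatKernel t) y e) x e := by
      rw [fderiv_clm_apply hd (by fun_prop)]; simp
    have hf : (fun y => fderiv ℝ (heatKernel t) y e) =
        fun y => (-(2 * t)⁻¹ * heatKernel t y) * innerSL ℝ e y := by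
      funext y
      rw [(hasFDerivAt_heatKernel t y).fderiv]
      simp only [smul_apply, innerSL_apply_apply, smul_eq_mul, real_inner_comm y e]
      ring
    have h4 : HasFDerivAt (fun y => (-(2 * t)⁻¹ * heatKernel t y) * innerSL ℝ e y) _ x :=
      ((hasFDerivAt_heatKernel t x).const_mul (-(2 * t)⁻¹)).mul
      (innerSL ℝ e).hasFDerivAt
    rw [h3, hf, h4.fderiv]
    simp only [add_apply, smul_apply, innerSL_apply_apply, smul_eq_mul, real_inner_comm x e]
    ring
  rw [InnerProductSpace.laplacian_eq_iteratedFDeriv_orthonormalBasis _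
    (EuclideanSpace.basisFun (Fin 2) ℝ)]
  simp only [iteratedFDeriv_two_apply]
  simp [h2, Fin.sum_univ_two, EuclideanSpace.norm_sq_eq, EuclideanSpace.inner_single_left]
  ring

lemma abs_laplacian_heatKernel_le {t : ℝ} (ht : 0 < t) (x : Plane) :
    |(Δ (heatKernel t)) x| ≤ 10 / t * heatKernel (2 * t) x := by
  rw [laplacian_heatKernel]
  set z := ‖x‖ ^ 2 / (8 * t) with hz
  have hz0 : 0 ≤ z := by positivity
  have h1 : ‖x‖ ^ 2 / (2 * t) = 4 * z := by rw [hz]; field_simp; ring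
  have h2 : heatKernel t x = 2 * Real.exp (-z) * heatKernel (2 * t) x := by
    unfold heatKernel
    rw [exp_heat_split, hz, neg_div]
    field_simp
  have hk := heatKernel_nonneg (t := 2 * t) (by positivity) x
  rw [h1, h2, abs_mul,
    abs_of_nonneg (by positivity : 0 ≤ 2 * Real.exp (-z) * heatKernel (2 * t) x / (2 * t))]
  have h3 : |4 * z - 2| * Real.exp (-z) ≤ 10 := by
    have ha : |4 * z - 2| ≤ 4 * (z + 1) := by rw [abs_le]; constructor <;> linarith
    have hb := Real.add_one_le_exp z
    have hc : Real.exp z * Real.exp (-z) = 1 := by rw [← Real.exp_add]; simp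
    nlinarith [Real.exp_pos (-z)]
  calc _ = (|4 * z - 2| * Real.exp (-z)) * (heatKernel (2 * t) x / t) := by field_simp
    _ ≤ 10 * (heatKernel (2 * t) x / t) := by gcongr
    _ = _ := by ring

lemma oseen_eq (t : ℝ) : oseen t = heatKernel (1 + t) := rfl

/-! ### The Riesz potential of order one in the plane -/

/-- The perimeter of the unit circle, as twice the area of the unit disc. -/
noncomputable def circleLength : ℝ := 2 * volume.real (Metric.ball (0 : Plane) 1)

lemma circleLength_nonneg : 0 ≤ circleLength := by unfold circleLength; positivity

lemma lintegral_inv_norm_ball {R : ℝ} (hR : 0 < R) :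
    ∫⁻ y : Plane, ENNReal.ofReal ((Set.Iio R).indicator (fun r => r⁻¹) ‖y‖) =
      ENNReal.ofReal (circleLength * R) := by
  set f : ℝ → ℝ := (Set.Iio R).indicator fun r => r⁻¹
  -- In polar coordinates of the plane the Jacobian `r` cancels the singularity `r⁻¹`.
  have e : Set.EqOn (fun y : ℝ => y ^ (Module.finrank ℝ Plane - 1) • f y)
      ((Set.Ioo 0 R).indicator fun _ => (1 : ℝ)) (Set.Ioi 0) := by
    intro y hy
    have hy : 0 < y := hy
    by_cases h : y < R
    · simp [f, h, hy, hy.ne']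
    · simp [f, h]
  have hi : Integrable fun y : Plane => f ‖y‖ := by
    rw [integrable_fun_norm_addHaar (E := Plane) volume (f := f),
      integrableOn_congr_fun e measurableSet_Ioi]
    refine Integrable.integrableOn ?_
    rw [integrable_indicator_iff measurableSet_Ioo]
    simp [IntegrableOn]
  have hp : ∀ y : Plane, 0 ≤ f ‖y‖ := fun y => Set.indicator_apply_nonneg fun _ => by simp
  rw [← ofReal_integral_eq_lintegral_ofReal hi (.of_forall hp),
    integral_fun_norm_addHaar (E := Plane) volume f, setIntegral_congr_fun measurableSet_Ioi e,
    setIntegral_indicator measurableSet_Ioo, Set.inter_eq_right.2 Set.Ioo_subset_Ioi_self]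
  simp [circleLength, hR.le]
  ring_nf

/-- The Riesz potential of a function in `L¹ ∩ L^∞` is bounded. -/
lemma lintegral_mul_inv_norm_le {w : Plane → ℝ≥0∞} {A : ℝ≥0∞} (hA : ∀ y, w y ≤ A)
    {R : ℝ} (hR : 0 < R) (x : Plane) :
    ∫⁻ y, w y * ENNReal.ofReal ‖x - y‖⁻¹ ≤
      A * ENNReal.ofReal (circleLength * R) + (∫⁻ y, w y) * ENNReal.ofReal R⁻¹ := by
  have hm : Measurable fun y : Plane =>
      A * ENNReal.ofReal ((Set.Iio R).indicator (fun r => r⁻¹) ‖x - y‖) := by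
    refine Measurable.const_mul (ENNReal.measurable_ofReal.comp ?_) A
    exact (measurable_inv.indicator measurableSet_Iio).comp (by fun_prop)
  -- Inside the disc of radius `R` about `x` the sup bound is used, outside it the total mass; `R`
  -- stays free so that the two can be balanced.
  calc _ ≤ ∫⁻ y, (A * ENNReal.ofReal ((Set.Iio R).indicator (fun r => r⁻¹) ‖x - y‖) +
        w y * ENNReal.ofReal R⁻¹) := by
        refine lintegral_mono fun y => ?_
        by_cases h : ‖x - y‖ < R
        · refine le_add_right ?_
          rw [Set.indicator_of_mem (by exact h)]
          gcongr; exact hA y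
        · refine le_add_left ?_
          push Not at h
          gcongr
    _ = _ := by
        rw [lintegral_add_left hm, lintegral_mul_const' _ _ ENNReal.ofReal_ne_top]
        congr 1
        rw [lintegral_const_mul _ (by
          refine ENNReal.measurable_ofReal.comp ?_
          exact (measurable_inv.indicator measurableSet_Iio).comp (by fun_prop))]
        rw [lintegral_sub_left_eq_self (fun y : Plane =>
          ENNReal.ofReal ((Set.Iio R).indicator (fun r => r⁻¹) ‖y‖)), lintegral_inv_norm_ball hR]

/-- The radius `R = √t` balances the sup bound `1 / (4πt)` against the mass `1`. -/
lemma lintegral_heatKernel_mul_inv_norm_le {t : ℝ} (ht : 0 < t) (x : Plane) :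
    ∫⁻ y, ENNReal.ofReal (heatKernel t y) * ENNReal.ofReal ‖x - y‖⁻¹ ≤
      ENNReal.ofReal ((circleLength + 1) / √t) := by
  have hs : 0 < √t := Real.sqrt_pos.2 ht
  refine (lintegral_mul_inv_norm_le (A := ENNReal.ofReal (1 / (4 * Real.pi * t)))
    (fun y => ENNReal.ofReal_le_ofReal (heatKernel_le ht y)) hs x).trans ?_
  have hc := circleLength_nonneg
  rw [lintegral_heatKernel ht, one_mul, ← ENNReal.ofReal_mul (by positivity),
    ← ENNReal.ofReal_add (by positivity) (by positivity)]
  refine ENNReal.ofReal_le_ofReal ?_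
  rw [add_div, one_div (√t)]
  gcongr
  rw [le_div_iff₀ hs]
  have h2 : √t * √t = t := Real.mul_self_sqrt ht.le
  have : 1 / (4 * Real.pi * t) * (circleLength * √t) * √t = circleLength * (1 / (4 * Real.pi)) := by
    rw [mul_assoc, mul_assoc circleLength, h2]; field_simp
  rw [this]
  refine mul_le_of_le_one_right hc ?_
  rw [div_le_one (by positivity)]
  linarith [Real.pi_gt_three]

/-! ### The Helmholtz kernel -/

/-- The fundamental solution of `g - α² Δ g`, as a superposition of heat kernels. -/
noncomputable def helmholtzKernel (α : ℝ) (x : Plane) : ℝ :=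
  ∫ s in Set.Ioi (0 : ℝ), Real.exp (-s) * heatKernel (α ^ 2 * s) x

lemma measurable_helmholtz_integrand (α : ℝ) :
    Measurable fun q : Plane × ℝ => Real.exp (-q.2) * heatKernel (α ^ 2 * q.2) q.1 := by
  refine Measurable.mul (by fun_prop) ?_
  exact measurable_heatKernel_uncurry.comp
    (((measurable_snd.const_mul (α ^ 2))).prodMk measurable_fst)

lemma measurable_helmholtzKernel (α : ℝ) : Measurable (helmholtzKernel α) :=
  (StronglyMeasurable.integral_prod_right' (ν := volume.restrict (Set.Ioi (0 : ℝ)))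
    (measurable_helmholtz_integrand α).stronglyMeasurable).measurable

lemma helmholtzKernel_nonneg (α : ℝ) (x : Plane) : 0 ≤ helmholtzKernel α x := by
  refine setIntegral_nonneg measurableSet_Ioi fun s hs => ?_
  exact mul_nonneg (Real.exp_nonneg _) (heatKernel_nonneg (by have : 0 < s := hs; positivity) x)

lemma helmholtzKernel_congr (α : ℝ) {x y : Plane} (h : ‖x‖ = ‖y‖) :
    helmholtzKernel α x = helmholtzKernel α y := by
  simp [helmholtzKernel, heatKernel_congr _ h]

lemma lintegral_exp_neg : ∫⁻ s in Set.Ioi (0 : ℝ), ENNReal.ofReal (Real.exp (-s)) = 1 := by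
  rw [← ofReal_integral_eq_lintegral_ofReal (integrableOn_exp_neg_Ioi 0)
    (.of_forall fun s => Real.exp_nonneg _), integral_exp_neg_Ioi_zero, ENNReal.ofReal_one]

/-- Tonelli. Only an inequality is stated: for `α ≠ 0` the `s`-integral diverges at the origin,
where the Bochner integral is zero by convention, and the upper bound needs no convergence. -/
lemma lintegral_helmholtzKernel_mul_le (α : ℝ) {F : Plane → ℝ≥0∞} (hF : Measurable F) :
    ∫⁻ y, ENNReal.ofReal (helmholtzKernel α y) * F y ≤
      ∫⁻ s in Set.Ioi (0 : ℝ), ENNReal.ofReal (Real.exp (-s)) *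
        ∫⁻ y, ENNReal.ofReal (heatKernel (α ^ 2 * s) y) * F y := by
  calc _ ≤ ∫⁻ y, ∫⁻ s in Set.Ioi (0 : ℝ), ENNReal.ofReal (Real.exp (-s)) *
          (ENNReal.ofReal (heatKernel (α ^ 2 * s) y) * F y) := by
        refine lintegral_mono fun y => ?_
        have hm : Measurable fun s : ℝ => Real.exp (-s) * heatKernel (α ^ 2 * s) y :=
          (measurable_helmholtz_integrand α).comp (measurable_const.prodMk measurable_id)
        simp_rw [← mul_assoc]
        rw [lintegral_mul_const _ (by
          refine (by fun_prop : Measurable fun s : ℝ => ENNReal.ofReal (Real.exp (-s))).mul ?_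
          exact ENNReal.measurable_ofReal.comp (measurable_heatKernel_uncurry.comp
            ((measurable_id.const_mul (α ^ 2)).prodMk measurable_const)))]
        gcongr
        rw [← Real.enorm_of_nonneg (helmholtzKernel_nonneg α y)]
        refine (enorm_integral_le_lintegral_enorm _).trans (le_of_eq ?_)
        refine setLIntegral_congr_fun measurableSet_Ioi fun s hs => ?_
        have hs : 0 < s := hs
        rw [Real.enorm_of_nonneg (mul_nonneg (Real.exp_nonneg _)
          (heatKernel_nonneg (by positivity) y)), ENNReal.ofReal_mul (Real.exp_nonneg _)]
    _ = _ := by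
        rw [lintegral_lintegral_swap]
        · refine lintegral_congr fun s => ?_
          rw [lintegral_const_mul' _ _ ENNReal.ofReal_ne_top]
        · refine Measurable.aemeasurable ?_
          refine Measurable.mul (by fun_prop) (Measurable.mul ?_ (hF.comp measurable_fst))
          exact ENNReal.measurable_ofReal.comp (measurable_heatKernel_uncurry.comp
            (((measurable_snd.const_mul (α ^ 2))).prodMk measurable_fst))

lemma lintegral_helmholtzKernel_le {α : ℝ} (hα : 0 < α) :
    ∫⁻ y, ENNReal.ofReal (helmholtzKernel α y) ≤ 1 := by
  have h := lintegral_helmholtzKernel_mul_le α (F := fun _ => 1) measurable_const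
  simp only [mul_one] at h
  refine h.trans (le_of_eq ?_)
  rw [← lintegral_exp_neg]
  refine setLIntegral_congr_fun measurableSet_Ioi fun s hs => ?_
  have hs : 0 < s := hs
  rw [lintegral_heatKernel (by positivity), mul_one]

lemma integrable_helmholtzKernel {α : ℝ} (hα : 0 < α) : Integrable (helmholtzKernel α) := by
  refine ⟨(measurable_helmholtzKernel α).aestronglyMeasurable, ?_⟩
  rw [hasFiniteIntegral_iff_ofReal (.of_forall (helmholtzKernel_nonneg α))]
  exact (lintegral_helmholtzKernel_le hα).trans_lt (by simp)

/-- A bound for the Riesz potential of the Helmholtz kernel. -/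
noncomputable def helmholtzRieszBound (α : ℝ) : ℝ :=
  ∫ s in Set.Ioi (0 : ℝ), (circleLength + 1) / α * (Real.exp (-s) * s ^ ((1 / 2 : ℝ) - 1))

lemma helmholtzRieszBound_nonneg {α : ℝ} (hα : 0 < α) : 0 ≤ helmholtzRieszBound α := by
  refine setIntegral_nonneg measurableSet_Ioi fun s hs => ?_
  have hs : 0 < s := hs
  have := circleLength_nonneg
  positivity

/-- The heat kernel at time `α² s` contributes a multiple of `s^{-1/2}`, which `e^{-s}` integrates
to a finite Gamma integral, uniformly in `x`. This is the smoothing due to the filter, and it makes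
the velocity kernel bounded. -/
lemma lintegral_helmholtzKernel_mul_inv_norm_le {α : ℝ} (hα : 0 < α) (x : Plane) :
    ∫⁻ y, ENNReal.ofReal (helmholtzKernel α y) * ENNReal.ofReal ‖x - y‖⁻¹ ≤
      ENNReal.ofReal (helmholtzRieszBound α) := by
  have hc := circleLength_nonneg
  refine (lintegral_helmholtzKernel_mul_le α (by fun_prop)).trans ?_
  rw [helmholtzRieszBound, ofReal_integral_eq_lintegral_ofReal]
  · refine setLIntegral_mono' measurableSet_Ioi fun s hs => ?_
    have hs : 0 < s := hs
    refine (mul_le_mul_right (lintegral_heatKernel_mul_inv_norm_le (by positivity) x) _).trans ?_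
    rw [← ENNReal.ofReal_mul (Real.exp_nonneg _)]
    refine ENNReal.ofReal_le_ofReal (le_of_eq ?_)
    rw [Real.sqrt_mul (by positivity), Real.sqrt_sq hα.le,
      show (1 / 2 : ℝ) - 1 = -(1 / 2) by norm_num, Real.rpow_neg hs.le, ← Real.sqrt_eq_rpow]
    field_simp
  · exact (Real.GammaIntegral_convergent (by norm_num)).const_mul _
  · filter_upwards [ae_restrict_mem measurableSet_Ioi] with s hs
    have hs : 0 < s := hs
    simp only [Pi.zero_apply]
    positivity

/-! ### The velocity field -/

lemma norm_perp (x : Plane) : ‖perp x‖ = ‖x‖ := by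
  simp [EuclideanSpace.norm_eq, perp, Fin.sum_univ_two, add_comm]

lemma measurable_perp : Measurable perp := by
  have : Continuous perp := by
    unfold perp
    fun_prop
  exact this.measurable

lemma enorm_biotSavart_integrand (c : ℝ) (z : Plane) :
    ‖(c / ‖z‖ ^ 2) • perp z‖ₑ = ‖c‖ₑ * ENNReal.ofReal ‖z‖⁻¹ := by
  rw [← ofReal_norm, ← ofReal_norm, ← ENNReal.ofReal_mul (norm_nonneg _),
    norm_smul, norm_perp, norm_div, norm_pow, norm_norm]
  congr 1
  by_cases h : ‖z‖ = 0
  · simp [h]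
  · field_simp

lemma measurable_biotSavart_integrand {w : Plane → ℝ} (hw : Measurable w) :
    Measurable fun q : Plane × Plane => (w q.2 / ‖q.1 - q.2‖ ^ 2) • perp (q.1 - q.2) := by
  have h : Measurable fun q : Plane × Plane => w q.2 / ‖q.1 - q.2‖ ^ 2 :=
    (hw.comp measurable_snd).div (by fun_prop)
  exact h.smul (measurable_perp.comp (measurable_fst.sub measurable_snd))

lemma measurable_biotSavart {w : Plane → ℝ} (hw : Measurable w) : Measurable (biotSavart w) := by
  unfold biotSavart
  refine Measurable.const_smul (c := 1 / (2 * Real.pi)) ?_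
  exact (StronglyMeasurable.integral_prod_right'
    (measurable_biotSavart_integrand hw).stronglyMeasurable).measurable

/-- The convolution kernel of `f ↦ B(H_α(f))`. -/
noncomputable def velocityKernel (α : ℝ) : Plane → Plane := biotSavart (helmholtzKernel α)

lemma measurable_velocityKernel (α : ℝ) : Measurable (velocityKernel α) :=
  measurable_biotSavart (measurable_helmholtzKernel α)

lemma enorm_two_pi_inv_le : ‖1 / (2 * Real.pi)‖ₑ ≤ 1 := by
  rw [Real.enorm_of_nonneg (by positivity), ENNReal.ofReal_le_one, div_le_one (by positivity)]
  linarith [Real.pi_gt_three]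

lemma enorm_velocityKernel_le (α : ℝ) (x : Plane) :
    ‖velocityKernel α x‖ₑ ≤
      ∫⁻ y, ENNReal.ofReal (helmholtzKernel α y) * ENNReal.ofReal ‖x - y‖⁻¹ := by
  rw [velocityKernel, biotSavart, enorm_smul]
  refine (mul_le_of_le_one_left' enorm_two_pi_inv_le).trans ?_
  refine (enorm_integral_le_lintegral_enorm _).trans (le_of_eq ?_)
  refine lintegral_congr fun y => ?_
  rw [enorm_biotSavart_integrand, Real.enorm_of_nonneg (helmholtzKernel_nonneg α y)]

lemma enorm_velocityKernel_le_const {α : ℝ} (hα : 0 < α) (x : Plane) :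
    ‖velocityKernel α x‖ₑ ≤ ENNReal.ofReal (helmholtzRieszBound α) :=
  (enorm_velocityKernel_le α x).trans (lintegral_helmholtzKernel_mul_inv_norm_le hα x)

/-- The velocity field `B(H_α(f))` generated by the vorticity `f`. -/
noncomputable def velocity (α : ℝ) (f : Plane → ℝ) (x : Plane) : Plane :=
  ∫ z, f z • velocityKernel α (x - z)

lemma integrable_velocity_integrand {α : ℝ} (hα : 0 < α) {f : Plane → ℝ} (hf : Integrable f)
    (x : Plane) : Integrable fun z => f z • velocityKernel α (x - z) := by
  refine Integrable.smul_bdd hf (C := helmholtzRieszBound α) ?_ ?_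
  · exact ((measurable_velocityKernel α).comp (by fun_prop)).aestronglyMeasurable
  · refine .of_forall fun z => ?_
    have := enorm_velocityKernel_le_const hα (x - z)
    rwa [← ofReal_norm, ENNReal.ofReal_le_ofReal_iff (helmholtzRieszBound_nonneg hα)]
      at this

lemma velocity_congr_ae {α : ℝ} {f g : Plane → ℝ} (h : f =ᵐ[volume] g) :
    velocity α f = velocity α g := by
  funext x
  refine integral_congr_ae ?_
  filter_upwards [h] with z hz
  rw [hz]

/-- The velocity bound that needs only `L¹` vorticity. It serves for short times and for uniqueness,
but carries no gain in time over the `L¹` norm. -/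
lemma enorm_velocity_le {α : ℝ} (hα : 0 < α) (f : Plane → ℝ) (x : Plane) :
    ‖velocity α f x‖ₑ ≤ ENNReal.ofReal (helmholtzRieszBound α) * ∫⁻ z, ‖f z‖ₑ := by
  refine (enorm_integral_le_lintegral_enorm _).trans ?_
  rw [← lintegral_const_mul' _ _ ENNReal.ofReal_ne_top]
  refine lintegral_mono fun z => ?_
  rw [enorm_smul, mul_comm]
  gcongr
  exact enorm_velocityKernel_le_const hα _

/-- The filter averages Riesz potentials against a kernel of mass at most one, so it can be dropped
and the unfiltered bound survives. With `R = √t` this gives the large-time decay of the velocity. -/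
lemma enorm_velocity_le_of_bounded {α : ℝ} (hα : 0 < α) {f : Plane → ℝ} (hf : Measurable f)
    {A : ℝ≥0∞} (hA : ∀ x, ‖f x‖ₑ ≤ A) {R : ℝ} (hR : 0 < R) (x : Plane) :
    ‖velocity α f x‖ₑ ≤
      A * ENNReal.ofReal (circleLength * R) + (∫⁻ y, ‖f y‖ₑ) * ENNReal.ofReal R⁻¹ := by
  refine (enorm_integral_le_lintegral_enorm _).trans ?_
  calc _ ≤ ∫⁻ z, ∫⁻ y, ENNReal.ofReal (helmholtzKernel α y) *
          (‖f z‖ₑ * ENNReal.ofReal ‖x - y - z‖⁻¹) := by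
        refine lintegral_mono fun z => ?_
        rw [enorm_smul]
        refine (mul_le_mul_right (enorm_velocityKernel_le α (x - z)) _).trans (le_of_eq ?_)
        rw [← lintegral_const_mul' _ _ enorm_ne_top]
        refine lintegral_congr fun y => ?_
        rw [mul_left_comm, sub_right_comm]
    _ = ∫⁻ y, ENNReal.ofReal (helmholtzKernel α y) *
          ∫⁻ z, ‖f z‖ₑ * ENNReal.ofReal ‖x - y - z‖⁻¹ := by
        rw [lintegral_lintegral_swap]
        · refine lintegral_congr fun y => ?_
          rw [lintegral_const_mul' _ _ ENNReal.ofReal_ne_top]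
        · refine Measurable.aemeasurable ?_
          have h : Measurable fun q : Plane × Plane => ENNReal.ofReal ‖x - q.2 - q.1‖⁻¹ := by
            fun_prop
          exact ((measurable_helmholtzKernel α).comp measurable_snd).ennreal_ofReal.mul
            ((hf.comp measurable_fst).enorm.mul h)
    _ ≤ ∫⁻ y, ENNReal.ofReal (helmholtzKernel α y) *
          (A * ENNReal.ofReal (circleLength * R) + (∫⁻ y, ‖f y‖ₑ) * ENNReal.ofReal R⁻¹) := by
        refine lintegral_mono fun y => mul_le_mul_right ?_ _
        exact lintegral_mul_inv_norm_le hA hR (x - y)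
    _ ≤ _ := by
        rw [lintegral_mul_const _ (measurable_helmholtzKernel α).ennreal_ofReal]
        exact mul_le_of_le_one_left' (lintegral_helmholtzKernel_le hα)

lemma measurable_velocity {α : ℝ} {β : Type*} [MeasurableSpace β] {f : β × Plane → ℝ}
    (hf : Measurable f) : Measurable fun q : β × Plane => velocity α (fun y => f (q.1, y)) q.2 := by
  refine (StronglyMeasurable.integral_prod_right' (ν := volume)
    (f := fun p : (β × Plane) × Plane => f (p.1.1, p.2) • velocityKernel α (p.1.2 - p.2))
    (Measurable.stronglyMeasurable ?_)).measurable
  exact (hf.comp (by fun_prop)).smul ((measurable_velocityKernel α).comp (by fun_prop))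

lemma velocity_sub {α : ℝ} (hα : 0 < α) {f g : Plane → ℝ} (hf : Integrable f) (hg : Integrable g)
    (x : Plane) : velocity α (fun y => f y - g y) x = velocity α f x - velocity α g x := by
  unfold velocity
  rw [← integral_sub (integrable_velocity_integrand hα hf x)
    (integrable_velocity_integrand hα hg x)]
  simp_rw [sub_smul]

/-! ### The Helmholtz equation -/

section Helmholtz

open scoped FourierTransform SchwartzMap Convolution

/-- The solution `H_α(f)` of `g - α² Δ g = f`, by convolution with the Helmholtz kernel. -/
noncomputable def helmholtzFilter (α : ℝ) (f : Plane → ℝ) (x : Plane) : ℝ :=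
  ∫ y, f y * helmholtzKernel α (x - y)

lemma helmholtzFilter_eq_convolution (α : ℝ) (f : Plane → ℝ) :
    helmholtzFilter α f = f ⋆[ContinuousLinearMap.mul ℝ ℝ] helmholtzKernel α := rfl

lemma integrable_helmholtzFilter {α : ℝ} (hα : 0 < α) {f : Plane → ℝ} (hf : Integrable f) :
    Integrable (helmholtzFilter α f) :=
  hf.integrable_convolution (ContinuousLinearMap.mul ℝ ℝ) (integrable_helmholtzKernel hα)

lemma ofReal_convolution (f g : Plane → ℝ) :
    (fun x => (f x : ℂ)) ⋆[ContinuousLinearMap.mul ℂ ℂ] (fun x => (g x : ℂ)) =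
      fun x => (((f ⋆[ContinuousLinearMap.mul ℝ ℝ] g) x : ℝ) : ℂ) := by
  funext x
  simp only [convolution_def, ContinuousLinearMap.mul_apply']
  rw [← integral_complex_ofReal]
  simp

lemma fourier_heatKernel {t : ℝ} (ht : 0 < t) (ξ : Plane) :
    𝓕 (fun x => (heatKernel t x : ℂ)) ξ = Real.exp (-(4 * Real.pi ^ 2 * t * ‖ξ‖ ^ 2)) := by
  have hb : 0 < ((1 / (4 * t) : ℝ) : ℂ).re := by simp; positivity
  have h := fourier_gaussian_innerProductSpace hb ξ
  have e : (fun x : Plane => (heatKernel t x : ℂ)) = ((1 / (4 * Real.pi * t) : ℝ) : ℂ) •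
      fun x : Plane => Complex.exp (-((1 / (4 * t) : ℝ) : ℂ) * (‖x‖ : ℂ) ^ 2) := by
    funext x
    rw [heatKernel_eq]
    simp
  have hsm : 𝓕 (((1 / (4 * Real.pi * t) : ℝ) : ℂ) •
      fun x : Plane => Complex.exp (-((1 / (4 * t) : ℝ) : ℂ) * (‖x‖ : ℂ) ^ 2)) ξ =
      ((1 / (4 * Real.pi * t) : ℝ) : ℂ) *
        𝓕 (fun x : Plane => Complex.exp (-((1 / (4 * t) : ℝ) : ℂ) * (‖x‖ : ℂ) ^ 2)) ξ := by
    simp only [Real.fourier_eq, Pi.smul_apply, smul_eq_mul, ← integral_const_mul]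
    refine integral_congr_ae (.of_forall fun x => ?_)
    simp only [Circle.smul_def, smul_eq_mul]
    ring
  rw [e, hsm, h]
  have ht' : (t : ℂ) ≠ 0 := by exact_mod_cast ht.ne'
  have hpi : (Real.pi : ℂ) ≠ 0 := by exact_mod_cast Real.pi_ne_zero
  have e2 : Complex.exp (-(Real.pi : ℂ) ^ 2 * (‖ξ‖ : ℂ) ^ 2 / ((1 / (4 * t) : ℝ) : ℂ)) =
      Real.exp (-(4 * Real.pi ^ 2 * t * ‖ξ‖ ^ 2)) := by
    push_cast
    congr 1
    field_simp
  rw [e2]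
  simp
  field_simp

lemma integral_exp_neg_mul_Ioi {c : ℝ} (hc : 0 < c) :
    ∫ s in Set.Ioi (0 : ℝ), Real.exp (-(c * s)) = 1 / c := by
  have := integral_exp_mul_Ioi (a := -c) (by linarith) 0
  simpa [neg_mul] using this

/-- By Fubini the transform is `∫ e^{-s} e^{-4π²α²s|ξ|²} ds`, the inverse of the symbol of `1 -
α²Δ`. -/
lemma fourier_helmholtzKernel {α : ℝ} (hα : 0 < α) (ξ : Plane) :
    𝓕 (fun x => (helmholtzKernel α x : ℂ)) ξ =
      ((1 / (1 + 4 * Real.pi ^ 2 * α ^ 2 * ‖ξ‖ ^ 2) : ℝ) : ℂ) := by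
  have hm := measurable_helmholtz_integrand α
  have hi : Integrable (fun q : Plane × ℝ => Real.exp (-q.2) * heatKernel (α ^ 2 * q.2) q.1)
      (volume.prod (volume.restrict (Set.Ioi (0 : ℝ)))) := by
    refine ⟨hm.aestronglyMeasurable, ?_⟩
    rw [hasFiniteIntegral_iff_enorm, lintegral_prod_symm _ hm.enorm.aemeasurable]
    refine lt_of_eq_of_lt (b := 1) ?_ (by simp)
    rw [← lintegral_exp_neg]
    refine setLIntegral_congr_fun measurableSet_Ioi fun s hs => ?_
    have hs : 0 < s := hs
    have : ∀ x : Plane, ‖Real.exp (-s) * heatKernel (α ^ 2 * s) x‖ₑ =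
        ENNReal.ofReal (Real.exp (-s)) * ENNReal.ofReal (heatKernel (α ^ 2 * s) x) := fun x => by
      rw [Real.enorm_of_nonneg (mul_nonneg (Real.exp_nonneg _)
        (heatKernel_nonneg (by positivity) x)), ENNReal.ofReal_mul (Real.exp_nonneg _)]
    simp_rw [this]
    rw [lintegral_const_mul' _ _ ENNReal.ofReal_ne_top, lintegral_heatKernel (by positivity),
      mul_one]
  have hc : Continuous fun x : Plane => ((𝐞 (-(inner ℝ x ξ)) : Circle) : ℂ) := by
    have := Real.continuous_fourierChar
    fun_prop
  have hi2 : Integrable (fun q : Plane × ℝ => ((𝐞 (-(inner ℝ q.1 ξ)) : Circle) : ℂ) *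
      ((Real.exp (-q.2) * heatKernel (α ^ 2 * q.2) q.1 : ℝ) : ℂ))
      (volume.prod (volume.restrict (Set.Ioi (0 : ℝ)))) := by
    refine hi.ofReal.bdd_mul (c := 1)
      ((hc.comp continuous_fst).measurable.aestronglyMeasurable)
      (.of_forall fun q => (Circle.norm_coe _).le)
  calc _ = ∫ x : Plane, ∫ s in Set.Ioi (0 : ℝ), ((𝐞 (-(inner ℝ x ξ)) : Circle) : ℂ) *
        ((Real.exp (-s) * heatKernel (α ^ 2 * s) x : ℝ) : ℂ) := by
        rw [Real.fourier_eq]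
        refine integral_congr_ae (.of_forall fun x => ?_)
        simp only [integral_const_mul, Circle.smul_def, smul_eq_mul]
        rw [helmholtzKernel, ← integral_complex_ofReal]
    _ = ∫ s in Set.Ioi (0 : ℝ), ∫ x : Plane, ((𝐞 (-(inner ℝ x ξ)) : Circle) : ℂ) *
        ((Real.exp (-s) * heatKernel (α ^ 2 * s) x : ℝ) : ℂ) := integral_integral_swap hi2
    _ = ∫ s in Set.Ioi (0 : ℝ),
        ((Real.exp (-((1 + 4 * Real.pi ^ 2 * α ^ 2 * ‖ξ‖ ^ 2) * s)) : ℝ) : ℂ) := by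
        refine setIntegral_congr_fun measurableSet_Ioi fun s hs => ?_
        have hs : 0 < s := hs
        have h := fourier_heatKernel (t := α ^ 2 * s) (by positivity) ξ
        rw [Real.fourier_eq] at h
        simp only [Circle.smul_def, smul_eq_mul] at h
        push_cast
        simp_rw [mul_left_comm _ (Complex.exp _), integral_const_mul]
        rw [h]
        push_cast
        rw [← Complex.exp_add]
        congr 1
        ring
    _ = _ := by
        rw [integral_complex_ofReal, integral_exp_neg_mul_Ioi (by positivity)]

lemma fourier_sub_laplacian (α : ℝ) (φ : 𝓢(Plane, ℂ)) (ξ : Plane) :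
    𝓕 (φ - (α ^ 2 : ℝ) • Δ φ) ξ = ((1 + 4 * Real.pi ^ 2 * α ^ 2 * ‖ξ‖ ^ 2 : ℝ) : ℂ) * 𝓕 φ ξ := by
  have h1 : 𝓕 (Δ φ) = (-(2 * Real.pi) ^ 2 : ℝ) •
      SchwartzMap.smulLeftCLM ℂ (fun x : Plane => ‖x‖ ^ 2) (𝓕 φ) := by
    rw [SchwartzMap.laplacian_eq_fourierMultiplierCLM, SchwartzMap.fourierMultiplierCLM_apply,
      FourierTransform.fourier_smul, FourierTransform.fourier_fourierInv_eq]
  have h2 : 𝓕 (φ - (α ^ 2 : ℝ) • Δ φ) = 𝓕 φ - (α ^ 2 : ℝ) • 𝓕 (Δ φ) := by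
    rw [sub_eq_add_neg, ← neg_smul, FourierTransform.fourier_add, FourierTransform.fourier_smul,
      neg_smul, ← sub_eq_add_neg]
  rw [h2, h1]
  simp only [sub_apply, smul_apply]
  rw [SchwartzMap.smulLeftCLM_apply_apply (by fun_prop)]
  simp only [Complex.real_smul]
  push_cast
  ring

/-- A real test function, as a complex Schwartz function. -/
noncomputable def testToSchwartz (φ : Plane → ℝ) (h : ContDiff ℝ ∞ φ) (hc : HasCompactSupport φ) :
    𝓢(Plane, ℂ) :=
  HasCompactSupport.toSchwartzMap (f := fun x => (φ x : ℂ)) (hc.comp_left (g := Complex.ofReal) rfl)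
    (Complex.ofRealCLM.contDiff.comp h)

lemma testToSchwartz_apply (φ : Plane → ℝ) (h : ContDiff ℝ ∞ φ) (hc : HasCompactSupport φ)
    (x : Plane) : testToSchwartz φ h hc x = φ x := rfl

lemma laplacian_testToSchwartz (φ : Plane → ℝ) (h : ContDiff ℝ ∞ φ) (hc : HasCompactSupport φ)
    (x : Plane) : (Δ (testToSchwartz φ h hc)) x = ((Δ φ) x : ℂ) := by
  rw [SchwartzMap.laplacian_apply]
  exact ContDiffAt.laplacian_CLM_comp_left (l := Complex.ofRealCLM)
    (h.contDiffAt.of_le (by norm_cast))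

lemma sub_laplacian_testToSchwartz (α : ℝ) (φ : Plane → ℝ) (h : ContDiff ℝ ∞ φ)
    (hc : HasCompactSupport φ) (x : Plane) :
    (testToSchwartz φ h hc - (α ^ 2 : ℝ) • Δ (testToSchwartz φ h hc)) x =
      ((φ x - α ^ 2 * (Δ φ) x : ℝ) : ℂ) := by
  simp only [sub_apply, smul_apply]
  rw [laplacian_testToSchwartz, testToSchwartz_apply]
  simp

/-- The test function is written as the Fourier transform of its inverse transform, and the
transform is moved onto `f`. This makes the weak Helmholtz equation an identity between symbols. -/
lemma integral_mul_eq_fourier {f : Plane → ℂ} (hf : Integrable f) (χ : 𝓢(Plane, ℂ)) :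
    ∫ x, f x * χ x = ∫ ξ, 𝓕 f ξ * (𝓕⁻ χ) ξ := by
  have h := VectorFourier.integral_fourierIntegral_smul_eq_flip (L := innerₗ Plane)
    Real.continuous_fourierChar continuous_inner hf (𝓕⁻ χ).integrable (μ := volume) (ν := volume)
  have h2 : (fun x => f x * χ x) = fun x => f x • 𝓕 ((𝓕⁻ χ : 𝓢(Plane, ℂ)) : Plane → ℂ) x := by
    funext x
    rw [← SchwartzMap.fourier_coe, FourierTransform.fourier_fourierInv_eq, smul_eq_mul]
  rw [h2]
  simpa using! h.symm

lemma isHelmholtzFilter_helmholtzFilter {α : ℝ} (hα : 0 < α) {f : Plane → ℝ} (hf : Integrable f) :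
    IsHelmholtzFilter α f (helmholtzFilter α f) := by
  refine ⟨integrable_helmholtzFilter hα hf, fun φ hφ hc => ?_⟩
  set φS := testToSchwartz φ hφ hc
  have hg : Integrable fun x => ((helmholtzFilter α f x : ℝ) : ℂ) :=
    (integrable_helmholtzFilter hα hf).ofReal
  have hf' : Integrable fun x => (f x : ℂ) := hf.ofReal
  have hK : Integrable fun x => (helmholtzKernel α x : ℂ) := (integrable_helmholtzKernel hα).ofReal
  have hF : ∀ ξ, 𝓕 (fun x => ((helmholtzFilter α f x : ℝ) : ℂ)) ξ *
      ((1 + 4 * Real.pi ^ 2 * α ^ 2 * ‖ξ‖ ^ 2 : ℝ) : ℂ) = 𝓕 (fun x => (f x : ℂ)) ξ := by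
    intro ξ
    rw [helmholtzFilter_eq_convolution, ← ofReal_convolution,
      Real.fourier_mul_convolution_eq hf' hK,
      fourier_helmholtzKernel hα, mul_assoc, ← Complex.ofReal_mul, one_div,
      inv_mul_cancel₀ (by positivity)]
    simp
  have key : ∫ x, ((helmholtzFilter α f x : ℝ) : ℂ) * (φS - (α ^ 2 : ℝ) • Δ φS) x =
      ∫ x, (f x : ℂ) * φS x := by
    rw [integral_mul_eq_fourier hg, integral_mul_eq_fourier hf']
    refine integral_congr_ae (.of_forall fun ξ => ?_)
    simp only
    rw [SchwartzMap.fourierInv_coe, Real.fourierInv_eq_fourier_neg, ← SchwartzMap.fourier_coe,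
      fourier_sub_laplacian, norm_neg, ← mul_assoc, hF, SchwartzMap.fourierInv_coe,
      Real.fourierInv_eq_fourier_neg, ← SchwartzMap.fourier_coe]
  simp only [φS, sub_laplacian_testToSchwartz, testToSchwartz_apply, ← Complex.ofReal_mul,
    integral_complex_ofReal] at key
  exact_mod_cast key

lemma fderiv_comp_const_sub {E F : Type*} [NormedAddCommGroup E] [NormedSpace ℝ E]
    [NormedAddCommGroup F] [NormedSpace ℝ F] {f : E → F} {x y : E}
    (hf : DifferentiableAt ℝ f (x - y)) :
    fderiv ℝ (fun y => f (x - y)) y = -fderiv ℝ f (x - y) := by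
  have := hf.hasFDerivAt.comp y ((hasFDerivAt_id y).const_sub x)
  rw [show (fun y => f (x - y)) = f ∘ fun y => x - y from rfl]
  refine HasFDerivAt.fderiv (this.congr_fderiv ?_)
  ext v
  simp

/-- Testing against translates gives `g * (ζ - α²Δζ) = 0`. The symbol `1 + 4π²α²|ξ|²` never
vanishes, so the transform of `g * ζ` vanishes too, and Fourier inversion gives `g * ζ = 0`. -/
lemma ae_eq_zero_of_helmholtz {α : ℝ} {g : Plane → ℝ} (hg : Integrable g)
    (h : ∀ φ : Plane → ℝ, ContDiff ℝ ∞ φ → HasCompactSupport φ →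
      ∫ x, g x * (φ x - α ^ 2 * (Δ φ) x) = 0) : g =ᵐ[volume] 0 := by
  refine ae_eq_zero_of_integral_contDiff_smul_eq_zero hg.locallyIntegrable fun η hη hc => ?_
  -- The reflection makes the value of `g * ζ` at the origin equal to the pairing of `g` with `η`.
  set ζ : Plane → ℝ := fun x => η (-x) with hζ
  have hζs : ContDiff ℝ ∞ ζ := hη.comp contDiff_neg
  have hζc : HasCompactSupport ζ := hc.comp_homeomorph (Homeomorph.neg Plane)
  set ζS := testToSchwartz ζ hζs hζc
  set χ := ζS - (α ^ 2 : ℝ) • Δ ζS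
  set gc : Plane → ℂ := fun x => (g x : ℂ)
  have hgc : Integrable gc := hg.ofReal
  have conv0 : gc ⋆[ContinuousLinearMap.mul ℂ ℂ] (χ : Plane → ℂ) = 0 := by
    funext x
    have hts : ContDiff ℝ ∞ fun y => ζ (x - y) := hζs.comp (contDiff_const.sub contDiff_id)
    have htc : HasCompactSupport fun y => ζ (x - y) :=
      hζc.comp_homeomorph (Homeomorph.subLeft x)
    have hl : ∀ y, (Δ fun y => ζ (x - y)) y = (Δ ζ) (x - y) := by
      intro y
      simp only [InnerProductSpace.laplacian_eq_iteratedFDeriv_stdOrthonormalBasis,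
        iteratedFDeriv_two_apply]
      have e1 : fderiv ℝ (fun y => ζ (x - y)) = fun y => -fderiv ℝ ζ (x - y) := by
        funext y; exact fderiv_comp_const_sub (hζs.differentiable (by simp) _)
      have e2 : fderiv ℝ (fun y => -fderiv ℝ ζ (x - y)) y = fderiv ℝ (fderiv ℝ ζ) (x - y) := by
        rw [fderiv_fun_neg, fderiv_comp_const_sub, neg_neg]
        exact (hζs.fderiv_right (m := 1) (by norm_cast)).differentiable (by simp) _
      simp only [e1, e2]
    have := h _ hts htc
    simp only [convolution_def, ContinuousLinearMap.mul_apply', Pi.zero_apply]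
    simp only [hl] at this
    simp only [χ, ζS, sub_laplacian_testToSchwartz, gc, ← Complex.ofReal_mul,
      integral_complex_ofReal, this, Complex.ofReal_zero]
  have hF : 𝓕 (gc ⋆[ContinuousLinearMap.mul ℂ ℂ] (ζS : Plane → ℂ)) = 0 := by
    funext ξ
    have h1 := Real.fourier_mul_convolution_eq hgc χ.integrable ξ
    rw [conv0, ← SchwartzMap.fourier_coe, fourier_sub_laplacian] at h1
    have h0 : 𝓕 (0 : Plane → ℂ) ξ = 0 := by simp [Real.fourier_eq]
    rw [h0, mul_left_comm, SchwartzMap.fourier_coe] at h1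
    rw [Real.fourier_mul_convolution_eq hgc ζS.integrable]
    have hne : ((1 + 4 * Real.pi ^ 2 * α ^ 2 * ‖ξ‖ ^ 2 : ℝ) : ℂ) ≠ 0 := by
      have : 0 < 1 + 4 * Real.pi ^ 2 * α ^ 2 * ‖ξ‖ ^ 2 := by positivity
      exact_mod_cast this.ne'
    exact (mul_eq_zero.1 h1.symm).resolve_left hne
  have hcont : Continuous (gc ⋆[ContinuousLinearMap.mul ℂ ℂ] (ζS : Plane → ℂ)) :=
    HasCompactSupport.continuous_convolution_right _ (hζc.comp_left (g := Complex.ofReal) rfl)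
      hgc.locallyIntegrable ζS.continuous
  have hz := hcont.fourierInv_fourier_eq
    (hgc.integrable_convolution _ ζS.integrable) (by rw [hF]; exact integrable_zero _ _ _)
  have hz0 := congrFun hz 0
  rw [hF] at hz0
  have h0 : 𝓕⁻ (0 : Plane → ℂ) 0 = 0 := by simp [Real.fourierInv_eq]
  rw [h0, convolution_def] at hz0
  simp only [ContinuousLinearMap.mul_apply', zero_sub, ζS, testToSchwartz_apply, gc, hζ, neg_neg,
    ← Complex.ofReal_mul, integral_complex_ofReal] at hz0
  have : (∫ x, g x * η x) = 0 := by exact_mod_cast hz0.symm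
  simpa [mul_comm] using this

lemma IsHelmholtzFilter.ae_eq {α : ℝ} {f g : Plane → ℝ} (hα : 0 < α) (hf : Integrable f)
    (hg : IsHelmholtzFilter α f g) : g =ᵐ[volume] helmholtzFilter α f := by
  have hh := isHelmholtzFilter_helmholtzFilter hα hf
  have := ae_eq_zero_of_helmholtz (α := α) (hg.1.sub hh.1) fun φ hφ hc => by
    set χ := testToSchwartz φ hφ hc - (α ^ 2 : ℝ) • Δ (testToSchwartz φ hφ hc)
    have hre : (fun x => φ x - α ^ 2 * (Δ φ) x) = fun x => (χ x).re := by
      funext x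
      rw [sub_laplacian_testToSchwartz, Complex.ofReal_re]
    have hcont : Continuous fun x => φ x - α ^ 2 * (Δ φ) x := by
      rw [hre]; exact Complex.continuous_re.comp χ.continuous
    have hC : ∀ x, ‖φ x - α ^ 2 * (Δ φ) x‖ ≤ ‖χ.toBoundedContinuousFunction‖ := fun x => by
      have := χ.toBoundedContinuousFunction.norm_coe_le_norm x
      rw [congrFun hre x]
      exact (Complex.abs_re_le_norm _).trans this
    have hi : ∀ w : Plane → ℝ, Integrable w →
        Integrable fun x => w x * (φ x - α ^ 2 * (Δ φ) x) := fun w hw =>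
      hw.mul_bdd hcont.aestronglyMeasurable (.of_forall hC)
    simp only [Pi.sub_apply, sub_mul]
    rw [integral_sub (hi _ hg.1) (hi _ hh.1), hg.2 φ hφ hc, hh.2 φ hφ hc, sub_self]
  filter_upwards [this] with x hx
  simpa [sub_eq_zero] using hx

end Helmholtz

/-! ### The velocity generated by a filtered vorticity -/

lemma biotSavart_congr_ae {w w' : Plane → ℝ} (h : w =ᵐ[volume] w') :
    biotSavart w = biotSavart w' := by
  funext x
  unfold biotSavart
  congr 1
  refine integral_congr_ae ?_
  filter_upwards [h] with y hy
  rw [hy]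

/-- Associativity of convolution, `B(K * f) = B(K) * f`; the uniform Riesz bound for the Helmholtz
kernel gives the absolute convergence needed for Fubini. -/
lemma biotSavart_helmholtzFilter {α : ℝ} (hα : 0 < α) {f : Plane → ℝ} (hf : Integrable f) :
    biotSavart (helmholtzFilter α f) = velocity α f := by
  funext x
  set F : Plane → Plane → Plane := fun z y =>
    (f z * helmholtzKernel α (y - z) / ‖x - y‖ ^ 2) • perp (x - y)
  have hmeas : AEStronglyMeasurable (Function.uncurry F) (volume.prod volume) := by
    have h1 : AEStronglyMeasurable (fun q : Plane × Plane => f q.1) (volume.prod volume) :=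
      hf.aestronglyMeasurable.comp_fst
    have h2 : Measurable fun q : Plane × Plane =>
        (helmholtzKernel α (q.2 - q.1) / ‖x - q.2‖ ^ 2) • perp (x - q.2) := by
      have h3 : Measurable fun q : Plane × Plane => helmholtzKernel α (q.2 - q.1) / ‖x - q.2‖ ^ 2 :=
        ((measurable_helmholtzKernel α).comp (measurable_snd.sub measurable_fst)).div (by fun_prop)
      exact h3.smul (measurable_perp.comp (measurable_const.sub measurable_snd))
    refine (h1.smul h2.aestronglyMeasurable).congr (.of_forall fun q => ?_)
    simp [F, Function.uncurry, smul_smul, mul_div_assoc]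
  have hFint : Integrable (Function.uncurry F) (volume.prod volume) := by
    refine ⟨hmeas, ?_⟩
    rw [hasFiniteIntegral_iff_enorm, lintegral_prod _ hmeas.enorm]
    refine lt_of_le_of_lt (b := ENNReal.ofReal (helmholtzRieszBound α) * ∫⁻ z, ‖f z‖ₑ) ?_
      (ENNReal.mul_lt_top ENNReal.ofReal_lt_top hf.2)
    rw [← lintegral_const_mul' _ _ ENNReal.ofReal_ne_top]
    refine lintegral_mono fun z => ?_
    simp only [Function.uncurry, F, enorm_biotSavart_integrand, enorm_mul]
    have : ∀ y, ‖f z‖ₑ * ‖helmholtzKernel α (y - z)‖ₑ * ENNReal.ofReal ‖x - y‖⁻¹ =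
        ‖f z‖ₑ * (ENNReal.ofReal (helmholtzKernel α (y - z)) *
          ENNReal.ofReal ‖(x - z) - (y - z)‖⁻¹) := fun y => by
      rw [Real.enorm_of_nonneg (helmholtzKernel_nonneg _ _), mul_assoc, sub_sub_sub_cancel_right]
    simp_rw [this]
    rw [lintegral_const_mul' _ _ enorm_ne_top, mul_comm]
    gcongr
    rw [lintegral_sub_right_eq_self (fun y => ENNReal.ofReal (helmholtzKernel α y) *
          ENNReal.ofReal ‖(x - z) - y‖⁻¹)]
    exact lintegral_helmholtzKernel_mul_inv_norm_le hα _
  calc biotSavart (helmholtzFilter α f) x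
      = (1 / (2 * Real.pi)) • ∫ y, ∫ z, F z y := by
        unfold biotSavart helmholtzFilter
        congr 2
        funext y
        simp only [F, integral_smul_const, integral_div]
    _ = (1 / (2 * Real.pi)) • ∫ z, ∫ y, F z y := by rw [integral_integral_swap hFint]
    _ = velocity α f x := by
        unfold velocity velocityKernel biotSavart
        rw [← integral_smul]
        refine integral_congr_ae (.of_forall fun z => ?_)
        simp only
        rw [smul_comm (f z), ← integral_smul (f z)]
        congr 1
        rw [← integral_add_right_eq_self _ z]
        congr 1
        funext y
        simp only [F, smul_smul, mul_div_assoc, add_sub_cancel_right, sub_sub, add_comm z y]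

lemma IsHelmholtzFilter.biotSavart_eq {α : ℝ} {f g : Plane → ℝ} (hα : 0 < α) (hf : Integrable f)
    (hg : IsHelmholtzFilter α f g) : biotSavart g = velocity α f := by
  rw [biotSavart_congr_ae (hg.ae_eq hα hf), biotSavart_helmholtzFilter hα hf]

/-! ### Integrals in time -/

lemma lintegral_Ioc_eq_ofReal_intervalIntegral {f : ℝ → ℝ} {a b : ℝ} (hab : a ≤ b)
    (hf : IntervalIntegrable f volume a b) (h0 : ∀ s ∈ Set.Ioc a b, 0 ≤ f s) :
    ∫⁻ s in Set.Ioc a b, ENNReal.ofReal (f s) = ENNReal.ofReal (∫ s in a..b, f s) := by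
  rw [intervalIntegral.integral_of_le hab, ofReal_integral_eq_lintegral_ofReal hf.1]
  filter_upwards [ae_restrict_mem measurableSet_Ioc] with s hs
  exact h0 s hs

lemma lintegral_inv_sqrt {c : ℝ} (hc : 0 ≤ c) :
    ∫⁻ s in Set.Ioc 0 c, ENNReal.ofReal (s ^ (-1 / 2 : ℝ)) = ENNReal.ofReal (2 * √c) := by
  rw [lintegral_Ioc_eq_ofReal_intervalIntegral hc
    (intervalIntegral.intervalIntegrable_rpow' (by norm_num))
    (fun s hs => Real.rpow_nonneg hs.1.le _), integral_rpow (Or.inl (by norm_num))]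
  congr 1
  rw [show (-1 / 2 : ℝ) + 1 = 1 / 2 by norm_num, ← Real.sqrt_eq_rpow, ← Real.sqrt_eq_rpow]
  simp
  ring

lemma inv_sqrt_eq_rpow {s : ℝ} (hs : 0 ≤ s) : 2 / √s = 2 * s ^ (-1 / 2 : ℝ) := by
  rw [show (-1 / 2 : ℝ) = -(1 / 2) by norm_num, Real.rpow_neg hs, ← Real.sqrt_eq_rpow]; rfl

lemma lintegral_two_div_sqrt_sub {c : ℝ} (hc : 0 ≤ c) (t : ℝ) :
    ∫⁻ s in Set.Ioc (t - c) t, ENNReal.ofReal (2 / √(t - s)) = ENNReal.ofReal (4 * √c) := by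
  have hi : IntervalIntegrable (fun s : ℝ => 2 * s ^ (-1 / 2 : ℝ)) volume 0 c :=
    (intervalIntegral.intervalIntegrable_rpow' (by norm_num)).const_mul _
  have hi' : IntervalIntegrable (fun s : ℝ => 2 * (t - s) ^ (-1 / 2 : ℝ)) volume (t - c) t := by
    have := (hi.comp_sub_left t).symm
    simpa using this
  have e : ∫⁻ s in Set.Ioc (t - c) t, ENNReal.ofReal (2 / √(t - s)) =
      ∫⁻ s in Set.Ioc (t - c) t, ENNReal.ofReal (2 * (t - s) ^ (-1 / 2 : ℝ)) := by
    refine setLIntegral_congr_fun measurableSet_Ioc fun s hs => ?_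
    rw [inv_sqrt_eq_rpow (by linarith [hs.2])]
  rw [e, lintegral_Ioc_eq_ofReal_intervalIntegral (by linarith) hi'
    (fun s hs => mul_nonneg (by norm_num) (Real.rpow_nonneg (by linarith [hs.2]) _))]
  rw [intervalIntegral.integral_comp_sub_left (fun s : ℝ => 2 * s ^ (-1 / 2 : ℝ)) t]
  simp only [sub_self, sub_sub_cancel, intervalIntegral.integral_const_mul]
  rw [integral_rpow (Or.inl (by norm_num))]
  congr 1
  rw [show (-1 / 2 : ℝ) + 1 = 1 / 2 by norm_num, ← Real.sqrt_eq_rpow, ← Real.sqrt_eq_rpow]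
  simp
  ring

/-- Here `l < 1/2` keeps the exponent above `-1`. The factor `c` on the right is retained, rather
than bounded by `1 + c`, because it must cancel a `1 / √c` for small `c`. -/
lemma lintegral_one_add_rpow_le {l c : ℝ} (hl0 : 0 ≤ l) (hl : l < 1 / 2) (hc : 0 ≤ c) :
    ∫⁻ s in Set.Ioc 0 c, ENNReal.ofReal ((1 + s) ^ (-1 / 2 - l)) ≤
      ENNReal.ofReal (1 / (1 / 2 - l) * (c * (1 + c) ^ (-1 / 2 - l))) := by
  have hi : IntervalIntegrable (fun s : ℝ => (1 + s) ^ (-1 / 2 - l)) volume 0 c := by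
    refine ContinuousOn.intervalIntegrable fun s hs => ?_
    rw [Set.uIcc_of_le hc] at hs
    refine (ContinuousAt.rpow_const (by fun_prop) (Or.inl ?_)).continuousWithinAt
    have := hs.1
    positivity
  rw [lintegral_Ioc_eq_ofReal_intervalIntegral hc hi
    (fun s hs => Real.rpow_nonneg (by linarith [hs.1]) _)]
  refine ENNReal.ofReal_le_ofReal ?_
  have h1 : ∫ s in (0 : ℝ)..c, (1 + s) ^ (-1 / 2 - l) =
      ((1 + c) ^ (1 / 2 - l) - 1) / (1 / 2 - l) := by
    rw [intervalIntegral.integral_comp_add_left (fun s : ℝ => s ^ (-1 / 2 - l)) 1,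
      integral_rpow (Or.inl (by linarith))]
    rw [show -1 / 2 - l + 1 = 1 / 2 - l by ring]
    simp
  rw [h1, div_eq_inv_mul, ← one_div]
  have hp : 0 < 1 / 2 - l := by linarith
  refine mul_le_mul_of_nonneg_left ?_ (by positivity)
  have h2 : (1 + c) ^ (1 / 2 - l) = (1 + c) * (1 + c) ^ (-1 / 2 - l) := by
    rw [show (1 / 2 - l) = 1 + (-1 / 2 - l) by ring, Real.rpow_add (by positivity), Real.rpow_one]
  have h3 : (1 + c) ^ (-1 / 2 - l) ≤ 1 :=
    Real.rpow_le_one_of_one_le_of_nonpos (by linarith) (by linarith)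
  rw [h2]; linarith

/-- On the first half `t - s` is at least `t / 2`, so the kernel is not singular; on the second half
the weights in `s` are comparable with their values at `t`. -/
lemma lintegral_Ioo_le_halves {t : ℝ} (f : ℝ → ℝ≥0∞) :
    ∫⁻ s in Set.Ioo 0 t, f s ≤
      (∫⁻ s in Set.Ioc 0 (t / 2), f s) + ∫⁻ s in Set.Ioc (t - t / 2) t, f s := by
  refine (lintegral_mono_set fun s hs => ?_).trans (lintegral_union_le _ _ _)
  by_cases h : s ≤ t / 2
  · exact Or.inl ⟨hs.1, h⟩
  · exact Or.inr ⟨by linarith, hs.2.le⟩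

lemma one_add_half_rpow_le {t b : ℝ} (ht : 0 ≤ t) (hb : 0 ≤ b) (hb2 : b ≤ 2) :
    (1 + t / 2) ^ (-b) ≤ 4 * (1 + t) ^ (-b) := by
  have h1 : (1 + t / 2) ^ (-b) ≤ ((1 + t) / 2) ^ (-b) :=
    Real.rpow_le_rpow_of_nonpos (by positivity) (by linarith) (by linarith)
  refine h1.trans ?_
  rw [Real.div_rpow (by positivity) (by positivity), Real.rpow_neg zero_le_two, div_inv_eq_mul,
    mul_comm]
  gcongr
  calc (2 : ℝ) ^ b ≤ 2 ^ (2 : ℝ) := Real.rpow_le_rpow_of_exponent_le (by norm_num) hb2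
    _ = 4 := by norm_num

lemma two_div_sqrt_sub_le {t s : ℝ} (ht : 0 < t) (hs : s ≤ t / 2) :
    2 / √(t - s) ≤ 2 / √(t / 2) := by
  have : 0 < √(t / 2) := Real.sqrt_pos.2 (by linarith)
  gcongr
  linarith

lemma sqrt_mul_rpow_le {c l : ℝ} (hc : 0 ≤ c) : √c * (1 + c) ^ (-1 / 2 - l) ≤ (1 + c) ^ (-l) := by
  have h : (1 + c) ^ (-l) = √(1 + c) * (1 + c) ^ (-1 / 2 - l) := by
    rw [Real.sqrt_eq_rpow, ← Real.rpow_add (by positivity)]; congr 1; ring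
  rw [h]
  have := Real.sqrt_le_sqrt (show c ≤ 1 + c by linarith)
  gcongr

lemma lintegral_heat_weight_le {l t : ℝ} (hl0 : 0 ≤ l) (hl : l < 1 / 2) (ht : 0 < t) :
    ∫⁻ s in Set.Ioo 0 t, ENNReal.ofReal (2 / √(t - s)) * ENNReal.ofReal ((1 + s) ^ (-1 / 2 - l)) ≤
      ENNReal.ofReal ((8 / (1 / 2 - l) + 16) * (1 + t) ^ (-l)) := by
  set c := t / 2 with hc
  have hc0 : 0 < c := by positivity
  have hsc : 0 < √c := Real.sqrt_pos.2 hc0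
  have hss : √c * √c = c := Real.mul_self_sqrt hc0.le
  have hk : 0 < 1 / 2 - l := by linarith
  refine (lintegral_Ioo_le_halves _).trans ?_
  have h1 : ∫⁻ s in Set.Ioc 0 c,
      ENNReal.ofReal (2 / √(t - s)) * ENNReal.ofReal ((1 + s) ^ (-1 / 2 - l)) ≤
      ENNReal.ofReal (2 / (1 / 2 - l) * (√c * (1 + c) ^ (-1 / 2 - l))) := by
    calc _ ≤ ∫⁻ s in Set.Ioc 0 c,
          ENNReal.ofReal (2 / √c) * ENNReal.ofReal ((1 + s) ^ (-1 / 2 - l)) := by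
          refine setLIntegral_mono' measurableSet_Ioc fun s hs => ?_
          gcongr ENNReal.ofReal ?_ * _
          exact two_div_sqrt_sub_le ht hs.2
      _ ≤ _ := by
          rw [lintegral_const_mul' _ _ ENNReal.ofReal_ne_top]
          refine (mul_le_mul_right (lintegral_one_add_rpow_le hl0 hl hc0.le) _).trans ?_
          rw [← ENNReal.ofReal_mul (by positivity)]
          refine ENNReal.ofReal_le_ofReal (le_of_eq ?_)
          nth_rewrite 2 [← hss]
          field_simp
  have h2 : ∫⁻ s in Set.Ioc (t - c) t,
      ENNReal.ofReal (2 / √(t - s)) * ENNReal.ofReal ((1 + s) ^ (-1 / 2 - l)) ≤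
      ENNReal.ofReal (4 * (√c * (1 + c) ^ (-1 / 2 - l))) := by
    calc _ ≤ ∫⁻ s in Set.Ioc (t - c) t,
          ENNReal.ofReal (2 / √(t - s)) * ENNReal.ofReal ((1 + c) ^ (-1 / 2 - l)) := by
          refine setLIntegral_mono' measurableSet_Ioc fun s hs => ?_
          gcongr _ * ENNReal.ofReal ?_
          refine Real.rpow_le_rpow_of_nonpos (by positivity) ?_ (by linarith)
          have := hs.1
          linarith
      _ ≤ _ := by
          rw [lintegral_mul_const' _ _ ENNReal.ofReal_ne_top, lintegral_two_div_sqrt_sub hc0.le,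
            ← ENNReal.ofReal_mul (by positivity), mul_assoc]
  refine (add_le_add h1 h2).trans ?_
  rw [← ENNReal.ofReal_add (by positivity) (by positivity)]
  refine ENNReal.ofReal_le_ofReal ?_
  have h3 := (sqrt_mul_rpow_le (l := l) hc0.le).trans
    (one_add_half_rpow_le (b := l) ht.le hl0 (by linarith))
  calc _ = (2 / (1 / 2 - l) + 4) * (√c * (1 + c) ^ (-1 / 2 - l)) := by ring
    _ ≤ (2 / (1 / 2 - l) + 4) * (4 * (1 + t) ^ (-l)) := by gcongr
    _ = _ := by ring

/-- The two bounds on `A` model the two estimates of a heat convolution: by the sup norm, and by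
smoothing from `L¹`. The first is used near `s = t`; near `s = 0` the choice depends on `t`. The
result has no singularity at `t = 0`. -/
lemma lintegral_heat_sup_weight_le {l t : ℝ} (hl0 : 0 ≤ l) (hl : l < 1 / 2) (ht : 0 < t)
    {A : ℝ → ℝ≥0∞}
    (hA : ∀ s ∈ Set.Ioo 0 t, A s ≤ ENNReal.ofReal (s ^ (-1 / 2 : ℝ) * (1 + s) ^ (-1 - l)))
    (hA' : ∀ s ∈ Set.Ioo 0 t, A s ≤ ENNReal.ofReal ((1 + s) ^ (-1 / 2 - l) / (t - s))) :
    ∫⁻ s in Set.Ioo 0 t, ENNReal.ofReal (2 / √(t - s)) * A s ≤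
      ENNReal.ofReal ((16 / (1 / 2 - l) + 80) * (1 + t) ^ (-1 - l)) := by
  set c := t / 2 with hc
  have hc0 : 0 < c := by positivity
  have hct : c < t := by linarith
  have hsc : 0 < √c := Real.sqrt_pos.2 hc0
  have hss : √c * √c = c := Real.mul_self_sqrt hc0.le
  have hk : 0 < 1 / 2 - l := by linarith
  have hkey := one_add_half_rpow_le (b := 1 + l) ht.le (by linarith) (by linarith)
  rw [neg_add' 1 l, ← hc] at hkey
  have hpos : 0 < (1 + c) ^ (-1 - l) := by positivity
  have hsplit : ∫⁻ s in Set.Ioo 0 t, ENNReal.ofReal (2 / √(t - s)) * A s ≤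
      (∫⁻ s in Set.Ioc 0 c, ENNReal.ofReal (2 / √(t - s)) * A s) +
        ∫⁻ s in Set.Ioo (t - c) t, ENNReal.ofReal (2 / √(t - s)) * A s := by
    refine (lintegral_Ioo_le_halves _).trans (le_of_eq ?_)
    rw [setLIntegral_congr (Ioo_ae_eq_Ioc (a := t - c) (b := t))]
  refine hsplit.trans ?_
  have h2 : ∫⁻ s in Set.Ioo (t - c) t, ENNReal.ofReal (2 / √(t - s)) * A s ≤
      ENNReal.ofReal (4 * (1 + c) ^ (-1 - l)) := by
    calc _ ≤ ∫⁻ s in Set.Ioo (t - c) t, ENNReal.ofReal (2 / √(t - s)) *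
          ENNReal.ofReal (c ^ (-1 / 2 : ℝ) * (1 + c) ^ (-1 - l)) := by
          refine setLIntegral_mono' measurableSet_Ioo fun s hs => ?_
          have hs1 : c ≤ s := by linarith [hs.1]
          have hs0 : 0 < s := hc0.trans_le hs1
          refine mul_le_mul_right ((hA s ⟨by linarith, hs.2⟩).trans ?_) _
          refine ENNReal.ofReal_le_ofReal (mul_le_mul ?_ ?_ (by positivity) (by positivity))
          · exact Real.rpow_le_rpow_of_nonpos hc0 hs1 (by norm_num)
          · exact Real.rpow_le_rpow_of_nonpos (by positivity) (by linarith) (by linarith)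
      _ = ENNReal.ofReal (4 * (1 + c) ^ (-1 - l)) := by
          rw [lintegral_mul_const' _ _ ENNReal.ofReal_ne_top,
            setLIntegral_congr (Ioo_ae_eq_Ioc (a := t - c) (b := t)),
            lintegral_two_div_sqrt_sub hc0.le, ← ENNReal.ofReal_mul (by positivity)]
          congr 1
          have : 2 / √c = 2 * c ^ (-1 / 2 : ℝ) := inv_sqrt_eq_rpow hc0.le
          have h5 : √c * c ^ (-1 / 2 : ℝ) = 1 := by
            have : c ^ (-1 / 2 : ℝ) = 1 / √c := by linarith [this, mul_one_div 2 (√c)]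
            rw [this]; field_simp
          linear_combination (4 * (1 + c) ^ (-1 - l)) * h5
  have h1 : ∫⁻ s in Set.Ioc 0 c, ENNReal.ofReal (2 / √(t - s)) * A s ≤
      ENNReal.ofReal ((4 / (1 / 2 - l) + 16) * (1 + c) ^ (-1 - l)) := by
    -- For `c ≤ 1` the singularity `s^{-1/2}` is integrable and a constant bound suffices, since `(1
    -- + c)^{-1-l}` stays above `1/4`. For `c ≥ 1` the smoothing bound is needed: it supplies the
    -- factor `1 / c` that the sup bound lacks near `s = 0`.
    rcases le_total c 1 with h | h
    · calc _ ≤ ∫⁻ s in Set.Ioc 0 c, ENNReal.ofReal (2 / √c) *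
            ENNReal.ofReal (s ^ (-1 / 2 : ℝ)) := by
            refine setLIntegral_mono' measurableSet_Ioc fun s hs => ?_
            have hs0 := hs.1
            refine mul_le_mul' (ENNReal.ofReal_le_ofReal (two_div_sqrt_sub_le ht hs.2)) ?_
            refine (hA s ⟨hs.1, hs.2.trans_lt hct⟩).trans (ENNReal.ofReal_le_ofReal ?_)
            refine mul_le_of_le_one_right (by positivity) ?_
            exact Real.rpow_le_one_of_one_le_of_nonpos (by linarith) (by linarith)
        _ = ENNReal.ofReal 4 := by
            rw [lintegral_const_mul' _ _ ENNReal.ofReal_ne_top, lintegral_inv_sqrt hc0.le,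
              ← ENNReal.ofReal_mul (by positivity)]
            congr 1
            field_simp
            norm_num
        _ ≤ _ := by
            refine ENNReal.ofReal_le_ofReal ?_
            have h6 : (2 : ℝ) ^ (-1 - l) ≤ (1 + c) ^ (-1 - l) :=
              Real.rpow_le_rpow_of_nonpos (by positivity) (by linarith) (by linarith)
            have h7 : (2 : ℝ) ^ (-2 : ℝ) ≤ 2 ^ (-1 - l) :=
              Real.rpow_le_rpow_of_exponent_le (by norm_num) (by linarith)
            have h8 : (2 : ℝ) ^ (-2 : ℝ) = 1 / 4 := by
              rw [Real.rpow_neg (by norm_num)]; norm_num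
            have h9 : 0 ≤ 4 / (1 / 2 - l) * (1 + c) ^ (-1 - l) := by positivity
            have h10 : 1 / 4 ≤ (1 + c) ^ (-1 - l) := h8 ▸ h7.trans h6
            rw [add_mul]
            linarith only [h9, h10]
    · calc _ ≤ ∫⁻ s in Set.Ioc 0 c, ENNReal.ofReal (2 / √c * (1 / c)) *
            ENNReal.ofReal ((1 + s) ^ (-1 / 2 - l)) := by
            refine setLIntegral_mono' measurableSet_Ioc fun s hs => ?_
            have hs0 := hs.1
            have hs2 := hs.2
            rw [ENNReal.ofReal_mul (by positivity), mul_assoc]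
            refine mul_le_mul' (ENNReal.ofReal_le_ofReal (two_div_sqrt_sub_le ht hs.2)) ?_
            refine (hA' s ⟨hs.1, hs.2.trans_lt hct⟩).trans ?_
            rw [← ENNReal.ofReal_mul (by positivity)]
            refine ENNReal.ofReal_le_ofReal ?_
            rw [div_eq_mul_one_div, mul_comm]
            have : c ≤ t - s := by linarith
            gcongr
        _ ≤ ENNReal.ofReal (2 / √c * (1 / c) *
              (1 / (1 / 2 - l) * (c * (1 + c) ^ (-1 / 2 - l)))) := by
            rw [lintegral_const_mul' _ _ ENNReal.ofReal_ne_top]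
            refine (mul_le_mul_right (lintegral_one_add_rpow_le hl0 hl hc0.le) _).trans ?_
            rw [← ENNReal.ofReal_mul (by positivity)]
        _ ≤ _ := by
            refine ENNReal.ofReal_le_ofReal ?_
            have h6 : (1 + c) ^ (-1 / 2 - l) = √(1 + c) * (1 + c) ^ (-1 - l) := by
              rw [Real.sqrt_eq_rpow, ← Real.rpow_add (by positivity)]; congr 1; ring
            have h7 : √(1 + c) ≤ 2 * √c := by
              rw [Real.sqrt_le_left (by positivity), mul_pow, Real.sq_sqrt hc0.le]
              linarith
            calc _ = 2 / (1 / 2 - l) * (√(1 + c) / √c * (1 + c) ^ (-1 - l)) := by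
                  rw [h6]; field_simp
              _ ≤ 2 / (1 / 2 - l) * (2 * (1 + c) ^ (-1 - l)) := by
                  gcongr
                  rwa [div_le_iff₀ hsc]
              _ ≤ _ := by
                  have : 2 / (1 / 2 - l) * (2 * (1 + c) ^ (-1 - l)) =
                    4 / (1 / 2 - l) * (1 + c) ^ (-1 - l) := by ring
                  rw [this, add_mul]
                  linarith
  refine (add_le_add h1 h2).trans ?_
  rw [← ENNReal.ofReal_add (by positivity) (by positivity)]
  refine ENNReal.ofReal_le_ofReal ?_
  calc _ = (4 / (1 / 2 - l) + 20) * (1 + c) ^ (-1 - l) := by ring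
    _ ≤ (4 / (1 / 2 - l) + 20) * (4 * (1 + t) ^ (-1 - l)) := by gcongr
    _ = _ := by ring

/-! ### The bilinear Duhamel operator -/

/-- The integrand of the Duhamel term, extended by zero to all times. -/
noncomputable def duhamelIntegrand (α : ℝ) (f g : ℝ × Plane → ℝ) (p q : ℝ × Plane) : ℝ :=
  if q.1 ∈ Set.Ioo 0 p.1 then
    inner ℝ (gradient (heatKernel (p.1 - q.1)) (p.2 - q.2))
      (g q • velocity α (fun z => f (q.1, z)) q.2)
  else 0

/-- The Duhamel term `∫₀ᵗ ∇Φ(t - s) * [B(H_α(f(s))) g(s)] ds`. -/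
noncomputable def duhamel (α : ℝ) (f g : ℝ × Plane → ℝ) (p : ℝ × Plane) : ℝ :=
  ∫ q, duhamelIntegrand α f g p q

lemma measurable_duhamelIntegrand_uncurry (α : ℝ) {f g : ℝ × Plane → ℝ} (hf : Measurable f)
    (hg : Measurable g) :
    Measurable fun r : (ℝ × Plane) × (ℝ × Plane) => duhamelIntegrand α f g r.1 r.2 := by
  refine Measurable.ite ?_ ?_ measurable_const
  · have h1 : MeasurableSet {r : (ℝ × Plane) × (ℝ × Plane) | 0 < r.2.1} :=
      measurableSet_lt measurable_const (by fun_prop)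
    have h2 : MeasurableSet {r : (ℝ × Plane) × (ℝ × Plane) | r.2.1 < r.1.1} :=
      measurableSet_lt (by fun_prop) (by fun_prop)
    exact h1.inter h2
  · have h1 : Measurable fun r : (ℝ × Plane) × (ℝ × Plane) =>
        gradient (heatKernel (r.1.1 - r.2.1)) (r.1.2 - r.2.2) :=
      measurable_gradient_heatKernel.comp (f := fun r : (ℝ × Plane) × (ℝ × Plane) =>
        (r.1.1 - r.2.1, r.1.2 - r.2.2)) (by fun_prop)
    have h2 : Measurable fun r : (ℝ × Plane) × (ℝ × Plane) =>
        velocity α (fun z => f (r.2.1, z)) r.2.2 := (measurable_velocity hf).comp measurable_snd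
    exact h1.inner ((hg.comp measurable_snd).smul h2)

lemma measurable_duhamelIntegrand (α : ℝ) {f g : ℝ × Plane → ℝ} (hf : Measurable f)
    (hg : Measurable g) (p : ℝ × Plane) : Measurable (duhamelIntegrand α f g p) :=
  (measurable_duhamelIntegrand_uncurry α hf hg).comp measurable_prodMk_left

lemma measurable_duhamel (α : ℝ) {f g : ℝ × Plane → ℝ} (hf : Measurable f) (hg : Measurable g) :
    Measurable (duhamel α f g) :=
  (StronglyMeasurable.integral_prod_right' (ν := volume)
    (measurable_duhamelIntegrand_uncurry α hf hg).stronglyMeasurable).measurable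

lemma duhamel_of_nonpos (α : ℝ) (f g : ℝ × Plane → ℝ) {p : ℝ × Plane} (hp : p.1 ≤ 0) :
    duhamel α f g p = 0 := by
  have : ∀ q, duhamelIntegrand α f g p q = 0 := fun q => by
    rw [duhamelIntegrand, if_neg]
    rintro ⟨h1, h2⟩
    linarith
  simp [duhamel, this]

/-- The sup bound `V` on the velocity is left abstract, so that both the `L¹` velocity bound and the
decaying one can be inserted. -/
lemma enorm_duhamelIntegrand_le (α : ℝ) (f g : ℝ × Plane → ℝ) {V : ℝ → ℝ≥0∞}
    (hV : ∀ s, 0 < s → ∀ y, ‖velocity α (fun z => f (s, z)) y‖ₑ ≤ V s) (t : ℝ) (x : Plane)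
    (s : ℝ) (y : Plane) :
    ‖duhamelIntegrand α f g (t, x) (s, y)‖ₑ ≤
      (Set.Ioo 0 t).indicator (fun s => ENNReal.ofReal (2 / √(t - s)) *
        (V s * (ENNReal.ofReal (heatKernel (2 * (t - s)) (x - y)) * ‖g (s, y)‖ₑ))) s := by
  by_cases hs : s ∈ Set.Ioo 0 t
  · rw [Set.indicator_of_mem hs, duhamelIntegrand, if_pos hs]
    have hts : 0 < t - s := by linarith [hs.2]
    calc _ ≤ ‖gradient (heatKernel (t - s)) (x - y)‖ₑ *
          ‖g (s, y) • velocity α (fun z => f (s, z)) y‖ₑ := by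
          rw [← ofReal_norm, ← ofReal_norm, ← ofReal_norm, ← ENNReal.ofReal_mul (norm_nonneg _)]
          exact ENNReal.ofReal_le_ofReal (norm_inner_le_norm _ _)
      _ ≤ (ENNReal.ofReal (2 / √(t - s)) * ENNReal.ofReal (heatKernel (2 * (t - s)) (x - y))) *
          (‖g (s, y)‖ₑ * V s) := by
          refine mul_le_mul' ?_ ?_
          · rw [← ofReal_norm, ← ENNReal.ofReal_mul (by positivity)]
            exact ENNReal.ofReal_le_ofReal (norm_gradient_heatKernel_le hts _)
          · rw [enorm_smul]
            exact mul_le_mul_right (hV s hs.1 y) _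
      _ = _ := by ring
  · rw [Set.indicator_of_notMem hs, duhamelIntegrand, if_neg hs, enorm_zero]

lemma measurable_heat_mul {g : ℝ × Plane → ℝ} (hg : Measurable g) (t : ℝ) :
    Measurable fun r : Plane × ℝ × Plane =>
      ENNReal.ofReal (heatKernel (2 * (t - r.2.1)) (r.1 - r.2.2)) * ‖g r.2‖ₑ := by
  have h : Measurable fun r : Plane × ℝ × Plane => heatKernel (2 * (t - r.2.1)) (r.1 - r.2.2) :=
    measurable_heatKernel_uncurry.comp (f := fun r : Plane × ℝ × Plane =>
      (2 * (t - r.2.1), r.1 - r.2.2)) (by fun_prop)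
  exact h.ennreal_ofReal.mul (hg.comp measurable_snd).enorm

lemma lintegral_duhamelIntegrand_le (α : ℝ) {f g : ℝ × Plane → ℝ} (hf : Measurable f)
    (hg : Measurable g) {V : ℝ → ℝ≥0∞}
    (hV : ∀ s, 0 < s → ∀ y, ‖velocity α (fun z => f (s, z)) y‖ₑ ≤ V s) (t : ℝ) (x : Plane) :
    ∫⁻ q, ‖duhamelIntegrand α f g (t, x) q‖ₑ ≤
      ∫⁻ s in Set.Ioo 0 t, ENNReal.ofReal (2 / √(t - s)) *
        (V s * ∫⁻ y, ENNReal.ofReal (heatKernel (2 * (t - s)) (x - y)) * ‖g (s, y)‖ₑ) := by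
  rw [Measure.volume_eq_prod,
    lintegral_prod _ (measurable_duhamelIntegrand α hf hg _).enorm.aemeasurable,
    ← lintegral_indicator measurableSet_Ioo]
  refine lintegral_mono fun s => ?_
  refine (lintegral_mono fun y => enorm_duhamelIntegrand_le α f g hV t x s y).trans ?_
  by_cases hs : s ∈ Set.Ioo 0 t
  · simp only [Set.indicator_of_mem hs]
    have hm : Measurable fun y =>
        ENNReal.ofReal (heatKernel (2 * (t - s)) (x - y)) * ‖g (s, y)‖ₑ :=
      (measurable_heat_mul hg t).comp (f := fun y : Plane => (x, s, y)) (by fun_prop)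
    rw [lintegral_const_mul' _ _ ENNReal.ofReal_ne_top, lintegral_const_mul _ hm]
  · simp [Set.indicator_of_notMem hs]

lemma lintegral_heat_conv {t : ℝ} (ht : 0 < t) {h : Plane → ℝ≥0∞} (hh : AEMeasurable h) :
    ∫⁻ x, ∫⁻ y, ENNReal.ofReal (heatKernel t (x - y)) * h y = ∫⁻ y, h y := by
  rw [lintegral_lintegral_swap]
  · refine lintegral_congr fun y => ?_
    have hm : Measurable fun x => ENNReal.ofReal (heatKernel t (x - y)) := by
      have := continuous_heatKernel t
      fun_prop
    rw [lintegral_mul_const _ hm, lintegral_heatKernel_sub ht, one_mul]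
  · have h1 : Measurable fun q : Plane × Plane => heatKernel t (q.1 - q.2) :=
      (continuous_heatKernel t).measurable.comp (measurable_fst.sub measurable_snd)
    exact h1.ennreal_ofReal.aemeasurable.mul hh.comp_snd

lemma heat_conv_le_sup {t : ℝ} (ht : 0 < t) {h : Plane → ℝ≥0∞} {A : ℝ≥0∞} (hA : ∀ y, h y ≤ A)
    (x : Plane) : ∫⁻ y, ENNReal.ofReal (heatKernel t (x - y)) * h y ≤ A := by
  refine (lintegral_mono fun y => mul_le_mul_right (hA y) _).trans (le_of_eq ?_)
  have hm : Measurable fun y => ENNReal.ofReal (heatKernel t (x - y)) := by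
    have := continuous_heatKernel t
    fun_prop
  rw [lintegral_mul_const _ hm, lintegral_heatKernel_sub_left ht, one_mul]

lemma heat_conv_le_lintegral {t : ℝ} (ht : 0 < t) (h : Plane → ℝ≥0∞) (x : Plane) :
    ∫⁻ y, ENNReal.ofReal (heatKernel t (x - y)) * h y ≤
      ENNReal.ofReal (1 / (4 * Real.pi * t)) * ∫⁻ y, h y := by
  rw [← lintegral_const_mul' _ _ ENNReal.ofReal_ne_top]
  exact lintegral_mono fun y => mul_le_mul_left (ENNReal.ofReal_le_ofReal (heatKernel_le ht _)) _

lemma lintegral_lintegral_duhamelIntegrand_le (α : ℝ) {f g : ℝ × Plane → ℝ} (hf : Measurable f)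
    (hg : Measurable g) {V : ℝ → ℝ≥0∞} (hVm : Measurable V)
    (hV : ∀ s, 0 < s → ∀ y, ‖velocity α (fun z => f (s, z)) y‖ₑ ≤ V s) (t : ℝ) :
    ∫⁻ x, ∫⁻ q, ‖duhamelIntegrand α f g (t, x) q‖ₑ ≤
      ∫⁻ s in Set.Ioo 0 t, ENNReal.ofReal (2 / √(t - s)) * (V s * ∫⁻ y, ‖g (s, y)‖ₑ) := by
  refine (lintegral_mono fun x => lintegral_duhamelIntegrand_le α hf hg hV t x).trans ?_
  have hm2 : Measurable fun r : Plane × ℝ =>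
      ∫⁻ y, ENNReal.ofReal (heatKernel (2 * (t - r.2)) (r.1 - y)) * ‖g (r.2, y)‖ₑ := by
    refine Measurable.lintegral_prod_right' (ν := volume) (f := fun p : (Plane × ℝ) × Plane =>
      ENNReal.ofReal (heatKernel (2 * (t - p.1.2)) (p.1.1 - p.2)) * ‖g (p.1.2, p.2)‖ₑ) ?_
    exact (measurable_heat_mul hg t).comp
      (f := fun p : (Plane × ℝ) × Plane => (p.1.1, p.1.2, p.2)) (by fun_prop)
  rw [lintegral_lintegral_swap]
  · refine setLIntegral_mono' measurableSet_Ioo fun s hs => ?_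
    have hts : 0 < 2 * (t - s) := by linarith [hs.2]
    have hm3 : Measurable fun x =>
        ∫⁻ y, ENNReal.ofReal (heatKernel (2 * (t - s)) (x - y)) * ‖g (s, y)‖ₑ :=
      hm2.comp (f := fun x : Plane => (x, s)) (by fun_prop)
    rw [lintegral_const_mul' _ _ ENNReal.ofReal_ne_top, lintegral_const_mul _ hm3,
      lintegral_heat_conv hts (h := fun y => ‖g (s, y)‖ₑ) (by fun_prop)]
  · refine Measurable.aemeasurable ?_
    have h1 : Measurable fun r : Plane × ℝ => ENNReal.ofReal (2 / √(t - r.2)) := by fun_prop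
    exact h1.mul ((hVm.comp measurable_snd).mul hm2)

lemma integrable_duhamelIntegrand {α : ℝ} {f g : ℝ × Plane → ℝ} (hf : Measurable f)
    (hg : Measurable g) {p : ℝ × Plane} (h : ∫⁻ q, ‖duhamelIntegrand α f g p q‖ₑ < ⊤) :
    Integrable (duhamelIntegrand α f g p) :=
  ⟨(measurable_duhamelIntegrand α hf hg p).aestronglyMeasurable, h⟩

lemma enorm_duhamel_le (α : ℝ) (f g : ℝ × Plane → ℝ) (p : ℝ × Plane) :
    ‖duhamel α f g p‖ₑ ≤ ∫⁻ q, ‖duhamelIntegrand α f g p q‖ₑ :=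
  enorm_integral_le_lintegral_enorm _

lemma duhamelIntegrand_sub_left {α : ℝ} (hα : 0 < α) {f f' : ℝ × Plane → ℝ} (g : ℝ × Plane → ℝ)
    (hf : ∀ s, 0 < s → Integrable fun y => f (s, y))
    (hf' : ∀ s, 0 < s → Integrable fun y => f' (s, y)) (p q : ℝ × Plane) :
    duhamelIntegrand α (fun r => f r - f' r) g p q =
      duhamelIntegrand α f g p q - duhamelIntegrand α f' g p q := by
  unfold duhamelIntegrand
  split_ifs with h
  · rw [velocity_sub hα (hf _ h.1) (hf' _ h.1), smul_sub, inner_sub_right]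
  · simp

lemma duhamelIntegrand_sub_right (α : ℝ) (f g g' : ℝ × Plane → ℝ) (p q : ℝ × Plane) :
    duhamelIntegrand α f (fun r => g r - g' r) p q =
      duhamelIntegrand α f g p q - duhamelIntegrand α f g' p q := by
  unfold duhamelIntegrand
  split_ifs with h
  · rw [sub_smul, inner_sub_right]
  · simp

lemma duhamel_sub_left {α : ℝ} (hα : 0 < α) {f f' g : ℝ × Plane → ℝ}
    (hf : ∀ s, 0 < s → Integrable fun y => f (s, y))
    (hf' : ∀ s, 0 < s → Integrable fun y => f' (s, y)) {p : ℝ × Plane}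
    (h : Integrable (duhamelIntegrand α f g p)) (h' : Integrable (duhamelIntegrand α f' g p)) :
    duhamel α (fun r => f r - f' r) g p = duhamel α f g p - duhamel α f' g p := by
  unfold duhamel
  rw [← integral_sub h h']
  simp_rw [duhamelIntegrand_sub_left hα g hf hf']

lemma duhamel_sub_right {α : ℝ} {f g g' : ℝ × Plane → ℝ} {p : ℝ × Plane}
    (h : Integrable (duhamelIntegrand α f g p)) (h' : Integrable (duhamelIntegrand α f g' p)) :
    duhamel α f (fun r => g r - g' r) p = duhamel α f g p - duhamel α f g' p := by
  unfold duhamel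
  rw [← integral_sub h h']
  simp_rw [duhamelIntegrand_sub_right α]

/-- `duhamel` is a single integral over space-time, convenient for measurability and for linearity;
Fubini recovers the iterated integral of the mild formulation. -/
lemma duhamel_eq_intervalIntegral {α : ℝ} {f g : ℝ × Plane → ℝ} {t : ℝ} (ht : 0 < t) {x : Plane}
    (h : Integrable (duhamelIntegrand α f g (t, x))) :
    duhamel α f g (t, x) = ∫ s in (0 : ℝ)..t, ∫ y : Plane,
      inner ℝ (gradient (heatKernel (t - s)) (x - y))
        (g (s, y) • velocity α (fun z => f (s, z)) y) := by
  unfold duhamel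
  rw [Measure.volume_eq_prod] at h ⊢
  rw [integral_prod _ h, intervalIntegral.integral_of_le ht.le,
    setIntegral_congr_set (Ioo_ae_eq_Ioc (a := (0 : ℝ)) (b := t)).symm,
    ← integral_indicator measurableSet_Ioo]
  refine integral_congr_ae (.of_forall fun s => ?_)
  simp only [duhamelIntegrand]
  by_cases hs : s ∈ Set.Ioo 0 t
  · simp only [if_pos hs, Set.indicator_of_mem hs]
  · simp only [if_neg hs, Set.indicator_of_notMem hs, integral_zero]

/-- The two hypotheses differ in form because `f` enters through whole time slices, by way of the
velocity, whereas `g` enters through its values in space-time. -/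
lemma duhamel_congr_ae {α : ℝ} {f f' g g' : ℝ × Plane → ℝ}
    (hf : ∀ᵐ s, 0 < s → (fun y => f (s, y)) =ᵐ[volume] fun y => f' (s, y))
    (hg : g =ᵐ[volume.restrict (Set.Ioi 0 ×ˢ Set.univ)] g') (p : ℝ × Plane) :
    duhamel α f g p = duhamel α f' g' p := by
  refine integral_congr_ae ?_
  have h1 : ∀ᵐ q : ℝ × Plane, 0 < q.1 →
      (fun y => f (q.1, y)) =ᵐ[volume] fun y => f' (q.1, y) := by
    rw [Measure.volume_eq_prod]
    exact Measure.quasiMeasurePreserving_fst.ae hf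
  rw [Filter.EventuallyEq, ae_restrict_iff' (measurableSet_Ioi.prod MeasurableSet.univ)] at hg
  filter_upwards [h1, hg] with q h1 h2
  unfold duhamelIntegrand
  split_ifs with h
  · rw [velocity_congr_ae (h1 h.1), h2 ⟨h.1, trivial⟩]
  · rfl

/-! ### Decay classes and the bilinear estimate -/

/-- Functions of time and space that decay like `t^{-ν}` relative to the heat kernel, in `L¹` and
in `L^∞`, with an initial singularity `t^{-1/2}` in `L^∞`. -/
structure Decays (ν N : ℝ) (f : ℝ × Plane → ℝ) : Prop where
  measurable : Measurable f
  lintegral_le : ∀ t, 0 < t → ∫⁻ x, ‖f (t, x)‖ₑ ≤ ENNReal.ofReal (N * (1 + t) ^ (-ν))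
  abs_le : ∀ t, 0 < t → ∀ x, |f (t, x)| ≤ N * (t ^ (-1 / 2 : ℝ) * (1 + t) ^ (-1 / 2 - ν))

namespace Decays

variable {ν N ν' N' : ℝ} {f g : ℝ × Plane → ℝ}

lemma integrable (hf : Decays ν N f) {t : ℝ} (ht : 0 < t) : Integrable fun x => f (t, x) :=
  ⟨(hf.measurable.comp measurable_prodMk_left).aestronglyMeasurable,
    (hf.lintegral_le t ht).trans_lt ENNReal.ofReal_lt_top⟩

lemma enorm_le (hf : Decays ν N f) {t : ℝ} (ht : 0 < t) (x : Plane) :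
    ‖f (t, x)‖ₑ ≤ ENNReal.ofReal (N * (t ^ (-1 / 2 : ℝ) * (1 + t) ^ (-1 / 2 - ν))) := by
  rw [← ofReal_norm]
  exact ENNReal.ofReal_le_ofReal (hf.abs_le t ht x)

lemma nonneg (hf : Decays ν N f) : 0 ≤ N := by
  have h := (abs_nonneg _).trans (hf.abs_le 1 one_pos 0)
  rw [Real.one_rpow, one_mul] at h
  exact nonneg_of_mul_nonneg_left h (by positivity)

lemma mono (hf : Decays ν N f) (hN : N ≤ N') (hν : ν' ≤ ν) : Decays ν' N' f := by
  have h0 := hf.nonneg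
  refine ⟨hf.measurable, fun t ht => (hf.lintegral_le t ht).trans (ENNReal.ofReal_le_ofReal ?_),
    fun t ht x => (hf.abs_le t ht x).trans ?_⟩
  · refine mul_le_mul hN ?_ (by positivity) (h0.trans hN)
    exact Real.rpow_le_rpow_of_exponent_le (by linarith) (by linarith)
  · refine mul_le_mul hN ?_ (by positivity) (h0.trans hN)
    gcongr
    linarith

lemma sub (hf : Decays ν N f) (hg : Decays ν N' g) : Decays ν (N + N') fun q => f q - g q := by
  have h0 := hf.nonneg
  have h0' := hg.nonneg
  refine ⟨hf.measurable.sub hg.measurable, fun t ht => ?_, fun t ht x => ?_⟩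
  · rw [add_mul, ENNReal.ofReal_add (by positivity) (by positivity)]
    refine le_trans ?_ (add_le_add (hf.lintegral_le t ht) (hg.lintegral_le t ht))
    have hm : Measurable fun x => ‖f (t, x)‖ₑ :=
      (hf.measurable.comp measurable_prodMk_left).enorm
    rw [← lintegral_add_left hm]
    exact lintegral_mono fun x => enorm_sub_le
  · rw [add_mul]
    exact (abs_sub _ _).trans (add_le_add (hf.abs_le t ht x) (hg.abs_le t ht x))

lemma neg (hf : Decays ν N f) : Decays ν N fun q => -f q :=
  ⟨hf.measurable.neg, fun t ht => by simpa using hf.lintegral_le t ht,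
    fun t ht x => by simpa using hf.abs_le t ht x⟩

lemma add (hf : Decays ν N f) (hg : Decays ν N' g) : Decays ν (N + N') fun q => f q + g q := by
  simpa using hf.sub hg.neg

lemma zero (hN : 0 ≤ N) : Decays ν N fun _ => 0 :=
  ⟨measurable_const, fun t ht => by simp, fun t ht x => by rw [abs_zero]; positivity⟩

/-- A constant in the bound of the velocity by the vorticity. -/
noncomputable def velocityConst (α : ℝ) : ℝ := 2 * helmholtzRieszBound α + circleLength + 2

lemma velocityConst_nonneg {α : ℝ} (hα : 0 < α) : 0 ≤ velocityConst α := by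
  have h1 := helmholtzRieszBound_nonneg hα
  have h2 := circleLength_nonneg
  unfold velocityConst; positivity

lemma enorm_velocity_le {α : ℝ} (hα : 0 < α) (hf : Decays ν N f) {t : ℝ} (ht : 0 < t)
    (x : Plane) : ‖velocity α (fun z => f (t, z)) x‖ₑ ≤
      ENNReal.ofReal (velocityConst α * N * (1 + t) ^ (-1 / 2 - ν)) := by
  have h1 := helmholtzRieszBound_nonneg hα
  have h2 := circleLength_nonneg
  have h0 := hf.nonneg
  have e : (1 + t) ^ (-ν) = √(1 + t) * (1 + t) ^ (-1 / 2 - ν) := by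
    rw [Real.sqrt_eq_rpow, ← Real.rpow_add (by positivity)]; congr 1; ring
  have hp : 0 < (1 + t) ^ (-1 / 2 - ν) := by positivity
  -- For `t ≤ 1` the `L¹` bound is used, since the sup norm may blow up like `t^{-1/2}`. For `t ≥ 1`
  -- the Riesz bound with `R = √t` gains the factor `t^{-1/2}`. The velocity therefore has no
  -- initial singularity.
  rcases le_total t 1 with h | h
  · refine (VCHE.enorm_velocity_le hα _ x).trans ?_
    refine (mul_le_mul_right (hf.lintegral_le t ht) _).trans ?_
    rw [← ENNReal.ofReal_mul h1]
    refine ENNReal.ofReal_le_ofReal ?_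
    have hs : √(1 + t) ≤ 2 := by
      rw [Real.sqrt_le_left (by norm_num)]; linarith
    rw [e]
    calc _ = helmholtzRieszBound α * √(1 + t) * (N * (1 + t) ^ (-1 / 2 - ν)) := by ring
      _ ≤ velocityConst α * (N * (1 + t) ^ (-1 / 2 - ν)) := by
          gcongr
          unfold velocityConst
          nlinarith
      _ = _ := by ring
  · have hst : 0 < √t := Real.sqrt_pos.2 ht
    refine (enorm_velocity_le_of_bounded hα (hf.measurable.comp measurable_prodMk_left)
      (fun y => hf.enorm_le ht y) hst x).trans ?_
    refine (add_le_add_right (mul_le_mul_left (hf.lintegral_le t ht) _) _).trans ?_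
    rw [← ENNReal.ofReal_mul (by positivity), ← ENNReal.ofReal_mul (by positivity),
      ← ENNReal.ofReal_add (by positivity) (by positivity)]
    refine ENNReal.ofReal_le_ofReal ?_
    have hs : √(1 + t) * (√t)⁻¹ ≤ 2 := by
      rw [← div_eq_mul_inv, div_le_iff₀ hst, Real.sqrt_le_left (by positivity), mul_pow,
        Real.sq_sqrt ht.le]
      linarith
    have h5 : t ^ (-1 / 2 : ℝ) * √t = 1 := by
      rw [Real.sqrt_eq_rpow, ← Real.rpow_add ht]; norm_num
    rw [e]
    calc _ = (circleLength * (t ^ (-1 / 2 : ℝ) * √t) + √(1 + t) * (√t)⁻¹) *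
          (N * (1 + t) ^ (-1 / 2 - ν)) := by ring
      _ ≤ velocityConst α * (N * (1 + t) ^ (-1 / 2 - ν)) := by
          rw [h5]
          gcongr
          unfold velocityConst
          linarith
      _ = _ := by ring

/-- A constant in the bilinear estimate. -/
noncomputable def duhamelConst (α l : ℝ) : ℝ := velocityConst α * (16 / (1 / 2 - l) + 80)

lemma duhamelConst_nonneg {α l : ℝ} (hα : 0 < α) (hl : l < 1 / 2) : 0 ≤ duhamelConst α l := by
  have h1 := velocityConst_nonneg hα
  have h2 : 0 < 1 / 2 - l := by linarith
  unfold duhamelConst; positivity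

lemma lintegral_duhamelIntegrand_le {α : ℝ} (hα : 0 < α) (hf : Decays ν N f) (hg : Decays ν' N' g)
    (hν : 0 ≤ ν) (hν' : 0 ≤ ν') (hl : ν + ν' < 1 / 2) {t : ℝ} (ht : 0 < t) (x : Plane) :
    ∫⁻ q, ‖duhamelIntegrand α f g (t, x) q‖ₑ ≤
      ENNReal.ofReal (duhamelConst α (ν + ν') * (N * N') * (1 + t) ^ (-1 - (ν + ν'))) := by
  have hc := velocityConst_nonneg hα
  have h0 := hf.nonneg
  have h0' := hg.nonneg
  refine (VCHE.lintegral_duhamelIntegrand_le α hf.measurable hg.measurable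
    (fun s hs y => hf.enorm_velocity_le hα hs y) t x).trans ?_
  -- The better, at each time, of the sup estimate and the `L¹` smoothing estimate for the heat
  -- convolution of `g`, after the decay of the velocity has been included.
  set A : ℝ → ℝ≥0∞ := fun s =>
    min (ENNReal.ofReal (s ^ (-1 / 2 : ℝ) * (1 + s) ^ (-1 - (ν + ν'))))
      (ENNReal.ofReal ((1 + s) ^ (-1 / 2 - (ν + ν')) / (t - s))) with hAdef
  have hbound : ∀ s ∈ Set.Ioo 0 t,
      ENNReal.ofReal (velocityConst α * N * (1 + s) ^ (-1 / 2 - ν)) *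
        ∫⁻ y, ENNReal.ofReal (heatKernel (2 * (t - s)) (x - y)) * ‖g (s, y)‖ₑ ≤
      ENNReal.ofReal (velocityConst α * (N * N')) * A s := by
    intro s hs
    have hs0 : 0 < s := hs.1
    have hts : 0 < t - s := by linarith [hs.2]
    rcases min_choice (ENNReal.ofReal (s ^ (-1 / 2 : ℝ) * (1 + s) ^ (-1 - (ν + ν'))))
      (ENNReal.ofReal ((1 + s) ^ (-1 / 2 - (ν + ν')) / (t - s))) with h | h
    · simp only [hAdef, h]
      refine (mul_le_mul_right (heat_conv_le_sup (by positivity)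
        (fun y => hg.enorm_le hs0 y) x) _).trans ?_
      rw [← ENNReal.ofReal_mul (by positivity), ← ENNReal.ofReal_mul (by positivity)]
      refine ENNReal.ofReal_le_ofReal (le_of_eq ?_)
      have e : (1 + s) ^ (-1 - (ν + ν')) =
          (1 + s) ^ (-1 / 2 - ν) * (1 + s) ^ (-1 / 2 - ν') := by
        rw [← Real.rpow_add (by positivity)]; congr 1; ring
      rw [e]; ring
    · simp only [hAdef, h]
      refine (mul_le_mul_right (heat_conv_le_lintegral (by positivity) _ x) _).trans ?_
      refine (mul_le_mul_right (mul_le_mul_right (hg.lintegral_le s hs0) _) _).trans ?_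
      rw [← ENNReal.ofReal_mul (by positivity), ← ENNReal.ofReal_mul (by positivity),
        ← ENNReal.ofReal_mul (by positivity)]
      refine ENNReal.ofReal_le_ofReal ?_
      have e : (1 + s) ^ (-1 / 2 - (ν + ν')) = (1 + s) ^ (-1 / 2 - ν) * (1 + s) ^ (-ν') := by
        rw [← Real.rpow_add (by positivity)]; congr 1; ring
      rw [e]
      have h4 : 1 / (4 * Real.pi * (2 * (t - s))) ≤ 1 / (t - s) := by
        refine one_div_le_one_div_of_le hts ?_
        nlinarith [Real.pi_gt_three]
      calc _ = (velocityConst α * (N * N')) * ((1 + s) ^ (-1 / 2 - ν) * (1 + s) ^ (-ν')) *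
            (1 / (4 * Real.pi * (2 * (t - s)))) := by ring
        _ ≤ (velocityConst α * (N * N')) * ((1 + s) ^ (-1 / 2 - ν) * (1 + s) ^ (-ν')) *
            (1 / (t - s)) := by gcongr
        _ = _ := by ring
  calc _ ≤ ∫⁻ s in Set.Ioo 0 t, ENNReal.ofReal (velocityConst α * (N * N')) *
        (ENNReal.ofReal (2 / √(t - s)) * A s) := by
        refine setLIntegral_mono' measurableSet_Ioo fun s hs => ?_
        rw [mul_left_comm (ENNReal.ofReal (velocityConst α * (N * N')))]
        exact mul_le_mul_right (hbound s hs) _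
    _ ≤ ENNReal.ofReal (velocityConst α * (N * N')) * ENNReal.ofReal
          ((16 / (1 / 2 - (ν + ν')) + 80) * (1 + t) ^ (-1 - (ν + ν'))) := by
        rw [lintegral_const_mul' _ _ ENNReal.ofReal_ne_top]
        refine mul_le_mul_right (lintegral_heat_sup_weight_le (by positivity) hl ht ?_ ?_) _
        · exact fun s _ => min_le_left _ _
        · exact fun s _ => min_le_right _ _
    _ = _ := by
        rw [← ENNReal.ofReal_mul (by positivity)]
        congr 1
        unfold duhamelConst
        ring

lemma lintegral_lintegral_duhamelIntegrand_le {α : ℝ} (hα : 0 < α) (hf : Decays ν N f)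
    (hg : Decays ν' N' g) (hν : 0 ≤ ν) (hν' : 0 ≤ ν') (hl : ν + ν' < 1 / 2) {t : ℝ} (ht : 0 < t) :
    ∫⁻ x, ∫⁻ q, ‖duhamelIntegrand α f g (t, x) q‖ₑ ≤
      ENNReal.ofReal (duhamelConst α (ν + ν') * (N * N') * (1 + t) ^ (-(ν + ν'))) := by
  have hc := velocityConst_nonneg hα
  have h0 := hf.nonneg
  have h0' := hg.nonneg
  have hk : 0 < 1 / 2 - (ν + ν') := by linarith
  refine (VCHE.lintegral_lintegral_duhamelIntegrand_le α hf.measurable hg.measurable (by fun_prop)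
    (fun s hs y => hf.enorm_velocity_le hα hs y) t).trans ?_
  calc _ ≤ ∫⁻ s in Set.Ioo 0 t, ENNReal.ofReal (velocityConst α * (N * N')) *
        (ENNReal.ofReal (2 / √(t - s)) * ENNReal.ofReal ((1 + s) ^ (-1 / 2 - (ν + ν')))) := by
        refine setLIntegral_mono' measurableSet_Ioo fun s hs => ?_
        have hs0 : 0 < s := hs.1
        rw [mul_left_comm (ENNReal.ofReal (velocityConst α * (N * N')))]
        refine mul_le_mul_right ?_ _
        refine (mul_le_mul_right (hg.lintegral_le s hs0) _).trans (le_of_eq ?_)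
        rw [← ENNReal.ofReal_mul (by positivity), ← ENNReal.ofReal_mul (by positivity)]
        have e : (1 + s) ^ (-1 / 2 - (ν + ν')) = (1 + s) ^ (-1 / 2 - ν) * (1 + s) ^ (-ν') := by
          rw [← Real.rpow_add (by positivity)]; congr 1; ring
        rw [e]
        congr 1
        ring
    _ ≤ ENNReal.ofReal (velocityConst α * (N * N')) * ENNReal.ofReal
          ((8 / (1 / 2 - (ν + ν')) + 16) * (1 + t) ^ (-(ν + ν'))) := by
        rw [lintegral_const_mul' _ _ ENNReal.ofReal_ne_top]
        exact mul_le_mul_right (lintegral_heat_weight_le (by positivity) hl ht) _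
    _ ≤ _ := by
        rw [← ENNReal.ofReal_mul (by positivity)]
        refine ENNReal.ofReal_le_ofReal ?_
        have h8 : 8 / (1 / 2 - (ν + ν')) ≤ 16 / (1 / 2 - (ν + ν')) := by gcongr; norm_num
        calc _ = (velocityConst α * (8 / (1 / 2 - (ν + ν')) + 16)) * (N * N') *
              (1 + t) ^ (-(ν + ν')) := by ring
          _ ≤ _ := by
            unfold duhamelConst
            gcongr
            norm_num

lemma integrable_duhamelIntegrand {α : ℝ} (hα : 0 < α) (hf : Decays ν N f) (hg : Decays ν' N' g)
    (hν : 0 ≤ ν) (hν' : 0 ≤ ν') (hl : ν + ν' < 1 / 2) {t : ℝ} (ht : 0 < t) (x : Plane) :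
    Integrable (duhamelIntegrand α f g (t, x)) :=
  VCHE.integrable_duhamelIntegrand hf.measurable hg.measurable
    ((hf.lintegral_duhamelIntegrand_le hα hg hν hν' hl ht x).trans_lt ENNReal.ofReal_lt_top)

/-- Stronger than membership in a decay class: the factor `t^{-1/2}` is absent. The final `L^p`
estimate relies on this at small times. -/
lemma abs_duhamel_le {α : ℝ} (hα : 0 < α) (hf : Decays ν N f) (hg : Decays ν' N' g)
    (hν : 0 ≤ ν) (hν' : 0 ≤ ν') (hl : ν + ν' < 1 / 2) {t : ℝ} (ht : 0 < t) (x : Plane) :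
    |duhamel α f g (t, x)| ≤ duhamelConst α (ν + ν') * (N * N') * (1 + t) ^ (-1 - (ν + ν')) := by
  have h := (enorm_duhamel_le α f g (t, x)).trans
    (hf.lintegral_duhamelIntegrand_le hα hg hν hν' hl ht x)
  have h0 := hf.nonneg
  have h0' := hg.nonneg
  have hc := duhamelConst_nonneg hα hl
  rwa [← ofReal_norm, ENNReal.ofReal_le_ofReal_iff (by positivity)] at h

/-- The bilinear estimate. -/
lemma duhamel {α : ℝ} (hα : 0 < α) (hf : Decays ν N f) (hg : Decays ν' N' g)
    (hν : 0 ≤ ν) (hν' : 0 ≤ ν') (hl : ν + ν' < 1 / 2) :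
    Decays (ν + ν') (duhamelConst α (ν + ν') * (N * N')) (duhamel α f g) := by
  have h0 := hf.nonneg
  have h0' := hg.nonneg
  have hc := duhamelConst_nonneg hα hl
  refine ⟨measurable_duhamel α hf.measurable hg.measurable, fun t ht => ?_, fun t ht x => ?_⟩
  · exact (lintegral_mono fun x => enorm_duhamel_le α f g (t, x)).trans
      (hf.lintegral_lintegral_duhamelIntegrand_le hα hg hν hν' hl ht)
  · refine (hf.abs_duhamel_le hα hg hν hν' hl ht x).trans ?_
    gcongr
    rw [show -1 - (ν + ν') = -1 / 2 + (-1 / 2 - (ν + ν')) by ring, Real.rpow_add (by positivity)]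
    gcongr ?_ * _
    exact Real.rpow_le_rpow_of_nonpos ht (by linarith) (by norm_num)

end Decays

/-! ### Reflections and radial vorticities -/

/-- A reflection reverses orientation, so it anticommutes with the rotation by a right angle. -/
lemma perp_reflection {u : Plane} (hu : ‖u‖ = 1) (z : Plane) :
    perp ((ℝ ∙ u).reflection z) = -(ℝ ∙ u).reflection (perp z) := by
  have h1 : u 0 ^ 2 + u 1 ^ 2 = 1 := by
    have := EuclideanSpace.norm_sq_eq u
    rw [hu] at this
    simpa [Fin.sum_univ_two] using this.symm
  rw [Submodule.reflection_singleton_apply, Submodule.reflection_singleton_apply, hu]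
  ext i
  fin_cases i
  · simp [perp, PiLp.inner_apply, Fin.sum_univ_two]
    linear_combination (-2 * z 1) * h1
  · simp [perp, PiLp.inner_apply, Fin.sum_univ_two]
    linear_combination (2 * z 0) * h1

lemma exists_unit_reflection_eq (x : Plane) :
    ∃ u : Plane, ‖u‖ = 1 ∧ (ℝ ∙ u).reflection x = x := by
  by_cases hx : x = 0
  · exact ⟨EuclideanSpace.single 0 1, by simp, by simp [hx]⟩
  · refine ⟨‖x‖⁻¹ • x, by rw [norm_smul]; simp [hx], ?_⟩
    rw [Submodule.reflection_eq_self_iff, Submodule.mem_span_singleton]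
    exact ⟨‖x‖, by simp [smul_smul, hx]⟩

lemma integral_comp_isometry {E : Type*} [NormedAddCommGroup E] [NormedSpace ℝ E]
    (S : Plane ≃ₗᵢ[ℝ] Plane) (f : Plane → E) : ∫ y, f (S y) = ∫ y, f y :=
  S.measurePreserving.integral_comp S.toHomeomorph.measurableEmbedding f

lemma map_integral_isometry (S : Plane ≃ₗᵢ[ℝ] Plane) (f : Plane → Plane) :
    S (∫ y, f y) = ∫ y, S (f y) :=
  (S.toContinuousLinearEquiv.integral_comp_comm f).symm

section Reflection

variable {u : Plane}

lemma velocityKernel_reflection (α : ℝ) (hu : ‖u‖ = 1) (x : Plane) :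
    velocityKernel α ((ℝ ∙ u).reflection x) = -(ℝ ∙ u).reflection (velocityKernel α x) := by
  set S := (ℝ ∙ u).reflection
  unfold velocityKernel biotSavart
  rw [← integral_comp_isometry S, map_smul, ← smul_neg, map_integral_isometry, ← integral_neg]
  congr 2
  funext y
  rw [← map_sub, S.norm_map, perp_reflection hu, map_smul, smul_neg,
    helmholtzKernel_congr α (S.norm_map y)]

lemma velocity_reflection (α : ℝ) (hu : ‖u‖ = 1) {f : Plane → ℝ}
    (hf : ∀ y, f ((ℝ ∙ u).reflection y) = f y) (x : Plane) :
    velocity α f ((ℝ ∙ u).reflection x) = -(ℝ ∙ u).reflection (velocity α f x) := by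
  set S := (ℝ ∙ u).reflection
  unfold velocity
  rw [← integral_comp_isometry S, map_integral_isometry, ← integral_neg]
  congr 1
  funext y
  rw [← map_sub, velocityKernel_reflection α hu, hf, map_smul, smul_neg]

end Reflection

/-- Reflect in a line through `x` and the origin. The gradient of the heat kernel and the radial
weight `g` are equivariant, while the velocity of a radial vorticity picks up a sign, so the
integral equals its own negative. No formula for the tangential velocity is needed. -/
lemma integral_gradient_heatKernel_radial (α t : ℝ) {f g : Plane → ℝ}
    (hf : ∀ y z, ‖y‖ = ‖z‖ → f y = f z) (hg : ∀ y z, ‖y‖ = ‖z‖ → g y = g z) (x : Plane) :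
    ∫ y, inner ℝ (gradient (heatKernel t) (x - y)) (g y • velocity α f y) = 0 := by
  obtain ⟨u, hu, hx⟩ := exists_unit_reflection_eq x
  have key : ∫ y, inner ℝ (gradient (heatKernel t) (x - y)) (g y • velocity α f y) =
      -∫ y, inner ℝ (gradient (heatKernel t) (x - y)) (g y • velocity α f y) := by
    conv_lhs => rw [← integral_comp_isometry (ℝ ∙ u).reflection]
    rw [← integral_neg]
    congr 1
    funext y
    rw [velocity_reflection α hu (fun y => hf _ _ ((ℝ ∙ u).reflection.norm_map y)),
      hg _ _ ((ℝ ∙ u).reflection.norm_map y)]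
    -- Since `x` is its own mirror image, `x` minus the image of `y` is the image of `x - y`.
    nth_rewrite 1 [← hx]
    rw [← map_sub, gradient_heatKernel, heatKernel_congr t ((ℝ ∙ u).reflection.norm_map (x - y)),
      ← map_smul, smul_neg, ← map_smul, inner_neg_right, LinearIsometryEquiv.inner_map_map,
      gradient_heatKernel]
  linarith

lemma duhamel_radial {α : ℝ} {f g : ℝ × Plane → ℝ}
    (hf : ∀ t y z, ‖y‖ = ‖z‖ → f (t, y) = f (t, z))
    (hg : ∀ t y z, ‖y‖ = ‖z‖ → g (t, y) = g (t, z)) {t : ℝ} (ht : 0 < t) {x : Plane}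
    (h : Integrable (duhamelIntegrand α f g (t, x))) : duhamel α f g (t, x) = 0 := by
  rw [duhamel_eq_intervalIntegral ht h]
  simp_rw [fun s => integral_gradient_heatKernel_radial α (t - s) (hf s) (hg s) x]
  simp

/-! ### The heat semigroup -/

/-- The heat semigroup applied to `f`, as a function of time and space. -/
noncomputable def heatFlow (f : Plane → ℝ) (p : ℝ × Plane) : ℝ :=
  ∫ y, heatKernel p.1 (p.2 - y) * f y

lemma heatFlow_congr_ae {f g : Plane → ℝ} (h : f =ᵐ[volume] g) : heatFlow f = heatFlow g := by
  funext p
  refine integral_congr_ae ?_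
  filter_upwards [h] with y hy
  rw [hy]

lemma measurable_heatFlow {f : Plane → ℝ} (hf : AEStronglyMeasurable f) :
    Measurable (heatFlow f) := by
  rw [heatFlow_congr_ae hf.ae_eq_mk]
  refine (StronglyMeasurable.integral_prod_right' (ν := volume)
    (f := fun r : (ℝ × Plane) × Plane => heatKernel r.1.1 (r.1.2 - r.2) * hf.mk f r.2)
    (Measurable.stronglyMeasurable ?_)).measurable
  have h : Measurable fun r : (ℝ × Plane) × Plane => heatKernel r.1.1 (r.1.2 - r.2) :=
    measurable_heatKernel_uncurry.comp (f := fun r : (ℝ × Plane) × Plane =>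
      (r.1.1, r.1.2 - r.2)) (by fun_prop)
  exact h.mul (hf.stronglyMeasurable_mk.measurable.comp measurable_snd)

lemma enorm_heatFlow_le (f : Plane → ℝ) {t : ℝ} (ht : 0 < t) (x : Plane) :
    ‖heatFlow f (t, x)‖ₑ ≤ ∫⁻ y, ENNReal.ofReal (heatKernel t (x - y)) * ‖f y‖ₑ := by
  refine (enorm_integral_le_lintegral_enorm _).trans (le_of_eq ?_)
  refine lintegral_congr fun y => ?_
  rw [enorm_mul, Real.enorm_of_nonneg (heatKernel_nonneg ht.le _)]

lemma integrable_heatFlow_integrand {f : Plane → ℝ} (hf : Integrable f) {t : ℝ} (ht : 0 < t)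
    (x : Plane) : Integrable fun y => heatKernel t (x - y) * f y := by
  have hc := continuous_heatKernel t
  refine hf.bdd_mul (c := 1 / (4 * Real.pi * t)) (by fun_prop) (.of_forall fun y => ?_)
  rw [Real.norm_of_nonneg (heatKernel_nonneg ht.le _)]
  exact heatKernel_le ht _

lemma lintegral_heatFlow_le {f : Plane → ℝ} (hf : AEStronglyMeasurable f) {t : ℝ} (ht : 0 < t) :
    ∫⁻ x, ‖heatFlow f (t, x)‖ₑ ≤ ∫⁻ y, ‖f y‖ₑ :=
  (lintegral_mono fun x => enorm_heatFlow_le f ht x).trans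
    (lintegral_heat_conv ht hf.enorm).le

/-- Cauchy-Schwarz against the heat kernel. -/
lemma heat_conv_sq_le {t : ℝ} (ht : 0 < t) {h : Plane → ℝ≥0∞} (hh : AEMeasurable h) (x : Plane) :
    (∫⁻ y, ENNReal.ofReal (heatKernel t (x - y)) * h y) ^ 2 ≤
      ∫⁻ y, ENNReal.ofReal (heatKernel t (x - y)) * h y ^ 2 := by
  have hc := continuous_heatKernel t
  have hm : Measurable fun y => ENNReal.ofReal (heatKernel t (x - y)) := by fun_prop
  have H := ENNReal.lintegral_mul_norm_pow_le hm.aemeasurable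
    (hm.aemeasurable.mul (hh.pow_const 2)) (p := 1 / 2) (q := 1 / 2)
    (by norm_num) (by norm_num) (by norm_num)
  rw [lintegral_heatKernel_sub_left ht, ENNReal.one_rpow, one_mul] at H
  have e : ∀ y, ENNReal.ofReal (heatKernel t (x - y)) ^ (1 / 2 : ℝ) *
      ((fun y => ENNReal.ofReal (heatKernel t (x - y))) * fun y => h y ^ 2) y ^ (1 / 2 : ℝ) =
      ENNReal.ofReal (heatKernel t (x - y)) * h y := by
    intro y
    simp only [Pi.mul_apply]
    rw [ENNReal.mul_rpow_of_nonneg _ _ (by norm_num), ← mul_assoc,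
      ← ENNReal.rpow_add_of_nonneg _ _ (by norm_num) (by norm_num), ← ENNReal.rpow_natCast,
      ← ENNReal.rpow_mul]
    norm_num
  simp_rw [e] at H
  calc _ ≤ ((∫⁻ y, ENNReal.ofReal (heatKernel t (x - y)) * h y ^ 2) ^ (1 / 2 : ℝ)) ^ 2 := by
        gcongr
        exact H
    _ = _ := by
        rw [← ENNReal.rpow_natCast, ← ENNReal.rpow_mul]; norm_num

lemma lintegral_heatFlow_sq_le {f : Plane → ℝ} (hf : AEStronglyMeasurable f) {t : ℝ}
    (ht : 0 < t) : ∫⁻ x, ‖heatFlow f (t, x)‖ₑ ^ 2 ≤ ∫⁻ y, ‖f y‖ₑ ^ 2 := by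
  refine le_trans (lintegral_mono fun x => ?_) (lintegral_heat_conv ht (hf.enorm.pow_const 2)).le
  exact (pow_le_pow_left' (enorm_heatFlow_le f ht x) 2).trans (heat_conv_sq_le ht hf.enorm x)

lemma enorm_heatFlow_sq_le {f : Plane → ℝ} (hf : AEStronglyMeasurable f) {t : ℝ} (ht : 0 < t)
    (x : Plane) :
    ‖heatFlow f (t, x)‖ₑ ^ 2 ≤ ENNReal.ofReal (1 / (4 * Real.pi * t)) * ∫⁻ y, ‖f y‖ₑ ^ 2 :=
  (pow_le_pow_left' (enorm_heatFlow_le f ht x) 2).trans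
    ((heat_conv_sq_le ht hf.enorm x).trans (heat_conv_le_lintegral ht _ x))

/-- The fundamental theorem of calculus along the segment from `x` to `x - y`, combined with the
gradient bound. -/
lemma enorm_heatKernel_sub_le {t : ℝ} (ht : 0 < t) (x y : Plane) :
    ‖heatKernel t (x - y) - heatKernel t x‖ₑ ≤ ∫⁻ θ in Set.Ioc (0 : ℝ) 1,
      ENNReal.ofReal (2 * ‖y‖ / √t) * ENNReal.ofReal (heatKernel (2 * t) (x - θ • y)) := by
  have hd : ∀ θ : ℝ, HasDerivAt (fun θ : ℝ => heatKernel t (x - θ • y))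
      ((-(heatKernel t (x - θ • y) / (2 * t)) • innerSL ℝ (x - θ • y)) (-y)) θ := by
    intro θ
    have h1 : HasDerivAt (fun θ : ℝ => x - θ • y) (-y) θ := by
      simpa using ((hasDerivAt_id θ).smul_const y).const_sub x
    exact (hasFDerivAt_heatKernel t (x - θ • y)).comp_hasDerivAt θ h1
  have hc := continuous_heatKernel t
  have hcont : Continuous fun θ : ℝ =>
      (-(heatKernel t (x - θ • y) / (2 * t)) • innerSL ℝ (x - θ • y)) (-y) := by
    simp only [smul_apply, innerSL_apply_apply]
    fun_prop
  have h := intervalIntegral.integral_eq_sub_of_hasDerivAt (fun θ _ => hd θ)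
    (hcont.intervalIntegrable 0 1)
  simp only [one_smul, zero_smul, sub_zero] at h
  rw [← h, intervalIntegral.integral_of_le zero_le_one]
  refine (enorm_integral_le_lintegral_enorm _).trans (lintegral_mono fun θ => ?_)
  rw [← ofReal_norm, ← ENNReal.ofReal_mul (by positivity)]
  refine ENNReal.ofReal_le_ofReal ?_
  have e : (-(heatKernel t (x - θ • y) / (2 * t)) • innerSL ℝ (x - θ • y)) (-y) =
      inner ℝ (gradient (heatKernel t) (x - θ • y)) (-y) := by
    rw [gradient_heatKernel, real_inner_smul_left]; rfl
  rw [e]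
  refine (norm_inner_le_norm _ _).trans ?_
  rw [norm_neg]
  calc _ ≤ 2 / √t * heatKernel (2 * t) (x - θ • y) * ‖y‖ := by
        gcongr; exact norm_gradient_heatKernel_le ht _
    _ = _ := by ring

/-- Interpolates between the triangle inequality and the gradient bound for differences of heat
kernels, so that a fractional moment of the data is enough. -/
lemma min_two_le_rpow {z b : ℝ} (hz : 0 ≤ z) (hb : 0 ≤ b) (hb1 : b ≤ 1) :
    min 2 (2 * z) ≤ 2 * z ^ b := by
  rcases le_total z 1 with h | h
  · refine (min_le_right _ _).trans ?_
    have := Real.rpow_le_rpow_of_exponent_ge' hz h hb hb1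
    rw [Real.rpow_one] at this
    linarith
  · refine (min_le_left _ _).trans ?_
    have := Real.one_le_rpow h hb
    linarith

lemma lintegral_heatKernel_sub_sub_le {t b : ℝ} (ht : 0 < t) (hb : 0 ≤ b) (hb1 : b ≤ 1)
    (y : Plane) : ∫⁻ x, ‖heatKernel t (x - y) - heatKernel t x‖ₑ ≤
      ENNReal.ofReal (2 * (‖y‖ / √t) ^ b) := by
  refine le_trans ?_ (ENNReal.ofReal_le_ofReal (min_two_le_rpow (by positivity) hb hb1))
  rw [ENNReal.ofReal_min]
  refine le_min ?_ ?_
  · have hc := continuous_heatKernel t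
    have hm : Measurable fun x => ENNReal.ofReal (heatKernel t (x - y)) := by fun_prop
    calc _ ≤ ∫⁻ x, (ENNReal.ofReal (heatKernel t (x - y)) + ENNReal.ofReal (heatKernel t x)) := by
          refine lintegral_mono fun x => ?_
          rw [← Real.enorm_of_nonneg (heatKernel_nonneg ht.le _),
            ← Real.enorm_of_nonneg (heatKernel_nonneg ht.le _)]
          exact enorm_sub_le
      _ = _ := by
          rw [lintegral_add_left hm, lintegral_heatKernel_sub ht, lintegral_heatKernel ht]
          norm_num
  · have hm : Measurable fun r : Plane × ℝ =>
        ENNReal.ofReal (heatKernel (2 * t) (r.1 - r.2 • y)) := by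
      have hc := continuous_heatKernel (2 * t)
      fun_prop
    refine (lintegral_mono fun x => enorm_heatKernel_sub_le ht x y).trans ?_
    rw [lintegral_lintegral_swap (hm.const_mul _).aemeasurable]
    have : ∀ θ : ℝ, ∫⁻ x, ENNReal.ofReal (2 * ‖y‖ / √t) *
        ENNReal.ofReal (heatKernel (2 * t) (x - θ • y)) = ENNReal.ofReal (2 * ‖y‖ / √t) := by
      intro θ
      rw [lintegral_const_mul' _ _ ENNReal.ofReal_ne_top, lintegral_heatKernel_sub (by positivity),
        mul_one]
    simp_rw [this]
    simp [mul_div_assoc]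

lemma enorm_heatKernel_sub_sub_le {t b : ℝ} (ht : 0 < t) (hb : 0 ≤ b) (hb1 : b ≤ 1)
    (x y : Plane) : ‖heatKernel t (x - y) - heatKernel t x‖ₑ ≤
      ENNReal.ofReal (1 / t * (2 * (‖y‖ / √t) ^ b)) := by
  have hpi := Real.pi_gt_three
  refine le_trans ?_ (ENNReal.ofReal_le_ofReal (mul_le_mul_of_nonneg_left
    (min_two_le_rpow (z := ‖y‖ / √t) (by positivity) hb hb1) (by positivity)))
  rw [mul_min_of_nonneg _ _ (by positivity), ENNReal.ofReal_min]
  refine le_min ?_ ?_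
  · rw [← ofReal_norm]
    refine ENNReal.ofReal_le_ofReal ?_
    rw [Real.norm_eq_abs, abs_le]
    have h1 := heatKernel_le ht x
    have h2 := heatKernel_le ht (x - y)
    have h3 := heatKernel_nonneg ht.le x
    have h4 := heatKernel_nonneg ht.le (x - y)
    have h5 : 1 / (4 * Real.pi * t) ≤ 1 / t := by
      refine one_div_le_one_div_of_le ht ?_
      nlinarith
    constructor <;> linarith
  · refine (enorm_heatKernel_sub_le ht x y).trans ?_
    calc _ ≤ ∫⁻ θ in Set.Ioc (0 : ℝ) 1, ENNReal.ofReal (2 * ‖y‖ / √t) * ENNReal.ofReal (1 / t) := by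
          refine lintegral_mono fun θ => mul_le_mul_right (ENNReal.ofReal_le_ofReal ?_) _
          refine (heatKernel_le (by positivity) _).trans ?_
          refine one_div_le_one_div_of_le ht ?_
          nlinarith
      _ = _ := by
          rw [← ENNReal.ofReal_mul (by positivity)]
          simp only [lintegral_const, MeasurableSet.univ, Measure.restrict_apply, Set.univ_inter,
            Real.volume_Ioc, sub_zero, ENNReal.ofReal_one, mul_one]
          congr 1
          ring

/-! ### Decay of the heat flow of mean-zero data -/

lemma rpow_neg_le_one_add {t b : ℝ} (ht : 1 ≤ t) (hb : 0 ≤ b) (hb1 : b ≤ 1) :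
    t ^ (-b) ≤ 2 * (1 + t) ^ (-b) := by
  have h1 : t ^ (-b) ≤ ((1 + t) / 2) ^ (-b) :=
    Real.rpow_le_rpow_of_nonpos (by positivity) (by linarith) (by linarith)
  refine h1.trans ?_
  rw [Real.div_rpow (by positivity) (by positivity), Real.rpow_neg zero_le_two, div_inv_eq_mul,
    mul_comm]
  gcongr
  calc (2 : ℝ) ^ b ≤ 2 ^ (1 : ℝ) := Real.rpow_le_rpow_of_exponent_le (by norm_num) hb1
    _ = 2 := by norm_num

lemma half_le_one_add_rpow {t b : ℝ} (ht0 : 0 ≤ t) (ht : t ≤ 1) (hb : 0 ≤ b) (hb1 : b ≤ 1) :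
    1 ≤ 2 * (1 + t) ^ (-b) := by
  have h1 : (2 : ℝ) ^ (-b) ≤ (1 + t) ^ (-b) :=
    Real.rpow_le_rpow_of_nonpos (by positivity) (by linarith) (by linarith)
  have h2 : (2 : ℝ) ^ (-1 : ℝ) ≤ 2 ^ (-b) :=
    Real.rpow_le_rpow_of_exponent_le (by norm_num) (by linarith)
  rw [Real.rpow_neg_one] at h2
  linarith

lemma heatFlow_eq_of_integral_eq_zero {f : Plane → ℝ} (hf : Integrable f) (h0 : ∫ y, f y = 0)
    {t : ℝ} (ht : 0 < t) (x : Plane) :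
    heatFlow f (t, x) = ∫ y, (heatKernel t (x - y) - heatKernel t x) * f y := by
  simp_rw [sub_mul]
  rw [integral_sub (integrable_heatFlow_integrand hf ht x) (hf.const_mul _), integral_const_mul,
    h0, mul_zero, sub_zero]
  rfl

lemma div_sqrt_rpow (y : Plane) {t μ : ℝ} (ht : 0 < t) :
    (‖y‖ / √t) ^ (2 * μ) = t ^ (-μ) * ‖y‖ ^ (2 * μ) := by
  rw [Real.div_rpow (norm_nonneg _) (Real.sqrt_nonneg _), Real.sqrt_eq_rpow, ← Real.rpow_mul ht.le,
    show 1 / 2 * (2 * μ) = μ by ring, Real.rpow_neg ht.le]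
  ring

/-- For `t ≥ 1` the mean-zero condition allows `heatKernel t x` to be subtracted inside the
convolution, and the moment of order `2μ ≤ 1` yields the extra `t^{-μ}`. For `t ≤ 1` the `L¹` and
`L²` bounds suffice; `L²` data are the source of the `t^{-1/2}` in the sup norm. -/
lemma decays_heatFlow {f : Plane → ℝ} (hf : Integrable f) (h0 : ∫ y, f y = 0) {μ M : ℝ}
    (hμ : 0 ≤ μ) (hμ' : μ ≤ 1 / 2) (hM : 0 ≤ M) (hM0 : ∫⁻ y, ‖f y‖ₑ ≤ ENNReal.ofReal M)
    (hM1 : ∫⁻ y, ENNReal.ofReal (‖y‖ ^ (2 * μ)) * ‖f y‖ₑ ≤ ENNReal.ofReal M)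
    (hM2 : ∫⁻ y, ‖f y‖ₑ ^ 2 ≤ ENNReal.ofReal (M ^ 2)) :
    Decays μ (4 * M) (heatFlow f) := by
  have hle : ∀ t, 0 < t → ∀ x, ‖heatFlow f (t, x)‖ₑ ≤
      ∫⁻ y, ‖heatKernel t (x - y) - heatKernel t x‖ₑ * ‖f y‖ₑ := by
    intro t ht x
    rw [heatFlow_eq_of_integral_eq_zero hf h0 ht]
    refine (enorm_integral_le_lintegral_enorm _).trans (le_of_eq ?_)
    simp_rw [enorm_mul]
  refine ⟨measurable_heatFlow hf.aestronglyMeasurable, fun t ht => ?_, fun t ht x => ?_⟩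
  · rcases le_total t 1 with h | h
    · refine (lintegral_heatFlow_le hf.aestronglyMeasurable ht).trans (hM0.trans ?_)
      refine ENNReal.ofReal_le_ofReal ?_
      have := half_le_one_add_rpow ht.le h hμ (by linarith)
      nlinarith
    · refine (lintegral_mono fun x => hle t ht x).trans ?_
      have hc := continuous_heatKernel t
      have hm : Measurable fun r : Plane × Plane =>
        ‖heatKernel t (r.1 - r.2) - heatKernel t r.1‖ₑ := by fun_prop
      rw [lintegral_lintegral_swap
        (hm.aemeasurable.mul hf.aestronglyMeasurable.enorm.comp_snd)]
      calc _ ≤ ∫⁻ y, ENNReal.ofReal (2 * t ^ (-μ)) * (ENNReal.ofReal (‖y‖ ^ (2 * μ)) * ‖f y‖ₑ) := by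
            refine lintegral_mono fun y => ?_
            rw [lintegral_mul_const' _ _ enorm_ne_top, ← mul_assoc,
              ← ENNReal.ofReal_mul (by positivity)]
            gcongr
            refine (lintegral_heatKernel_sub_sub_le ht (b := 2 * μ) (by linarith)
              (by linarith) y).trans (ENNReal.ofReal_le_ofReal (le_of_eq ?_))
            rw [div_sqrt_rpow y ht]; ring
        _ ≤ ENNReal.ofReal (2 * t ^ (-μ)) * ENNReal.ofReal M := by
            rw [lintegral_const_mul' _ _ ENNReal.ofReal_ne_top]
            gcongr
        _ ≤ _ := by
            rw [← ENNReal.ofReal_mul (by positivity)]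
            refine ENNReal.ofReal_le_ofReal ?_
            have := rpow_neg_le_one_add h hμ (by linarith)
            nlinarith
  · rcases le_total t 1 with h | h
    · have h1 := (enorm_heatFlow_sq_le hf.aestronglyMeasurable ht x).trans (mul_le_mul_right hM2 _)
      rw [← ENNReal.ofReal_mul (by positivity), ← ofReal_norm,
        ← ENNReal.ofReal_pow (norm_nonneg _), ENNReal.ofReal_le_ofReal_iff (by positivity)] at h1
      have h2 := half_le_one_add_rpow ht.le h (b := 1 / 2 + μ) (by linarith) (by linarith)
      rw [show -(1 / 2 + μ) = -1 / 2 - μ by ring] at h2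
      have h3 : 0 < t ^ (-1 / 2 : ℝ) := by positivity
      have h4 : |heatFlow f (t, x)| ≤ M * t ^ (-1 / 2 : ℝ) := by
        refine abs_le_of_sq_le_sq' ?_ (by positivity) |> abs_le.2
        rw [Real.norm_eq_abs, sq_abs] at h1
        refine h1.trans ?_
        have h5 : (t ^ (-1 / 2 : ℝ)) ^ 2 = 1 / t := by
          rw [← Real.rpow_natCast, ← Real.rpow_mul ht.le]
          norm_num [Real.rpow_neg_one]
        rw [mul_pow, h5, mul_comm]
        gcongr
        nlinarith [Real.pi_gt_three]
      refine h4.trans ?_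
      have h6 : 0 ≤ M * t ^ (-1 / 2 : ℝ) := by positivity
      nlinarith
    · have h1 : ‖heatFlow f (t, x)‖ₑ ≤ ENNReal.ofReal (2 * t ^ (-1 - μ) * M) := by
        calc _ ≤ ∫⁻ y, ENNReal.ofReal (2 * t ^ (-1 - μ)) *
              (ENNReal.ofReal (‖y‖ ^ (2 * μ)) * ‖f y‖ₑ) := by
              refine (hle t ht x).trans (lintegral_mono fun y => ?_)
              rw [← mul_assoc, ← ENNReal.ofReal_mul (by positivity)]
              gcongr
              refine (enorm_heatKernel_sub_sub_le ht (b := 2 * μ) (by linarith)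
                (by linarith) x y).trans (ENNReal.ofReal_le_ofReal (le_of_eq ?_))
              rw [div_sqrt_rpow y ht, show -1 - μ = -1 + -μ by ring, Real.rpow_add ht,
                Real.rpow_neg_one]
              ring
          _ ≤ ENNReal.ofReal (2 * t ^ (-1 - μ)) * ENNReal.ofReal M := by
              rw [lintegral_const_mul' _ _ ENNReal.ofReal_ne_top]
              gcongr
          _ = _ := by rw [← ENNReal.ofReal_mul (by positivity)]
      rw [← ofReal_norm, ENNReal.ofReal_le_ofReal_iff (by positivity)] at h1
      refine h1.trans ?_
      have h2 := rpow_neg_le_one_add h (b := 1 / 2 + μ) (by linarith) (by linarith)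
      rw [show -(1 / 2 + μ) = -1 / 2 - μ by ring] at h2
      rw [show -1 - μ = -1 / 2 + (-1 / 2 - μ) by ring, Real.rpow_add ht]
      calc _ = 2 * M * t ^ (-1 / 2 : ℝ) * t ^ (-1 / 2 - μ) := by ring
        _ ≤ 2 * M * t ^ (-1 / 2 : ℝ) * (2 * (1 + t) ^ (-1 / 2 - μ)) := by gcongr
        _ = _ := by ring

/-! ### Initial data -/

lemma lintegral_weight_sq_le {v : Plane → ℝ} {r : ℝ} (hv : MemWeightedL2 2 v)
    (hr : weightedNorm 2 v ≤ r) :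
    ∫⁻ y, ENNReal.ofReal ((1 + ‖y‖ ^ 2) ^ 2) * ‖v y‖ₑ ^ 2 ≤ ENNReal.ofReal (r ^ 2) := by
  have e : ∀ y : Plane, weight y ^ (2 * 2) * |v y| ^ 2 = (1 + ‖y‖ ^ 2) ^ 2 * |v y| ^ 2 := by
    intro y
    rw [pow_mul, weight, Real.sq_sqrt (by positivity)]
  have hi := hv.2
  simp_rw [e] at hi
  have h0 : 0 ≤ ∫ y : Plane, (1 + ‖y‖ ^ 2) ^ 2 * |v y| ^ 2 :=
    integral_nonneg fun y => by positivity
  unfold weightedNorm at hr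
  simp_rw [e] at hr
  have h1 : ∫ y : Plane, (1 + ‖y‖ ^ 2) ^ 2 * |v y| ^ 2 ≤ r ^ 2 :=
    (Real.sqrt_le_left ((Real.sqrt_nonneg _).trans hr)).1 hr
  refine le_trans (le_of_eq ?_) (ENNReal.ofReal_le_ofReal h1)
  rw [ofReal_integral_eq_lintegral_ofReal hi (.of_forall fun y => by positivity)]
  refine lintegral_congr fun y => ?_
  rw [ENNReal.ofReal_mul (by positivity), ENNReal.ofReal_pow (abs_nonneg _), ← Real.norm_eq_abs,
    ofReal_norm]

/-- The constant `∫ (1 + |y|²)^{2μ - 2} dy`. -/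
noncomputable def weightConst (μ : ℝ) : ℝ := ∫ y : Plane, (1 + ‖y‖ ^ 2) ^ (2 * μ - 2)

lemma weightConst_nonneg (μ : ℝ) : 0 ≤ weightConst μ := integral_nonneg fun y => by positivity

/-- The threshold `μ < 1/2` is integrability at infinity: the integrand decays like `‖y‖^{-(4 -
4μ)}`, and the plane requires an exponent above `2`. -/
lemma lintegral_weight_eq {μ : ℝ} (hμ : μ < 1 / 2) :
    ∫⁻ y : Plane, ENNReal.ofReal ((1 + ‖y‖ ^ 2) ^ (2 * μ - 2)) = ENNReal.ofReal (weightConst μ) := by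
  have h := integrable_rpow_neg_one_add_norm_sq (E := Plane) (μ := volume) (r := 4 - 4 * μ)
    (by simp; linarith)
  rw [show -(4 - 4 * μ) / 2 = 2 * μ - 2 by ring] at h
  rw [weightConst, ofReal_integral_eq_lintegral_ofReal h (.of_forall fun y => by positivity)]

/-- Cauchy–Schwarz with `(1 + ‖y‖²)^μ = (1 + ‖y‖²)^{μ-1} (1 + ‖y‖²)`. This turns the weighted `L²`
norm into the moments needed for the heat flow. -/
lemma lintegral_rpow_weight_le {v : Plane → ℝ} {r μ : ℝ} (hμ : μ < 1 / 2)
    (hv : MemWeightedL2 2 v) (hr : weightedNorm 2 v ≤ r) :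
    ∫⁻ y, ENNReal.ofReal ((1 + ‖y‖ ^ 2) ^ μ) * ‖v y‖ₑ ≤ ENNReal.ofReal (√(weightConst μ) * r) := by
  have hr0 : 0 ≤ r := (Real.sqrt_nonneg _).trans hr
  have hm1 : Measurable fun y : Plane => ENNReal.ofReal ((1 + ‖y‖ ^ 2) ^ (2 * μ - 2)) := by fun_prop
  have hm2 : AEMeasurable fun y : Plane => ENNReal.ofReal ((1 + ‖y‖ ^ 2) ^ 2) * ‖v y‖ₑ ^ 2 :=
    (by fun_prop : Measurable fun y : Plane => ENNReal.ofReal ((1 + ‖y‖ ^ 2) ^ 2)).aemeasurable.mul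
      (hv.1.aestronglyMeasurable.enorm.pow_const 2)
  have H := ENNReal.lintegral_mul_norm_pow_le hm1.aemeasurable hm2 (p := 1 / 2) (q := 1 / 2)
    (by norm_num) (by norm_num) (by norm_num)
  have e : ∀ y : Plane, ENNReal.ofReal ((1 + ‖y‖ ^ 2) ^ (2 * μ - 2)) ^ (1 / 2 : ℝ) *
      (ENNReal.ofReal ((1 + ‖y‖ ^ 2) ^ 2) * ‖v y‖ₑ ^ 2) ^ (1 / 2 : ℝ) =
      ENNReal.ofReal ((1 + ‖y‖ ^ 2) ^ μ) * ‖v y‖ₑ := by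
    intro y
    have hp : (0 : ℝ) < 1 + ‖y‖ ^ 2 := by positivity
    rw [ENNReal.mul_rpow_of_nonneg _ _ (by norm_num), ← mul_assoc,
      ENNReal.ofReal_rpow_of_nonneg (by positivity) (by norm_num),
      ENNReal.ofReal_rpow_of_nonneg (by positivity) (by norm_num),
      ← ENNReal.ofReal_mul (by positivity), ← ENNReal.rpow_natCast, ← ENNReal.rpow_mul]
    have : ((1 + ‖y‖ ^ 2) ^ (2 * μ - 2)) ^ (1 / 2 : ℝ) * ((1 + ‖y‖ ^ 2) ^ 2) ^ (1 / 2 : ℝ) =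
        (1 + ‖y‖ ^ 2) ^ μ := by
      rw [← Real.rpow_natCast (1 + ‖y‖ ^ 2) 2, ← Real.rpow_mul hp.le, ← Real.rpow_mul hp.le,
        ← Real.rpow_add hp]
      congr 1
      push_cast
      ring
    rw [this]
    norm_num
  simp_rw [e] at H
  refine H.trans ?_
  rw [lintegral_weight_eq hμ]
  refine (mul_le_mul_right (ENNReal.rpow_le_rpow (lintegral_weight_sq_le hv hr)
    (by norm_num)) _).trans (le_of_eq ?_)
  rw [ENNReal.ofReal_rpow_of_nonneg (weightConst_nonneg μ) (by norm_num),
    ENNReal.ofReal_rpow_of_nonneg (by positivity) (by norm_num),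
    ← ENNReal.ofReal_mul (by have := weightConst_nonneg μ; positivity), ← Real.sqrt_eq_rpow,
    ← Real.sqrt_eq_rpow, Real.sqrt_sq hr0]

lemma one_le_weight_rpow (y : Plane) {μ : ℝ} (hμ : 0 ≤ μ) : 1 ≤ (1 + ‖y‖ ^ 2) ^ μ :=
  Real.one_le_rpow (by nlinarith [sq_nonneg ‖y‖]) hμ

lemma lintegral_enorm_le_weight {μ : ℝ} (hμ : 0 ≤ μ) (v : Plane → ℝ) :
    ∫⁻ y, ‖v y‖ₑ ≤ ∫⁻ y, ENNReal.ofReal ((1 + ‖y‖ ^ 2) ^ μ) * ‖v y‖ₑ := by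
  refine lintegral_mono fun y => ?_
  refine le_mul_of_one_le_left' ?_
  rw [ENNReal.one_le_ofReal]
  exact one_le_weight_rpow y hμ

lemma lintegral_norm_rpow_le_weight {μ : ℝ} (hμ : 0 ≤ μ) (v : Plane → ℝ) :
    ∫⁻ y, ENNReal.ofReal (‖y‖ ^ (2 * μ)) * ‖v y‖ₑ ≤
      ∫⁻ y, ENNReal.ofReal ((1 + ‖y‖ ^ 2) ^ μ) * ‖v y‖ₑ := by
  refine lintegral_mono fun y => mul_le_mul_left (ENNReal.ofReal_le_ofReal ?_) _
  rw [Real.rpow_mul (norm_nonneg _), Real.rpow_two]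
  exact Real.rpow_le_rpow (by positivity) (by linarith) hμ

lemma MemWeightedL2.integrable {v : Plane → ℝ} (hv : MemWeightedL2 2 v) : Integrable v := by
  refine ⟨hv.1.aestronglyMeasurable, ?_⟩
  have h := (lintegral_enorm_le_weight le_rfl v).trans
    (lintegral_rpow_weight_le (μ := 0) (by norm_num) hv le_rfl)
  exact h.trans_lt ENNReal.ofReal_lt_top

lemma abs_integral_le_of_weightedNorm {v : Plane → ℝ} {r μ : ℝ} (hμ0 : 0 ≤ μ) (hμ : μ < 1 / 2)
    (hv : MemWeightedL2 2 v) (hr : weightedNorm 2 v ≤ r) :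
    |∫ y, v y| ≤ √(weightConst μ) * r := by
  have hr0 : 0 ≤ r := (Real.sqrt_nonneg _).trans hr
  have h := (enorm_integral_le_lintegral_enorm v).trans ((lintegral_enorm_le_weight hμ0 v).trans
    (lintegral_rpow_weight_le hμ hv hr))
  rwa [← ofReal_norm, ENNReal.ofReal_le_ofReal_iff (by positivity)] at h

lemma weight_mul_heatKernel_le (y : Plane) {μ : ℝ} (hμ1 : μ ≤ 1) :
    (1 + ‖y‖ ^ 2) ^ μ * heatKernel 1 y ≤ 16 * heatKernel 2 y := by
  have h1 : (1 + ‖y‖ ^ 2) ^ μ ≤ 1 + ‖y‖ ^ 2 := by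
    have := Real.rpow_le_rpow_of_exponent_le (x := 1 + ‖y‖ ^ 2) (by nlinarith [sq_nonneg ‖y‖]) hμ1
    rwa [Real.rpow_one] at this
  have h2 : heatKernel 1 y = 2 * Real.exp (-(‖y‖ ^ 2 / 8)) * heatKernel 2 y := by
    unfold heatKernel
    rw [exp_heat_split (t := 1)]
    rw [show -‖y‖ ^ 2 / (8 * 1) = -(‖y‖ ^ 2 / 8) by ring, show (4 * (2 * 1) : ℝ) = 4 * 2 by norm_num]
    field_simp
  have hk := heatKernel_nonneg (t := 2) (by positivity) y
  have h3 := Real.add_one_le_exp (‖y‖ ^ 2 / 8)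
  have h4 : Real.exp (‖y‖ ^ 2 / 8) * Real.exp (-(‖y‖ ^ 2 / 8)) = 1 := by
    rw [← Real.exp_add]; simp
  have h5 := Real.exp_pos (-(‖y‖ ^ 2 / 8))
  have h6 : (1 + ‖y‖ ^ 2) * Real.exp (-(‖y‖ ^ 2 / 8)) ≤ 8 := by nlinarith
  calc _ ≤ (1 + ‖y‖ ^ 2) * (2 * Real.exp (-(‖y‖ ^ 2 / 8)) * heatKernel 2 y) := by
        rw [h2]; gcongr
    _ = 2 * ((1 + ‖y‖ ^ 2) * Real.exp (-(‖y‖ ^ 2 / 8))) * heatKernel 2 y := by ring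
    _ ≤ 2 * 8 * heatKernel 2 y := by gcongr
    _ = _ := by ring

lemma lintegral_weight_mul_oseen_le {μ : ℝ} (hμ1 : μ ≤ 1) :
    ∫⁻ y, ENNReal.ofReal ((1 + ‖y‖ ^ 2) ^ μ) * ‖oseen 0 y‖ₑ ≤ ENNReal.ofReal 16 := by
  calc _ ≤ ∫⁻ y, ENNReal.ofReal 16 * ENNReal.ofReal (heatKernel 2 y) := by
        refine lintegral_mono fun y => ?_
        rw [oseen_eq, add_zero, Real.enorm_of_nonneg (heatKernel_nonneg zero_le_one y),
          ← ENNReal.ofReal_mul (by positivity), ← ENNReal.ofReal_mul (by positivity)]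
        exact ENNReal.ofReal_le_ofReal (weight_mul_heatKernel_le y hμ1)
    _ = _ := by
        rw [lintegral_const_mul' _ _ ENNReal.ofReal_ne_top, lintegral_heatKernel (by norm_num),
          mul_one]

/-- The part of the initial vorticity that has mean zero. -/
noncomputable def meanFree (v : Plane → ℝ) (x : Plane) : ℝ := v x - (∫ y, v y) * oseen 0 x

lemma integrable_oseen {t : ℝ} (ht : 0 ≤ t) : Integrable (oseen t) :=
  integrable_heatKernel (by positivity)

lemma integrable_meanFree {v : Plane → ℝ} (hv : Integrable v) : Integrable (meanFree v) :=
  hv.sub ((integrable_oseen le_rfl).const_mul _)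

lemma integral_meanFree {v : Plane → ℝ} (hv : Integrable v) : ∫ x, meanFree v x = 0 := by
  unfold meanFree
  rw [integral_sub hv ((integrable_oseen le_rfl).const_mul _), integral_const_mul]
  simp [oseen_eq, integral_heatKernel]

/-- A constant in the bounds of the mean-free part. -/
noncomputable def dataConst (μ : ℝ) : ℝ := 20 * √(weightConst μ) + 2

lemma lintegral_weight_meanFree_le {v : Plane → ℝ} {r μ : ℝ} (hμ0 : 0 ≤ μ) (hμ : μ < 1 / 2)
    (hv : MemWeightedL2 2 v) (hr : weightedNorm 2 v ≤ r) :
    ∫⁻ y, ENNReal.ofReal ((1 + ‖y‖ ^ 2) ^ μ) * ‖meanFree v y‖ₑ ≤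
      ENNReal.ofReal (dataConst μ * r) := by
  have hr0 : 0 ≤ r := (Real.sqrt_nonneg _).trans hr
  have ha := abs_integral_le_of_weightedNorm hμ0 hμ hv hr
  have hm : AEMeasurable fun y : Plane => ENNReal.ofReal ((1 + ‖y‖ ^ 2) ^ μ) * ‖v y‖ₑ :=
    (by fun_prop : Measurable fun y : Plane => ENNReal.ofReal ((1 + ‖y‖ ^ 2) ^ μ)).aemeasurable.mul
      hv.1.aestronglyMeasurable.enorm
  calc _ ≤ ∫⁻ y, (ENNReal.ofReal ((1 + ‖y‖ ^ 2) ^ μ) * ‖v y‖ₑ + ‖∫ y, v y‖ₑ *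
        (ENNReal.ofReal ((1 + ‖y‖ ^ 2) ^ μ) * ‖oseen 0 y‖ₑ)) := by
        refine lintegral_mono fun y => ?_
        rw [mul_left_comm, ← mul_add, ← enorm_mul]
        gcongr
        exact enorm_sub_le
    _ ≤ ENNReal.ofReal (√(weightConst μ) * r) +
        ENNReal.ofReal (√(weightConst μ) * r) * ENNReal.ofReal 16 := by
        rw [lintegral_add_left' hm, lintegral_const_mul' _ _ enorm_ne_top]
        refine add_le_add (lintegral_rpow_weight_le hμ hv hr) (mul_le_mul' ?_ ?_)
        · rw [← ofReal_norm]; exact ENNReal.ofReal_le_ofReal ha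
        · exact lintegral_weight_mul_oseen_le (by linarith)
    _ ≤ _ := by
        rw [← ENNReal.ofReal_mul (by positivity), ← ENNReal.ofReal_add (by positivity)
          (by positivity)]
        refine ENNReal.ofReal_le_ofReal ?_
        -- The data contribute `1` and the subtracted Gaussian `16` multiples of `√(weightConst μ) *
        -- r`, within the `20` allowed.
        unfold dataConst
        nlinarith [mul_nonneg (Real.sqrt_nonneg (weightConst μ)) hr0]

lemma lintegral_meanFree_sq_le {v : Plane → ℝ} {r μ : ℝ} (hμ0 : 0 ≤ μ) (hμ : μ < 1 / 2)
    (hv : MemWeightedL2 2 v) (hr : weightedNorm 2 v ≤ r) :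
    ∫⁻ y, ‖meanFree v y‖ₑ ^ 2 ≤ ENNReal.ofReal ((dataConst μ * r) ^ 2) := by
  have hr0 : 0 ≤ r := (Real.sqrt_nonneg _).trans hr
  set k := √(weightConst μ)
  have hk : 0 ≤ k := Real.sqrt_nonneg _
  have ha := abs_integral_le_of_weightedNorm hμ0 hμ hv hr
  have hm : AEMeasurable fun y : Plane => ENNReal.ofReal 2 * ‖v y‖ₑ ^ 2 :=
    (hv.1.aestronglyMeasurable.enorm.pow_const 2).const_mul _
  calc _ ≤ ∫⁻ y, (ENNReal.ofReal 2 * ‖v y‖ₑ ^ 2 +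
        ENNReal.ofReal (2 * (k * r) ^ 2) * ENNReal.ofReal (heatKernel 1 y)) := by
        refine lintegral_mono fun y => ?_
        have hk0 := heatKernel_nonneg zero_le_one y
        have hk1 : heatKernel 1 y ≤ 1 := by
          refine (heatKernel_le one_pos y).trans ?_
          rw [div_le_one (by positivity)]
          linarith [Real.pi_gt_three]
        rw [← ofReal_norm, ← ofReal_norm, ← ENNReal.ofReal_pow (norm_nonneg _),
          ← ENNReal.ofReal_pow (norm_nonneg _), ← ENNReal.ofReal_mul (by positivity),
          ← ENNReal.ofReal_mul (by positivity), ← ENNReal.ofReal_add (by positivity)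
          (by positivity)]
        refine ENNReal.ofReal_le_ofReal ?_
        rw [Real.norm_eq_abs, Real.norm_eq_abs, sq_abs, sq_abs, meanFree, oseen_eq, add_zero]
        set a := ∫ y, v y
        have h1 : a ^ 2 ≤ (k * r) ^ 2 := by
          rw [← sq_abs a]; exact pow_le_pow_left₀ (abs_nonneg _) ha 2
        have h2 : (a * heatKernel 1 y) ^ 2 ≤ (k * r) ^ 2 * heatKernel 1 y := by
          calc (a * heatKernel 1 y) ^ 2 = a ^ 2 * (heatKernel 1 y * heatKernel 1 y) := by ring
            _ ≤ (k * r) ^ 2 * (heatKernel 1 y * 1) := by gcongr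
            _ = _ := by ring
        nlinarith [sq_nonneg (v y + a * heatKernel 1 y)]
    _ ≤ ENNReal.ofReal 2 * ENNReal.ofReal (r ^ 2) + ENNReal.ofReal (2 * (k * r) ^ 2) := by
        rw [lintegral_add_left' hm, lintegral_const_mul' _ _ ENNReal.ofReal_ne_top,
          lintegral_const_mul' _ _ ENNReal.ofReal_ne_top, lintegral_heatKernel one_pos, mul_one]
        gcongr
        refine le_trans (lintegral_mono fun y => ?_) (lintegral_weight_sq_le hv hr)
        refine le_mul_of_one_le_left' ?_
        rw [ENNReal.one_le_ofReal]
        exact one_le_pow₀ (by nlinarith [sq_nonneg ‖y‖])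
    _ ≤ _ := by
        rw [← ENNReal.ofReal_mul (by positivity), ← ENNReal.ofReal_add (by positivity)
          (by positivity)]
        refine ENNReal.ofReal_le_ofReal ?_
        unfold dataConst
        have : 0 ≤ k * r ^ 2 := by positivity
        have h2 : 0 ≤ k ^ 2 * r ^ 2 := by positivity
        have h3 : 0 ≤ r ^ 2 := by positivity
        nlinarith

lemma dataConst_pos (μ : ℝ) : 0 < dataConst μ := by unfold dataConst; positivity

lemma decays_heatFlow_meanFree {v : Plane → ℝ} {r μ : ℝ} (hμ0 : 0 ≤ μ) (hμ : μ < 1 / 2)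
    (hv : MemWeightedL2 2 v) (hr : weightedNorm 2 v ≤ r) :
    Decays μ (4 * (dataConst μ * r)) (heatFlow (meanFree v)) := by
  have hr0 : 0 ≤ r := (Real.sqrt_nonneg _).trans hr
  have h := lintegral_weight_meanFree_le hμ0 hμ hv hr
  have hc := (dataConst_pos μ).le
  exact decays_heatFlow (integrable_meanFree hv.integrable) (integral_meanFree hv.integrable) hμ0
    hμ.le (by positivity) ((lintegral_enorm_le_weight hμ0 _).trans h)
    ((lintegral_norm_rpow_le_weight hμ0 _).trans h) (lintegral_meanFree_sq_le hμ0 hμ hv hr)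

/-- By the semigroup property the Oseen vortex is the heat flow of its own initial value, the heat
kernel at time one. -/
lemma heatFlow_meanFree {v : Plane → ℝ} (hv : Integrable v) {t : ℝ} (ht : 0 < t) (x : Plane) :
    heatFlow v (t, x) = (∫ y, v y) * oseen t x + heatFlow (meanFree v) (t, x) := by
  have h : heatFlow (meanFree v) (t, x) = heatFlow v (t, x) -
      (∫ y, v y) * ∫ y, heatKernel t (x - y) * heatKernel 1 y := by
    unfold heatFlow meanFree
    simp_rw [mul_sub, oseen_eq, add_zero, mul_left_comm _ (∫ y, v y)]
    rw [integral_sub (integrable_heatFlow_integrand hv ht x)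
      ((integrable_heatFlow_integrand (integrable_heatKernel one_pos) ht x).const_mul _),
      integral_const_mul]
  rw [h, integral_heatKernel_mul_heatKernel ht one_pos, oseen_eq, add_comm t 1]
  ring

/-! ### The fixed point -/

namespace Decays

variable {ν N : ℝ} {f g : ℝ × Plane → ℝ}

lemma congr (hf : Decays ν N f) (hg : Measurable g) (h : ∀ t, 0 < t → ∀ x, f (t, x) = g (t, x)) :
    Decays ν N g := by
  refine ⟨hg, fun t ht => ?_, fun t ht x => ?_⟩
  · simp_rw [← h t ht]; exact hf.lintegral_le t ht
  · rw [← h t ht]; exact hf.abs_le t ht x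

/-- Fatou for the `L¹` bound, a pointwise limit for the other. With this closedness the fixed point
can be found from pointwise limits, without setting up a Banach space. -/
lemma of_tendsto {F : ℕ → ℝ × Plane → ℝ} (hF : ∀ n, Decays ν N (F n))
    (h : ∀ p, Filter.Tendsto (fun n => F n p) Filter.atTop (nhds (g p))) : Decays ν N g := by
  refine ⟨measurable_of_tendsto_metrizable (fun n => (hF n).measurable) (tendsto_pi_nhds.2 h),
    fun t ht => ?_, fun t ht x => ?_⟩
  · have e : ∀ x, ‖g (t, x)‖ₑ = Filter.liminf (fun n => ‖F n (t, x)‖ₑ) Filter.atTop := fun x =>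
      ((h (t, x)).enorm.liminf_eq).symm
    simp_rw [e]
    refine (lintegral_liminf_le fun n =>
      ((hF n).measurable.comp measurable_prodMk_left).enorm).trans ?_
    refine Filter.liminf_le_of_frequently_le' (Filter.Frequently.of_forall fun n => ?_)
    exact (hF n).lintegral_le t ht
  · exact le_of_tendsto (h (t, x)).abs (.of_forall fun n => (hF n).abs_le t ht x)

end Decays

/-- The map whose fixed point is the remainder `v - E` of a mild solution `v` with respect to a
radial self-similar part `E`, with linear part `L`. -/
noncomputable def picard (α : ℝ) (L E ρ : ℝ × Plane → ℝ) (p : ℝ × Plane) : ℝ :=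
  L p - duhamel α ρ (fun q => E q + ρ q) p - duhamel α E ρ p

section Picard

open Decays

variable {α μ A B : ℝ} {L E : ℝ × Plane → ℝ}

lemma measurable_picard (hL : Measurable L) (hE : Measurable E) {ρ : ℝ × Plane → ℝ}
    (hρ : Measurable ρ) : Measurable (picard α L E ρ) :=
  (hL.sub (measurable_duhamel α hρ (hE.add hρ))).sub (measurable_duhamel α hE hρ)

/-- The linear part takes up `A`; the bilinear terms contribute at most `duhamelConst α μ * 2A(2B +
2A) ≤ A`, so the ball of radius `2A` is preserved. -/
lemma decays_picard (hα : 0 < α) (hμ0 : 0 ≤ μ) (hμ : μ < 1 / 2) (hL : Decays μ A L)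
    (hE : Decays 0 B E) (hK : duhamelConst α μ * (2 * B + 4 * A) ≤ 1 / 2)
    {ρ : ℝ × Plane → ℝ} (hρ : Decays μ (2 * A) ρ) : Decays μ (2 * A) (picard α L E ρ) := by
  have hA := hL.nonneg
  have hB := hE.nonneg
  have hc := duhamelConst_nonneg hα hμ
  have hv : Decays 0 (B + 2 * A) fun q => E q + ρ q := hE.add (hρ.mono le_rfl hμ0)
  have h1 := hρ.duhamel hα hv hμ0 le_rfl (by linarith)
  have h2 := hE.duhamel hα hρ le_rfl hμ0 (by linarith)
  simp only [add_zero, zero_add] at h1 h2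
  refine ((hL.sub h1).sub h2).mono ?_ le_rfl
  nlinarith [mul_nonneg hc hA]

lemma decays_picard_sub (hα : 0 < α) (hμ0 : 0 ≤ μ) (hμ : μ < 1 / 2) (hL : Decays μ A L)
    (hE : Decays 0 B E) (hK : duhamelConst α μ * (2 * B + 4 * A) ≤ 1 / 2)
    {ρ ρ' : ℝ × Plane → ℝ} (hρ : Decays μ (2 * A) ρ) (hρ' : Decays μ (2 * A) ρ') {d : ℝ}
    (hd : Decays μ d fun q => ρ q - ρ' q) :
    Decays μ (d / 2) fun q => picard α L E ρ q - picard α L E ρ' q := by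
  have hA := hL.nonneg
  have hB := hE.nonneg
  have hd0 := hd.nonneg
  have hc := duhamelConst_nonneg hα hμ
  have hv : Decays 0 (B + 2 * A) fun q => E q + ρ q := hE.add (hρ.mono le_rfl hμ0)
  have hv' : Decays 0 (B + 2 * A) fun q => E q + ρ' q := hE.add (hρ'.mono le_rfl hμ0)
  have h1 := hd.duhamel hα hv hμ0 le_rfl (by linarith)
  have h2 := (hρ'.mono le_rfl hμ0).duhamel hα hd le_rfl hμ0 (by linarith)
  have h3 := hE.duhamel hα hd le_rfl hμ0 (by linarith)
  simp only [add_zero, zero_add] at h1 h2 h3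
  -- The difference of the images is `-(D(δ, E + ρ) + D(ρ', δ) + D(E, δ))` with `D` the Duhamel
  -- operator and `δ = ρ - ρ'`. The coefficients `B + 2A`, `2A` and `B` add up to the `2B + 4A` of
  -- the smallness hypothesis.
  have h := (((h1.add h2).add h3).neg).mono (N' := d / 2) (by nlinarith) le_rfl
  refine h.congr ((measurable_picard hL.measurable hE.measurable hρ.measurable).sub
    (measurable_picard hL.measurable hE.measurable hρ'.measurable)) fun t ht x => ?_
  have e1 := duhamel_sub_left hα (fun s hs => hρ.integrable hs) (fun s hs => hρ'.integrable hs)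
    (hρ.integrable_duhamelIntegrand hα hv hμ0 le_rfl (by linarith) ht x)
    (hρ'.integrable_duhamelIntegrand hα hv hμ0 le_rfl (by linarith) ht x)
  have e2 := duhamel_sub_right
    (hρ'.integrable_duhamelIntegrand hα hv hμ0 le_rfl (by linarith) ht x)
    (hρ'.integrable_duhamelIntegrand hα hv' hμ0 le_rfl (by linarith) ht x)
  have e3 := duhamel_sub_right
    (hE.integrable_duhamelIntegrand hα hρ le_rfl hμ0 (by linarith) ht x)
    (hE.integrable_duhamelIntegrand hα hρ' le_rfl hμ0 (by linarith) ht x)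
  simp only [add_sub_add_left_eq_sub] at e2
  rw [e1, e2, e3]
  unfold picard
  ring

/-- The Picard iterates. -/
noncomputable def picardSeq (α : ℝ) (L E : ℝ × Plane → ℝ) : ℕ → ℝ × Plane → ℝ
  | 0 => L
  | n + 1 => picard α L E (picardSeq α L E n)

lemma picardSeq_of_nonpos (α : ℝ) (L E : ℝ × Plane → ℝ) (n : ℕ) {p : ℝ × Plane} (hp : p.1 ≤ 0) :
    picardSeq α L E n p = L p := by
  cases n with
  | zero => rfl
  | succ n => simp [picardSeq, picard, duhamel_of_nonpos _ _ _ hp]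

lemma decays_picardSeq (hα : 0 < α) (hμ0 : 0 ≤ μ) (hμ : μ < 1 / 2) (hL : Decays μ A L)
    (hE : Decays 0 B E) (hK : duhamelConst α μ * (2 * B + 4 * A) ≤ 1 / 2) (n : ℕ) :
    Decays μ (2 * A) (picardSeq α L E n) := by
  induction n with
  | zero => exact hL.mono (by linarith [hL.nonneg]) le_rfl
  | succ n ih => exact decays_picard hα hμ0 hμ hL hE hK ih

lemma decays_picardSeq_succ_sub (hα : 0 < α) (hμ0 : 0 ≤ μ) (hμ : μ < 1 / 2) (hL : Decays μ A L)
    (hE : Decays 0 B E) (hK : duhamelConst α μ * (2 * B + 4 * A) ≤ 1 / 2) (n : ℕ) :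
    Decays μ (4 * A / 2 ^ n) fun q => picardSeq α L E (n + 1) q - picardSeq α L E n q := by
  have hs := decays_picardSeq hα hμ0 hμ hL hE hK
  induction n with
  | zero => exact ((hs 1).sub (hs 0)).mono (le_of_eq (by ring)) le_rfl
  | succ n ih =>
    have := decays_picard_sub hα hμ0 hμ hL hE hK (hs (n + 1)) (hs n) ih
    exact this.mono (le_of_eq (by rw [pow_succ]; field_simp)) le_rfl

/-- Telescoping the geometric bounds. The sum is kept in closed form so that letting `m → ∞` leaves
`8A / 2^n` for the distance to the limit. -/
lemma decays_picardSeq_add_sub (hα : 0 < α) (hμ0 : 0 ≤ μ) (hμ : μ < 1 / 2) (hL : Decays μ A L)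
    (hE : Decays 0 B E) (hK : duhamelConst α μ * (2 * B + 4 * A) ≤ 1 / 2) (n m : ℕ) :
    Decays μ (8 * A / 2 ^ n * (1 - 1 / 2 ^ m))
      fun q => picardSeq α L E (n + m) q - picardSeq α L E n q := by
  induction m with
  | zero => simpa using Decays.zero (ν := μ) le_rfl
  | succ m ih =>
    have h := (decays_picardSeq_succ_sub hα hμ0 hμ hL hE hK (n + m)).add ih
    simp only [sub_add_sub_cancel] at h
    refine h.mono (le_of_eq ?_) le_rfl
    rw [pow_add, pow_succ]
    field_simp
    ring

theorem exists_picard_fixedPoint (hα : 0 < α) (hμ0 : 0 ≤ μ) (hμ : μ < 1 / 2) (hL : Decays μ A L)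
    (hE : Decays 0 B E) (hK : duhamelConst α μ * (2 * B + 4 * A) ≤ 1 / 2) :
    ∃ ρ : ℝ × Plane → ℝ, Decays μ (2 * A) ρ ∧
      ∀ t, 0 < t → ∀ x, ρ (t, x) = picard α L E ρ (t, x) := by
  have hA := hL.nonneg
  have hs := decays_picardSeq hα hμ0 hμ hL hE hK
  have hlim : ∀ p, ∃ l, Filter.Tendsto (fun n => picardSeq α L E n p) Filter.atTop (nhds l) := by
    rintro ⟨t, x⟩
    -- A limit is needed at every point for `ρ` to be measurable; at nonpositive times all iterates
    -- equal `L`.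
    rcases le_or_gt t 0 with ht | ht
    · exact ⟨L (t, x), tendsto_const_nhds.congr fun n => (picardSeq_of_nonpos α L E n ht).symm⟩
    · refine cauchySeq_tendsto_of_complete (cauchySeq_of_le_geometric (1 / 2)
        (4 * A * (t ^ (-1 / 2 : ℝ) * (1 + t) ^ (-1 / 2 - μ))) (by norm_num) fun n => ?_)
      have h := (decays_picardSeq_succ_sub hα hμ0 hμ hL hE hK n).abs_le t ht x
      rw [dist_comm, Real.dist_eq]
      refine h.trans (le_of_eq ?_)
      rw [div_pow, one_pow]
      ring
  choose ρ hρ using hlim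
  have hdρ : Decays μ (2 * A) ρ := Decays.of_tendsto hs hρ
  refine ⟨ρ, hdρ, fun t ht x => ?_⟩
  have hdiff : ∀ n : ℕ, Decays μ (8 * A / 2 ^ n) fun q => ρ q - picardSeq α L E n q := by
    intro n
    refine Decays.of_tendsto (F := fun m q => picardSeq α L E (n + m) q - picardSeq α L E n q)
      (fun m => (decays_picardSeq_add_sub hα hμ0 hμ hL hE hK n m).mono ?_ le_rfl) fun p => ?_
    · refine mul_le_of_le_one_right (by positivity) ?_
      have : (0 : ℝ) ≤ 1 / 2 ^ m := by positivity
      linarith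
    · refine Filter.Tendsto.sub_const ?_ _
      have := (hρ p).comp (Filter.tendsto_add_atTop_nat n)
      simpa [Function.comp_def, add_comm n] using this
  set w := t ^ (-1 / 2 : ℝ) * (1 + t) ^ (-1 / 2 - μ)
  have h1 : ∀ n : ℕ, |picardSeq α L E (n + 1) (t, x) - picard α L E ρ (t, x)| ≤
      (4 * A * w) * (1 / 2) ^ n := by
    intro n
    have h := (decays_picard_sub hα hμ0 hμ hL hE hK hdρ (hs n) (hdiff n)).abs_le t ht x
    rw [abs_sub_comm]
    refine h.trans (le_of_eq ?_)
    rw [div_pow, one_pow]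
    ring
  have h2 : Filter.Tendsto (fun n : ℕ => (4 * A * w) * (1 / 2 : ℝ) ^ n) Filter.atTop (nhds 0) := by
    simpa using (tendsto_pow_atTop_nhds_zero_of_lt_one (r := (1 / 2 : ℝ)) (by norm_num)
      (by norm_num)).const_mul (4 * A * w)
  have h3 : Filter.Tendsto (fun n => picardSeq α L E (n + 1) (t, x)) Filter.atTop
      (nhds (picard α L E ρ (t, x))) := by
    rw [tendsto_iff_dist_tendsto_zero]
    exact squeeze_zero (fun n => dist_nonneg) (fun n => by rw [Real.dist_eq]; exact h1 n) h2
  exact tendsto_nhds_unique ((hρ (t, x)).comp (Filter.tendsto_add_atTop_nat 1)) h3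

end Picard

/-! ### Existence -/

/-- The Oseen vortex of circulation `a`, as a function of time and space. -/
noncomputable def oseenFlow (a : ℝ) (p : ℝ × Plane) : ℝ := a * oseen p.1 p.2

lemma decays_oseenFlow (a : ℝ) : Decays 0 |a| (oseenFlow a) := by
  refine ⟨?_, fun t ht => ?_, fun t ht x => ?_⟩
  · have : Measurable fun p : ℝ × Plane => heatKernel (1 + p.1) p.2 :=
      measurable_heatKernel_uncurry.comp (f := fun p : ℝ × Plane => (1 + p.1, p.2)) (by fun_prop)
    exact this.const_mul a
  · simp_rw [oseenFlow, enorm_mul, oseen_eq]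
    rw [lintegral_const_mul' _ _ enorm_ne_top]
    have : ∀ x : Plane, ‖heatKernel (1 + t) x‖ₑ = ENNReal.ofReal (heatKernel (1 + t) x) :=
      fun x => Real.enorm_of_nonneg (heatKernel_nonneg (by positivity) x)
    simp_rw [this]
    rw [lintegral_heatKernel (by positivity), mul_one, neg_zero, Real.rpow_zero, mul_one,
      ← ofReal_norm, Real.norm_eq_abs]
  · rw [oseenFlow, abs_mul, oseen_eq, abs_of_nonneg (heatKernel_nonneg (by positivity) x)]
    gcongr
    refine (heatKernel_le (by positivity) x).trans ?_
    have h1 : (1 + t) ^ (-1 / 2 : ℝ) ≤ t ^ (-1 / 2 : ℝ) :=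
      Real.rpow_le_rpow_of_nonpos ht (by linarith) (by norm_num)
    rw [sub_zero]
    calc 1 / (4 * Real.pi * (1 + t)) ≤ 1 / (1 + t) := by
          refine one_div_le_one_div_of_le (by positivity) ?_
          nlinarith [Real.pi_gt_three]
      _ = (1 + t) ^ (-1 / 2 : ℝ) * (1 + t) ^ (-1 / 2 : ℝ) := by
          rw [← Real.rpow_add (by positivity)]
          norm_num [Real.rpow_neg_one]
      _ ≤ _ := by gcongr

lemma duhamel_oseenFlow {α : ℝ} (hα : 0 < α) (a : ℝ) {t : ℝ} (ht : 0 < t) (x : Plane) :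
    duhamel α (oseenFlow a) (oseenFlow a) (t, x) = 0 := by
  have h : ∀ (s : ℝ) (y z : Plane), ‖y‖ = ‖z‖ → oseenFlow a (s, y) = oseenFlow a (s, z) :=
    fun s y z hyz => by
      simp only [oseenFlow, oseen_eq]
      rw [heatKernel_congr _ hyz]
  exact duhamel_radial h h ht
    ((decays_oseenFlow a).integrable_duhamelIntegrand hα (decays_oseenFlow a) le_rfl le_rfl
      (by norm_num) ht x)

/-- Solutions of the Duhamel equation, in terms of the operator `duhamel`. -/
theorem exists_duhamel_solution {α μ : ℝ} (hα : 0 < α) (hμ0 : 0 ≤ μ) (hμ : μ < 1 / 2)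
    {v₀ : Plane → ℝ} {r : ℝ} (hv : MemWeightedL2 2 v₀) (hr : weightedNorm 2 v₀ ≤ r)
    (hK : Decays.duhamelConst α μ * (18 * (dataConst μ * r)) ≤ 1 / 2) :
    ∃ ρ : ℝ × Plane → ℝ, Decays μ (8 * (dataConst μ * r)) ρ ∧
      (∀ t, 0 < t → ∀ x, ρ (t, x) = picard α (heatFlow (meanFree v₀)) (oseenFlow (∫ y, v₀ y)) ρ
        (t, x)) ∧
      ∀ t, 0 < t → ∀ x, oseenFlow (∫ y, v₀ y) (t, x) + ρ (t, x) = heatFlow v₀ (t, x) -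
        duhamel α (fun q => oseenFlow (∫ y, v₀ y) q + ρ q)
          (fun q => oseenFlow (∫ y, v₀ y) q + ρ q) (t, x) := by
  have hr0 : 0 ≤ r := (Real.sqrt_nonneg _).trans hr
  set a := ∫ y, v₀ y
  set L := heatFlow (meanFree v₀)
  have hL : Decays μ (4 * (dataConst μ * r)) L := decays_heatFlow_meanFree hμ0 hμ hv hr
  have ha : |a| ≤ dataConst μ * r := by
    refine (abs_integral_le_of_weightedNorm hμ0 hμ hv hr).trans ?_
    unfold dataConst
    nlinarith [mul_nonneg (Real.sqrt_nonneg (weightConst μ)) hr0]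
  have hE : Decays 0 (dataConst μ * r) (oseenFlow a) := (decays_oseenFlow a).mono ha le_rfl
  -- With `R = dataConst μ * r`, the linear part has size `A = 4R` and the vortex `B = R`, so `2B +
  -- 4A = 18R`.
  obtain ⟨ρ, hρ, hfix⟩ := exists_picard_fixedPoint hα hμ0 hμ hL hE
    (by refine (le_of_eq ?_).trans hK; ring)
  refine ⟨ρ, hρ.mono (le_of_eq (by ring)) le_rfl, hfix, fun t ht x => ?_⟩
  have hρ0 : Decays 0 _ ρ := hρ.mono le_rfl hμ0
  have hv' := hE.add hρ0
  -- The expansion `D(E + ρ, E + ρ) = D(ρ, E + ρ) + D(E, ρ) + D(E, E)`, whose last term vanishes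
  -- because `E` is radial.
  have e1 := duhamel_sub_left hα (fun s hs => hv'.integrable hs) (fun s hs => hE.integrable hs)
    (hv'.integrable_duhamelIntegrand hα hv' le_rfl le_rfl (by norm_num) ht x)
    (hE.integrable_duhamelIntegrand hα hv' le_rfl le_rfl (by norm_num) ht x)
  have e2 := duhamel_sub_right
    (hE.integrable_duhamelIntegrand hα hv' le_rfl le_rfl (by norm_num) ht x)
    (hE.integrable_duhamelIntegrand hα hE le_rfl le_rfl (by norm_num) ht x)
  simp only [add_sub_cancel_left] at e1 e2
  rw [duhamel_oseenFlow hα a ht x] at e2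
  rw [hfix t ht x, picard, heatFlow_meanFree hv.integrable ht, e1, e2, oseenFlow]
  ring

/-! ### Mild solutions from solutions of the Duhamel equation -/

lemma isMildSolution_of_duhamel {α N : ℝ} (hα : 0 < α) {v₀ : Plane → ℝ} (hv₀ : Integrable v₀)
    {f : ℝ × Plane → ℝ} (hf : Decays 0 N f)
    (h : ∀ t, 0 < t → ∀ x, f (t, x) = heatFlow v₀ (t, x) - duhamel α f f (t, x)) :
    IsMildSolution α v₀ fun t x => if t ≤ 0 then v₀ x else f (t, x) := by
  have hpos : ∀ {t : ℝ}, 0 < t → (fun x => if t ≤ 0 then v₀ x else f (t, x)) =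
      fun x => f (t, x) := fun ht => funext fun x => if_neg (not_le.2 ht)
  have hv_int : ∀ t : ℝ, Integrable fun x => if t ≤ 0 then v₀ x else f (t, x) := fun t => by
    rcases le_or_gt t 0 with ht | ht
    · simpa only [if_pos ht] using hv₀
    · rw [hpos ht]
      exact hf.integrable ht
  refine ⟨?_, fun t _ => hv_int t, ⟨max N (∫ x, |v₀ x|), fun t _ => ?_⟩, ?_,
    fun t => helmholtzFilter α _, fun t _ => isHelmholtzFilter_helmholtzFilter hα (hv_int t),
    fun t ht => .of_forall fun x => ?_⟩
  · refine ⟨f, hf.measurable.stronglyMeasurable, ?_⟩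
    have h0 : ∀ᵐ s ∂(volume.restrict (Set.Ici (0 : ℝ))), 0 < s := by
      rw [← restrict_Ioi_eq_restrict_Ici]
      exact ae_restrict_mem measurableSet_Ioi
    filter_upwards [Measure.quasiMeasurePreserving_fst.ae h0] with q hq
    exact if_neg (not_le.2 hq)
  · rcases le_or_gt t 0 with ht | ht
    · simp only [if_pos ht]
      exact le_max_right _ _
    · simp only [if_neg (not_le.2 ht)]
      refine le_max_of_le_left ?_
      have h1 := hf.lintegral_le t ht
      rw [neg_zero, Real.rpow_zero, mul_one] at h1
      have h2 : ∫⁻ x, ‖f (t, x)‖ₑ = ENNReal.ofReal (∫ x, |f (t, x)|) := by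
        rw [← ofReal_integral_norm_eq_lintegral_enorm (hf.integrable ht)]
        rfl
      rwa [h2, ENNReal.ofReal_le_ofReal_iff hf.nonneg] at h1
  · exact .of_forall fun x => if_pos le_rfl
  · rw [if_neg (not_le.2 ht), h t ht x, duhamel_eq_intervalIntegral ht
      (hf.integrable_duhamelIntegrand hα hf le_rfl le_rfl (by norm_num) ht x)]
    congr 1
    refine intervalIntegral.integral_congr_ae (.of_forall fun s hs => ?_)
    rw [Set.uIoc_of_le ht.le] at hs
    dsimp only
    rw [hpos hs.1, biotSavart_helmholtzFilter hα (hf.integrable hs.1)]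
    refine integral_congr_ae (.of_forall fun y => ?_)
    simp only [if_neg (not_le.2 hs.1)]

/-! ### Uniqueness of mild solutions -/

lemma measurable_lintegral_enorm {f : ℝ × Plane → ℝ} (hf : Measurable f) :
    Measurable fun s => ∫⁻ y, ‖f (s, y)‖ₑ :=
  Measurable.lintegral_prod_right' (ν := volume) (f := fun q : ℝ × Plane => ‖f q‖ₑ) hf.enorm

lemma lintegral_lintegral_duhamelIntegrand_le_mul {α : ℝ} (hα : 0 < α) {f g : ℝ × Plane → ℝ}
    (hf : Measurable f) (hg : Measurable g) (t : ℝ) :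
    ∫⁻ x, ∫⁻ q, ‖duhamelIntegrand α f g (t, x) q‖ₑ ≤
      ∫⁻ s in Set.Ioo 0 t, ENNReal.ofReal (2 / √(t - s)) *
        (ENNReal.ofReal (helmholtzRieszBound α) * (∫⁻ y, ‖f (s, y)‖ₑ) * ∫⁻ y, ‖g (s, y)‖ₑ) :=
  lintegral_lintegral_duhamelIntegrand_le α hf hg
    ((measurable_lintegral_enorm hf).const_mul _) (fun _ _ y => enorm_velocity_le hα _ y) t

lemma lintegral_Ioo_two_div_sqrt_sub {t : ℝ} (ht : 0 < t) :
    ∫⁻ s in Set.Ioo 0 t, ENNReal.ofReal (2 / √(t - s)) ≤ ENNReal.ofReal (4 * √t) := by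
  rw [← lintegral_two_div_sqrt_sub ht.le t, sub_self]
  exact lintegral_mono_set Set.Ioo_subset_Ioc_self

/-- With only `L¹` control of both factors, absolute convergence of the Duhamel integral is obtained
at almost every `x`. -/
lemma ae_integrable_duhamelIntegrand {α : ℝ} (hα : 0 < α) {f g : ℝ × Plane → ℝ}
    (hf : Measurable f) (hg : Measurable g) {M N : ℝ}
    (hfM : ∀ s, 0 < s → ∫⁻ y, ‖f (s, y)‖ₑ ≤ ENNReal.ofReal M)
    (hgN : ∀ s, 0 < s → ∫⁻ y, ‖g (s, y)‖ₑ ≤ ENNReal.ofReal N) {t : ℝ} (ht : 0 < t) :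
    ∀ᵐ x, Integrable (duhamelIntegrand α f g (t, x)) := by
  have hfin : ∫⁻ x, ∫⁻ q, ‖duhamelIntegrand α f g (t, x) q‖ₑ ≠ ⊤ := by
    refine ((lintegral_lintegral_duhamelIntegrand_le_mul hα hf hg t).trans_lt ?_).ne
    refine (setLIntegral_mono' (g := fun s => ENNReal.ofReal (2 / √(t - s)) *
      (ENNReal.ofReal (helmholtzRieszBound α) * ENNReal.ofReal M * ENNReal.ofReal N))
      measurableSet_Ioo fun s hs => ?_).trans_lt ?_
    · gcongr
      exacts [hfM s hs.1, hgN s hs.1]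
    · rw [lintegral_mul_const' _ _ (by finiteness)]
      exact ENNReal.mul_lt_top
        ((lintegral_Ioo_two_div_sqrt_sub ht).trans_lt ENNReal.ofReal_lt_top) (by finiteness)
  have hm : Measurable fun x => ∫⁻ q, ‖duhamelIntegrand α f g (t, x) q‖ₑ :=
    Measurable.lintegral_prod_right' (ν := volume)
      (f := fun r : Plane × (ℝ × Plane) => ‖duhamelIntegrand α f g (t, r.1) r.2‖ₑ)
      ((measurable_duhamelIntegrand_uncurry α hf hg).comp
        (f := fun r : Plane × (ℝ × Plane) => ((t, r.1), r.2)) (by fun_prop)).enorm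
  filter_upwards [ae_lt_top hm hfin] with x hx
  exact integrable_duhamelIntegrand hf hg hx

/-- Every mild solution agrees at all positive times with a measurable solution of the Duhamel
equation. -/
lemma IsMildSolution.exists_duhamel_version {α : ℝ} (hα : 0 < α) {v₀ : Plane → ℝ}
    (hv₀ : Integrable v₀) {v : ℝ → Plane → ℝ} (hv : IsMildSolution α v₀ v) :
    ∃ f : ℝ × Plane → ℝ, ∃ M : ℝ, Measurable f ∧
      (∀ t, 0 < t → ∫⁻ x, ‖f (t, x)‖ₑ ≤ ENNReal.ofReal M) ∧
      (∀ t, 0 < t → v t =ᵐ[volume] fun x => f (t, x)) ∧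
      ∀ t x, f (t, x) = heatFlow v₀ (t, x) - VCHE.duhamel α f f (t, x) := by
  obtain ⟨M, hM⟩ := hv.bounded
  obtain ⟨w, hw, hd⟩ := hv.duhamel
  have hvM : ∀ t, 0 < t → ∫⁻ x, ‖v t x‖ₑ ≤ ENNReal.ofReal M := fun t ht => by
    rw [← ofReal_integral_norm_eq_lintegral_enorm (hv.integrable t ht.le)]
    exact ENNReal.ofReal_le_ofReal (hM t ht.le)
  set g₀ := hv.aestronglyMeasurable.mk with hg₀
  have hg₀m : Measurable g₀ := hv.aestronglyMeasurable.stronglyMeasurable_mk.measurable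
  have hvg₀ : ∀ᵐ s, 0 < s → v s =ᵐ[volume] fun y => g₀ (s, y) := by
    have h1 := Measure.ae_ae_of_ae_prod hv.aestronglyMeasurable.ae_eq_mk
    rw [ae_restrict_iff' measurableSet_Ici] at h1
    filter_upwards [h1] with s hs h0
    exact hs h0.le
  -- A measurable representative respects the `L¹` bound only at almost every time; slices of larger
  -- mass are set to zero so that the bound holds at all positive times.
  set A : Set (ℝ × Plane) := {q | ∫⁻ y, ‖g₀ (q.1, y)‖ₑ ≤ ENNReal.ofReal M}
  have hA : MeasurableSet A :=
    measurableSet_le ((measurable_lintegral_enorm hg₀m).comp measurable_fst) measurable_const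
  set g := A.indicator g₀
  have hgm : Measurable g := hg₀m.indicator hA
  have hgM : ∀ s, 0 < s → ∫⁻ y, ‖g (s, y)‖ₑ ≤ ENNReal.ofReal M := fun s _ => by
    by_cases hs : ∫⁻ y, ‖g₀ (s, y)‖ₑ ≤ ENNReal.ofReal M
    · have : ∀ y, g (s, y) = g₀ (s, y) := fun y => Set.indicator_of_mem (s := A) hs _
      simpa only [this] using hs
    · have : ∀ y, g (s, y) = 0 := fun y => Set.indicator_of_notMem (s := A) hs _
      simp [this]
  have hvg : ∀ᵐ s, 0 < s → v s =ᵐ[volume] fun y => g (s, y) := by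
    filter_upwards [hvg₀] with s hs h0
    have h1 : ∫⁻ y, ‖g₀ (s, y)‖ₑ ≤ ENNReal.ofReal M := by
      refine (lintegral_congr_ae ?_).trans_le (hvM s h0)
      filter_upwards [hs h0] with y hy
      rw [hy]
    have : ∀ y, g (s, y) = g₀ (s, y) := fun y => Set.indicator_of_mem (s := A) h1 _
    simpa only [this] using hs h0
  have hgint : ∀ s, 0 < s → Integrable fun y => g (s, y) := fun s hs =>
    ⟨(hgm.comp measurable_prodMk_left).aestronglyMeasurable,
      (hgM s hs).trans_lt ENNReal.ofReal_lt_top⟩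
  -- Redefining the solution by the right-hand side of its own equation gives a version that agrees
  -- with `v t` at every positive `t`. As `f` and `g` agree almost everywhere, the Duhamel term can
  -- afterwards be rewritten in terms of `f`.
  set f : ℝ × Plane → ℝ := fun q => heatFlow v₀ q - VCHE.duhamel α g g q
  have hfm : Measurable f :=
    (measurable_heatFlow hv₀.aestronglyMeasurable).sub (measurable_duhamel α hgm hgm)
  have hvf : ∀ t, 0 < t → v t =ᵐ[volume] fun x => f (t, x) := fun t ht => by
    filter_upwards [hd t ht, ae_integrable_duhamelIntegrand hα hgm hgm hgM hgM ht] with x hx hi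
    rw [hx]
    show _ = heatFlow v₀ (t, x) - VCHE.duhamel α g g (t, x)
    rw [duhamel_eq_intervalIntegral ht hi, heatFlow]
    congr 1
    refine intervalIntegral.integral_congr_ae ?_
    filter_upwards [hvg] with s hs h0
    rw [Set.uIoc_of_le ht.le] at h0
    rw [(hw s h0.1.le).biotSavart_eq hα (hv.integrable s h0.1.le),
      velocity_congr_ae (hs h0.1)]
    refine integral_congr_ae ?_
    filter_upwards [hs h0.1] with y hy
    rw [hy]
  have hgf : ∀ᵐ s, 0 < s → (fun y => g (s, y)) =ᵐ[volume] fun y => f (s, y) := by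
    filter_upwards [hvg] with s hs h0
    exact (hs h0).symm.trans (hvf s h0)
  have hgf' : g =ᵐ[volume.restrict (Set.Ioi 0 ×ˢ Set.univ)] f := by
    rw [Filter.EventuallyEq, ae_restrict_iff' (measurableSet_Ioi.prod MeasurableSet.univ),
      Measure.volume_eq_prod, Measure.ae_prod_iff_ae_ae]
    · filter_upwards [hgf] with s hs
      by_cases h0 : 0 < s
      · filter_upwards [hs h0] with y hy _ using hy
      · exact .of_forall fun y hy => absurd hy.1 h0
    · exact (measurableSet_Ioi.prod MeasurableSet.univ).imp (measurableSet_eq_fun hgm hfm)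
  refine ⟨f, M, hfm, fun t ht => ?_, hvf, fun t x => ?_⟩
  · refine (lintegral_congr_ae ?_).trans_le (hvM t ht)
    filter_upwards [hvf t ht] with y hy
    rw [hy]
  · rw [← duhamel_congr_ae hgf hgf']

/-- A Gronwall lemma with the weakly singular kernel `(t - s)^{-1/2}`. -/
lemma eq_zero_of_le_lintegral_inv_sqrt {m : ℝ → ℝ≥0∞} {B K : ℝ} (hK : 0 ≤ K)
    (hB : ∀ t, 0 < t → m t ≤ ENNReal.ofReal B)
    (hm : ∀ t, 0 < t → m t ≤ ∫⁻ s in Set.Ioo 0 t,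
      ENNReal.ofReal (2 / √(t - s)) * (ENNReal.ofReal K * m s)) {t : ℝ} (ht : 0 < t) :
    m t = 0 := by
  -- A step so short that the kernel over it has mass `4√c` with `4√c K ≤ 1/2`; `K + 1` avoids
  -- division by zero.
  set c : ℝ := (1 / (8 * (K + 1))) ^ 2
  have hc : 0 < c := by positivity
  have hcK : 4 * √c * K ≤ 1 / 2 := by
    rw [Real.sqrt_sq (by positivity)]
    rw [show 4 * (1 / (8 * (K + 1))) * K = K / (2 * (K + 1)) by field_simp; ring,
      div_le_div_iff₀ (by positivity) (by norm_num)]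
    linarith
  have step : ∀ n : ℕ, ∀ t, 0 < t → t ≤ n * c → m t = 0 := by
    intro n
    induction n with
    | zero => intro t ht h; simp at h; linarith
    | succ n ih =>
      -- Before `t - c` the function vanishes by induction, so only a window of length `c`
      -- contributes. This gives `S ≤ S / 2`, and `S` is finite, hence zero.
      set S : ℝ≥0∞ := ⨆ t ∈ Set.Ioc 0 ((n + 1 : ℕ) * c), m t
      have hS : S ≤ ENNReal.ofReal B := iSup₂_le fun t ht => hB t ht.1
      have hhalf : ∀ t ∈ Set.Ioc 0 ((n + 1 : ℕ) * c), m t ≤ ENNReal.ofReal (1 / 2) * S := by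
        intro t ht
        calc m t ≤ ∫⁻ s in Set.Ioo 0 t,
              ENNReal.ofReal (2 / √(t - s)) * (ENNReal.ofReal K * m s) := hm t ht.1
          _ ≤ ∫⁻ s in Set.Ioc (t - c) t,
              ENNReal.ofReal (2 / √(t - s)) * (ENNReal.ofReal K * S) := by
            rw [← lintegral_indicator measurableSet_Ioo, ← lintegral_indicator measurableSet_Ioc]
            refine lintegral_mono fun s => ?_
            by_cases hs : s ∈ Set.Ioo 0 t
            · rw [Set.indicator_of_mem hs]
              by_cases hs' : t - c < s
              · rw [Set.indicator_of_mem (show s ∈ Set.Ioc (t - c) t from ⟨hs', hs.2.le⟩)]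
                gcongr
                exact le_iSup₂ (f := fun t (_ : t ∈ Set.Ioc 0 ((n + 1 : ℕ) * c)) => m t) s
                  ⟨hs.1, hs.2.le.trans ht.2⟩
              · have h2 := ht.2
                push_cast at h2
                rw [ih s hs.1 (by linarith)]
                simp
            · rw [Set.indicator_of_notMem hs]
              exact zero_le
          _ = ENNReal.ofReal (4 * √c * K) * S := by
            have hSt : S ≠ ⊤ := (hS.trans_lt ENNReal.ofReal_lt_top).ne
            rw [lintegral_mul_const' _ _ (ENNReal.mul_ne_top ENNReal.ofReal_ne_top hSt),
              lintegral_two_div_sqrt_sub hc.le, ENNReal.ofReal_mul (by positivity) (q := K),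
              mul_assoc]
          _ ≤ _ := by gcongr
      have hS0 : S = 0 := by
        by_contra h0
        have h1 : S ≤ ENNReal.ofReal (1 / 2) * S := iSup₂_le hhalf
        have h2 : ENNReal.ofReal (1 / 2) * S < 1 * S :=
          ENNReal.mul_lt_mul_left h0 (hS.trans_lt ENNReal.ofReal_lt_top).ne
            (by rw [ENNReal.ofReal_lt_one]; norm_num)
        rw [one_mul] at h2
        exact absurd h1 (not_le.2 h2)
      intro t ht htn
      have := hhalf t ⟨ht, htn⟩
      rwa [hS0, mul_zero, nonpos_iff_eq_zero] at this
  obtain ⟨n, hn⟩ := exists_nat_ge (t / c)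
  exact step n t ht ((div_le_iff₀ hc).1 hn)

/-- The difference `d = f - g` satisfies `d = -(D(d, f) + D(g, d))`, with `D` the Duhamel operator.
The bounded velocity kernel turns this into a linear inequality for the `L¹` norm of `d` with kernel
`(t - s)^{-1/2}`. No smallness is used. -/
lemma duhamel_solution_unique {α : ℝ} (hα : 0 < α) {f g L : ℝ × Plane → ℝ} (hf : Measurable f)
    (hg : Measurable g) {M N : ℝ}
    (hfM : ∀ s, 0 < s → ∫⁻ y, ‖f (s, y)‖ₑ ≤ ENNReal.ofReal M)
    (hgN : ∀ s, 0 < s → ∫⁻ y, ‖g (s, y)‖ₑ ≤ ENNReal.ofReal N)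
    (hfD : ∀ t, 0 < t → ∀ x, f (t, x) = L (t, x) - duhamel α f f (t, x))
    (hgD : ∀ t, 0 < t → ∀ x, g (t, x) = L (t, x) - duhamel α g g (t, x)) {t : ℝ} (ht : 0 < t) :
    (fun x => f (t, x)) =ᵐ[volume] fun x => g (t, x) := by
  have hfi : ∀ s, 0 < s → Integrable fun y => f (s, y) := fun s hs =>
    ⟨(hf.comp measurable_prodMk_left).aestronglyMeasurable,
      (hfM s hs).trans_lt ENNReal.ofReal_lt_top⟩
  have hgi : ∀ s, 0 < s → Integrable fun y => g (s, y) := fun s hs =>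
    ⟨(hg.comp measurable_prodMk_left).aestronglyMeasurable,
      (hgN s hs).trans_lt ENNReal.ofReal_lt_top⟩
  set d : ℝ × Plane → ℝ := fun q => f q - g q
  have hd : Measurable d := hf.sub hg
  set H := helmholtzRieszBound α
  have hH : 0 ≤ H := helmholtzRieszBound_nonneg hα
  set m : ℝ → ℝ≥0∞ := fun s => ∫⁻ y, ‖d (s, y)‖ₑ
  have hmm : Measurable m := measurable_lintegral_enorm hd
  have hdB : ∀ s, 0 < s → m s ≤ ENNReal.ofReal (max M 0 + max N 0) := fun s hs => by
    rw [ENNReal.ofReal_add (le_max_right _ _) (le_max_right _ _)]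
    refine le_trans ?_ (add_le_add ((hfM s hs).trans (ENNReal.ofReal_le_ofReal (le_max_left _ _)))
      ((hgN s hs).trans (ENNReal.ofReal_le_ofReal (le_max_left _ _))))
    have h1 : Measurable fun y => ‖f (s, y)‖ₑ := (hf.comp measurable_prodMk_left).enorm
    rw [← lintegral_add_left h1]
    exact lintegral_mono fun y => enorm_sub_le
  have key : ∀ t, 0 < t → m t ≤ ∫⁻ s in Set.Ioo 0 t,
      ENNReal.ofReal (2 / √(t - s)) * (ENNReal.ofReal (H * (max M 0 + max N 0)) * m s) := by
    intro t ht
    have h1 : ∀ᵐ x, ‖d (t, x)‖ₑ ≤ (∫⁻ q, ‖duhamelIntegrand α d f (t, x) q‖ₑ) +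
        ∫⁻ q, ‖duhamelIntegrand α g d (t, x) q‖ₑ := by
      filter_upwards [ae_integrable_duhamelIntegrand hα hf hf hfM hfM ht,
        ae_integrable_duhamelIntegrand hα hg hf hgN hfM ht,
        ae_integrable_duhamelIntegrand hα hg hg hgN hgN ht] with x i1 i2 i3
      have e : d (t, x) = -(duhamel α d f (t, x) + duhamel α g d (t, x)) := by
        rw [show duhamel α d f (t, x) = _ from duhamel_sub_left hα hfi hgi i1 i2,
          show duhamel α g d (t, x) = _ from duhamel_sub_right i2 i3]
        show f (t, x) - g (t, x) = _
        rw [hfD t ht x, hgD t ht x]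
        ring
      rw [e, enorm_neg]
      exact (enorm_add_le _ _).trans
        (add_le_add (enorm_duhamel_le _ _ _ _) (enorm_duhamel_le _ _ _ _))
    have hmeas : Measurable fun x => ∫⁻ q, ‖duhamelIntegrand α d f (t, x) q‖ₑ :=
      Measurable.lintegral_prod_right' (ν := volume)
        (f := fun r : Plane × (ℝ × Plane) => ‖duhamelIntegrand α d f (t, r.1) r.2‖ₑ)
        ((measurable_duhamelIntegrand_uncurry α hd hf).comp
          (f := fun r : Plane × (ℝ × Plane) => ((t, r.1), r.2)) (by fun_prop)).enorm
    calc m t ≤ _ := lintegral_mono_ae h1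
      _ = _ := lintegral_add_left hmeas _
      _ ≤ _ := add_le_add (lintegral_lintegral_duhamelIntegrand_le_mul hα hd hf t)
          (lintegral_lintegral_duhamelIntegrand_le_mul hα hg hd t)
      _ = ∫⁻ s in Set.Ioo 0 t, (ENNReal.ofReal (2 / √(t - s)) *
            (ENNReal.ofReal H * m s * ∫⁻ y, ‖f (s, y)‖ₑ) + ENNReal.ofReal (2 / √(t - s)) *
            (ENNReal.ofReal H * (∫⁻ y, ‖g (s, y)‖ₑ) * m s)) := by
          have hfm := measurable_lintegral_enorm hf
          refine (lintegral_add_left ?_ _).symm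
          exact Measurable.mul (by fun_prop) ((hmm.const_mul _).mul hfm)
      _ ≤ _ := by
          refine setLIntegral_mono' measurableSet_Ioo fun s hs => ?_
          rw [ENNReal.ofReal_mul hH, ENNReal.ofReal_add (le_max_right _ _) (le_max_right _ _)]
          calc _ = ENNReal.ofReal (2 / √(t - s)) * (ENNReal.ofReal H *
                ((∫⁻ y, ‖f (s, y)‖ₑ) + ∫⁻ y, ‖g (s, y)‖ₑ) * m s) := by ring
            _ ≤ _ := by
              gcongr
              · exact (hfM s hs.1).trans (ENNReal.ofReal_le_ofReal (le_max_left _ _))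
              · exact (hgN s hs.1).trans (ENNReal.ofReal_le_ofReal (le_max_left _ _))
  have h0 : m t = 0 := eq_zero_of_le_lintegral_inv_sqrt (by positivity) hdB key ht
  have h1 : Measurable fun y => ‖d (t, y)‖ₑ := (hd.comp measurable_prodMk_left).enorm
  rw [lintegral_eq_zero_iff h1] at h0
  filter_upwards [h0] with x hx
  exact sub_eq_zero.1 (enorm_eq_zero.1 hx)

/-! ### Decay of the remainder in `L^p` -/

/-- Interpolation between `L¹` and `L²`. -/
lemma eLpNorm_le_of_lintegral_of_sq {F : Plane → ℝ} (hF : AEStronglyMeasurable F)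
    {C T μ p : ℝ} (hC : 0 ≤ C) (hT : 0 < T) (hp1 : 1 ≤ p) (hp2 : p ≤ 2)
    (h1 : ∫⁻ x, ‖F x‖ₑ ≤ ENNReal.ofReal (C * T ^ (-μ)))
    (h2 : ∫⁻ x, ‖F x‖ₑ ^ 2 ≤ ENNReal.ofReal (C ^ 2 * T ^ (-1 - 2 * μ))) :
    eLpNorm F (ENNReal.ofReal p) volume ≤ ENNReal.ofReal (C * T ^ (-1 - μ + 1 / p)) := by
  have hp0 : 0 < p := by linarith
  have hTm := Real.rpow_pos_of_pos hT
  rw [eLpNorm_eq_lintegral_rpow_enorm_toReal (by simpa using hp0) ENNReal.ofReal_ne_top,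
    ENNReal.toReal_ofReal hp0.le]
  have h3 : ∫⁻ x, ‖F x‖ₑ ^ p ≤ ENNReal.ofReal ((C * T ^ (-1 - μ + 1 / p)) ^ p) := by
    -- Hölder with weights `2 - p` and `p - 1`, which are nonnegative and sum to one.
    calc ∫⁻ x, ‖F x‖ₑ ^ p = ∫⁻ x, ‖F x‖ₑ ^ (2 - p) * (‖F x‖ₑ ^ 2) ^ (p - 1) := by
          refine lintegral_congr fun x => ?_
          rw [← ENNReal.rpow_natCast, ← ENNReal.rpow_mul,
            ← ENNReal.rpow_add_of_nonneg _ _ (by linarith) (by push_cast; nlinarith)]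
          congr 1
          push_cast
          ring
      _ ≤ (∫⁻ x, ‖F x‖ₑ) ^ (2 - p) * (∫⁻ x, ‖F x‖ₑ ^ 2) ^ (p - 1) :=
          ENNReal.lintegral_mul_norm_pow_le hF.enorm (hF.enorm.pow_const 2) (by linarith)
            (by linarith) (by ring)
      _ ≤ ENNReal.ofReal (C * T ^ (-μ)) ^ (2 - p) *
          ENNReal.ofReal (C ^ 2 * T ^ (-1 - 2 * μ)) ^ (p - 1) :=
          mul_le_mul' (ENNReal.rpow_le_rpow h1 (by linarith))
            (ENNReal.rpow_le_rpow h2 (by linarith))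
      _ = _ := by
          have hA := hTm (-μ)
          have hB := hTm (-1 - 2 * μ)
          rw [ENNReal.ofReal_rpow_of_nonneg (by positivity) (by linarith),
            ENNReal.ofReal_rpow_of_nonneg (by positivity) (by linarith),
            ← ENNReal.ofReal_mul (by positivity), Real.mul_rpow hC hA.le,
            Real.mul_rpow (by positivity) hB.le, Real.mul_rpow hC (hTm _).le,
            ← Real.rpow_natCast C 2, ← Real.rpow_mul hC, ← Real.rpow_mul hT.le,
            ← Real.rpow_mul hT.le, ← Real.rpow_mul hT.le, mul_mul_mul_comm,
            ← Real.rpow_add_of_nonneg hC (by linarith) (by push_cast; nlinarith),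
            ← Real.rpow_add hT]
          congr 3
          · push_cast; ring
          · field_simp; ring
  calc _ ≤ ENNReal.ofReal ((C * T ^ (-1 - μ + 1 / p)) ^ p) ^ (1 / p) :=
        ENNReal.rpow_le_rpow h3 (by positivity)
    _ = _ := by
        have hA := hTm (-1 - μ + 1 / p)
        rw [ENNReal.ofReal_rpow_of_nonneg (by positivity) (by positivity), one_div p,
          Real.rpow_rpow_inv (by positivity) hp0.ne']

/-- Interpolation between `L¹` and `L^∞`. -/
lemma eLpNorm_le_of_lintegral_of_abs_le {F : Plane → ℝ} (hF : AEStronglyMeasurable F)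
    {C T μ p : ℝ} (hC : 0 ≤ C) (hT : 0 < T) (hp1 : 1 ≤ p) (hp2 : p ≤ 2)
    (h1 : ∫⁻ x, ‖F x‖ₑ ≤ ENNReal.ofReal (C * T ^ (-μ)))
    (h2 : ∀ x, |F x| ≤ C * T ^ (-1 - μ)) :
    eLpNorm F (ENNReal.ofReal p) volume ≤ ENNReal.ofReal (C * T ^ (-1 - μ + 1 / p)) := by
  refine eLpNorm_le_of_lintegral_of_sq hF hC hT hp1 hp2 h1 ?_
  have hA := Real.rpow_pos_of_pos hT (-1 - μ)
  calc ∫⁻ x, ‖F x‖ₑ ^ 2 ≤ ∫⁻ x, ENNReal.ofReal (C * T ^ (-1 - μ)) * ‖F x‖ₑ := by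
        refine lintegral_mono fun x => ?_
        rw [sq]
        gcongr
        rw [← ofReal_norm]
        exact ENNReal.ofReal_le_ofReal (h2 x)
    _ ≤ ENNReal.ofReal (C * T ^ (-1 - μ)) * ENNReal.ofReal (C * T ^ (-μ)) := by
        rw [lintegral_const_mul' _ _ ENNReal.ofReal_ne_top]
        gcongr
    _ = _ := by
        rw [← ENNReal.ofReal_mul (by positivity), mul_mul_mul_comm, ← Real.rpow_add hT, ← sq]
        congr 3
        ring

lemma Decays.eLpNorm_duhamel_le {α ν ν' N N' p : ℝ} {f g : ℝ × Plane → ℝ} (hα : 0 < α)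
    (hf : Decays ν N f) (hg : Decays ν' N' g) (hν : 0 ≤ ν) (hν' : 0 ≤ ν') (hl : ν + ν' < 1 / 2)
    (hp1 : 1 ≤ p) (hp2 : p ≤ 2) {t : ℝ} (ht : 0 < t) :
    eLpNorm (fun x => VCHE.duhamel α f g (t, x)) (ENNReal.ofReal p) volume ≤
      ENNReal.ofReal (duhamelConst α (ν + ν') * (N * N') * (1 + t) ^ (-1 - (ν + ν') + 1 / p)) := by
  have h := hf.duhamel hα hg hν hν' hl
  exact eLpNorm_le_of_lintegral_of_abs_le (h.integrable ht).aestronglyMeasurable h.nonneg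
    (by positivity) hp1 hp2 (h.lintegral_le t ht) (hf.abs_duhamel_le hα hg hν hν' hl ht)

/-- The initial layer, and the initial time itself. -/
lemma eLpNorm_le_of_sq_le_of_le_one {F : Plane → ℝ} (hF : AEStronglyMeasurable F)
    {R t μ p : ℝ} (hR : 0 ≤ R) (hμ0 : 0 ≤ μ) (hμ : μ < 1 / 2) (hp1 : 1 ≤ p) (hp2 : p ≤ 2)
    (ht0 : 0 ≤ t) (ht : t ≤ 1) (h1 : ∫⁻ x, ‖F x‖ₑ ≤ ENNReal.ofReal R)
    (h2 : ∫⁻ x, ‖F x‖ₑ ^ 2 ≤ ENNReal.ofReal (R ^ 2)) :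
    eLpNorm F (ENNReal.ofReal p) volume ≤
      ENNReal.ofReal (8 * R * (1 + t) ^ (-1 - μ + 1 / p)) := by
  refine eLpNorm_le_of_lintegral_of_sq hF (by positivity) (by positivity) hp1 hp2
    (h1.trans (ENNReal.ofReal_le_ofReal ?_)) (h2.trans (ENNReal.ofReal_le_ofReal ?_))
  · nlinarith [half_le_one_add_rpow ht0 ht hμ0 (by linarith : μ ≤ 1)]
  · have h := half_le_one_add_rpow ht0 ht (by linarith : 0 ≤ 1 / 2 + μ) (by linarith)
    have e : (1 + t) ^ (-1 - 2 * μ) = ((1 + t) ^ (-(1 / 2 + μ))) ^ 2 := by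
      rw [← Real.rpow_natCast, ← Real.rpow_mul (by positivity)]
      congr 1
      push_cast
      ring
    rw [e, ← mul_pow]
    refine pow_le_pow_left₀ hR ?_ 2
    nlinarith

lemma eLpNorm_heatFlow_meanFree_le {v : Plane → ℝ} {r μ p t : ℝ} (hμ0 : 0 ≤ μ) (hμ : μ < 1 / 2)
    (hv : MemWeightedL2 2 v) (hr : weightedNorm 2 v ≤ r) (hp1 : 1 ≤ p) (hp2 : p ≤ 2)
    (ht : 0 < t) :
    eLpNorm (fun x => heatFlow (meanFree v) (t, x)) (ENNReal.ofReal p) volume ≤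
      ENNReal.ofReal (8 * (dataConst μ * r) * (1 + t) ^ (-1 - μ + 1 / p)) := by
  have hr0 : 0 ≤ r := (Real.sqrt_nonneg _).trans hr
  have hR : 0 ≤ dataConst μ * r := mul_nonneg (dataConst_pos μ).le hr0
  have hL := decays_heatFlow_meanFree hμ0 hμ hv hr
  have hLm := (hL.integrable ht).aestronglyMeasurable
  have hmf := (integrable_meanFree hv.integrable).aestronglyMeasurable
  -- For `t ≤ 1` the sup bound is singular, so the `L²` bound inherited from the data replaces it;
  -- for `t ≥ 1` the factor `t^{-1/2}` is comparable with `(1 + t)^{-1/2}`.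
  rcases le_total t 1 with h1 | h1
  · exact eLpNorm_le_of_sq_le_of_le_one hLm hR hμ0 hμ hp1 hp2 ht.le h1
      ((lintegral_heatFlow_le hmf ht).trans ((lintegral_enorm_le_weight hμ0 _).trans
        (lintegral_weight_meanFree_le hμ0 hμ hv hr)))
      ((lintegral_heatFlow_sq_le hmf ht).trans (lintegral_meanFree_sq_le hμ0 hμ hv hr))
  · refine eLpNorm_le_of_lintegral_of_abs_le hLm (by positivity) (by positivity) hp1 hp2
      ((hL.lintegral_le t ht).trans (ENNReal.ofReal_le_ofReal ?_))
      fun x => (hL.abs_le t ht x).trans ?_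
    · gcongr
      norm_num
    · have h := rpow_neg_le_one_add h1 (b := 1 / 2) (by norm_num) (by norm_num)
      rw [show -(1 / 2 : ℝ) = -1 / 2 by norm_num] at h
      calc 4 * (dataConst μ * r) * (t ^ (-1 / 2 : ℝ) * (1 + t) ^ (-1 / 2 - μ))
          ≤ 4 * (dataConst μ * r) * (2 * (1 + t) ^ (-1 / 2 : ℝ) * (1 + t) ^ (-1 / 2 - μ)) := by
            gcongr
        _ = _ := by
            rw [show -1 - μ = -1 / 2 + (-1 / 2 - μ) by ring, Real.rpow_add (by positivity)]
            ring

/-- Two derivatives of the Gaussian gain a full factor `1 / (1 + t)`, at least as good as `(1 +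
t)^{-μ}`, so the unfiltering correction never limits the rate. -/
lemma eLpNorm_laplacian_oseen_le {t μ p : ℝ} (hμ1 : μ ≤ 1) (hp1 : 1 ≤ p)
    (hp2 : p ≤ 2) (ht : 0 ≤ t) :
    eLpNorm (Δ (oseen t)) (ENNReal.ofReal p) volume ≤
      ENNReal.ofReal (10 * (1 + t) ^ (-1 - μ + 1 / p)) := by
  have hT : 0 < 1 + t := by positivity
  have hle := fun x => abs_laplacian_heatKernel_le hT x
  rw [oseen_eq]
  have hm : AEStronglyMeasurable (Δ (heatKernel (1 + t))) := by
    refine Continuous.aestronglyMeasurable ?_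
    rw [funext (laplacian_heatKernel (1 + t))]
    have := continuous_heatKernel (1 + t)
    fun_prop
  have hinv : 10 / (1 + t) ≤ 10 * (1 + t) ^ (-μ) := by
    rw [div_eq_mul_inv, ← Real.rpow_neg_one]
    gcongr
    linarith
  refine eLpNorm_le_of_lintegral_of_abs_le hm (by norm_num) hT hp1 hp2 ?_ fun x => ?_
  · calc _ ≤ ∫⁻ x, ENNReal.ofReal (10 / (1 + t)) * ENNReal.ofReal (heatKernel (2 * (1 + t)) x) := by
          refine lintegral_mono fun x => ?_
          rw [← ENNReal.ofReal_mul (by positivity), ← ofReal_norm]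
          exact ENNReal.ofReal_le_ofReal (hle x)
      _ = ENNReal.ofReal (10 / (1 + t)) := by
          rw [lintegral_const_mul' _ _ ENNReal.ofReal_ne_top, lintegral_heatKernel (by positivity),
            mul_one]
      _ ≤ _ := ENNReal.ofReal_le_ofReal hinv
  · refine (hle x).trans ?_
    have h1 : heatKernel (2 * (1 + t)) x ≤ (1 + t) ^ (-1 : ℝ) := by
      refine (heatKernel_le (by positivity) x).trans ?_
      rw [Real.rpow_neg_one, one_div]
      gcongr
      nlinarith [Real.pi_gt_three]
    have h0 := heatKernel_nonneg (mul_pos two_pos hT).le x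
    calc _ ≤ 10 * (1 + t) ^ (-μ) * (1 + t) ^ (-1 : ℝ) := by gcongr
      _ = _ := by rw [mul_assoc, ← Real.rpow_add hT]; congr 2; ring

/-- The remainder of a solution consists of the heat flow of the mean-free part of the data, of two
Duhamel terms and of the filtering defect of the Oseen vortex. -/
lemma eLpNorm_sub_unfilteredOseen_le {α μ r p t : ℝ} (hα : 0 < α) (hμ0 : 0 ≤ μ) (hμ : μ < 1 / 2)
    {v₀ : Plane → ℝ} (hv₀ : MemWeightedL2 2 v₀) (hr : weightedNorm 2 v₀ ≤ r)
    {ρ : ℝ × Plane → ℝ} (hρ : Decays μ (8 * (dataConst μ * r)) ρ)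
    (hfix : ∀ t, 0 < t → ∀ x,
      ρ (t, x) = picard α (heatFlow (meanFree v₀)) (oseenFlow (∫ y, v₀ y)) ρ (t, x))
    {V : Plane → ℝ} (hV0 : t = 0 → V =ᵐ[volume] v₀)
    (hV : 0 < t → V =ᵐ[volume] fun x => oseenFlow (∫ y, v₀ y) (t, x) + ρ (t, x))
    (hp1 : 1 ≤ p) (hp2 : p ≤ 2) (ht : 0 ≤ t) :
    eLpNorm (fun x => V x - (∫ y, v₀ y) * unfilteredOseen α t x) (ENNReal.ofReal p) volume ≤
      ENNReal.ofReal ((8 * (dataConst μ * r) + 80 * Decays.duhamelConst α μ * (dataConst μ * r) ^ 2 +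
        10 * α ^ 2 * (dataConst μ * r)) * (1 + t) ^ (-1 - μ + 1 / p)) := by
  have hr0 : 0 ≤ r := (Real.sqrt_nonneg _).trans hr
  set R := dataConst μ * r
  have hR : 0 ≤ R := mul_nonneg (dataConst_pos μ).le hr0
  set a := ∫ y, v₀ y
  have ha : |a| ≤ R := by
    refine (abs_integral_le_of_weightedNorm hμ0 hμ hv₀ hr).trans ?_
    show _ ≤ dataConst μ * r
    unfold dataConst
    nlinarith [mul_nonneg (Real.sqrt_nonneg (weightConst μ)) hr0]
  have hp : 1 ≤ ENNReal.ofReal p := by rwa [ENNReal.one_le_ofReal]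
  set K := Decays.duhamelConst α μ
  have hK : 0 ≤ K := Decays.duhamelConst_nonneg hα hμ
  set T := (1 + t) ^ (-1 - μ + 1 / p)
  have hT : 0 ≤ T := by positivity
  have hΔm : AEStronglyMeasurable fun x => a * α ^ 2 * (Δ (oseen t)) x := by
    refine Continuous.aestronglyMeasurable ?_
    rw [oseen_eq, funext (laplacian_heatKernel (1 + t))]
    have := continuous_heatKernel (1 + t)
    fun_prop
  have hΔ : eLpNorm (fun x => a * α ^ 2 * (Δ (oseen t)) x) (ENNReal.ofReal p) volume ≤
      ENNReal.ofReal (10 * α ^ 2 * R * T) := by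
    calc _ = ‖a * α ^ 2‖ₑ * eLpNorm (Δ (oseen t)) (ENNReal.ofReal p) volume :=
          eLpNorm_const_smul (a * α ^ 2) (Δ (oseen t)) _ _
      _ ≤ ENNReal.ofReal (R * α ^ 2) * ENNReal.ofReal (10 * T) := by
          refine mul_le_mul' ?_ (eLpNorm_laplacian_oseen_le (by linarith) hp1 hp2 ht)
          rw [← ofReal_norm, norm_mul, Real.norm_eq_abs, Real.norm_of_nonneg (sq_nonneg α)]
          gcongr
      _ = _ := by rw [← ENNReal.ofReal_mul (by positivity)]; congr 1; ring
  have hsum : ∀ {F : Plane → ℝ}, AEStronglyMeasurable F →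
      eLpNorm F (ENNReal.ofReal p) volume ≤ ENNReal.ofReal ((8 * R + 80 * K * R ^ 2) * T) →
      (fun x => V x - a * unfilteredOseen α t x) =ᵐ[volume]
        (F + fun x => a * α ^ 2 * (Δ (oseen t)) x) →
      eLpNorm (fun x => V x - a * unfilteredOseen α t x) (ENNReal.ofReal p) volume ≤
        ENNReal.ofReal ((8 * R + 80 * K * R ^ 2 + 10 * α ^ 2 * R) * T) := by
    intro F hFm hF he
    rw [eLpNorm_congr_ae he, add_mul, ENNReal.ofReal_add (by positivity) (by positivity)]
    exact (eLpNorm_add_le hFm hΔm hp).trans (add_le_add hF hΔ)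
  have hmf := (integrable_meanFree hv₀.integrable).aestronglyMeasurable
  -- The Duhamel formula is available only for positive times. At `t = 0` the remainder is the
  -- mean-free datum plus the Laplacian correction.
  rcases ht.eq_or_lt with h0 | h0
  · refine hsum hmf ?_ ?_
    · refine (eLpNorm_le_of_sq_le_of_le_one hmf hR hμ0 hμ hp1 hp2 ht (by linarith)
        ((lintegral_enorm_le_weight hμ0 _).trans (lintegral_weight_meanFree_le hμ0 hμ hv₀ hr))
        (lintegral_meanFree_sq_le hμ0 hμ hv₀ hr)).trans (ENNReal.ofReal_le_ofReal ?_)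
      rw [add_mul]
      exact le_add_of_nonneg_right (by positivity)
    · filter_upwards [hV0 h0.symm] with x hx
      simp only [Pi.add_apply, meanFree, unfilteredOseen, hx, ← h0]
      ring
  · set L := heatFlow (meanFree v₀)
    set E := oseenFlow a
    have hE : Decays 0 R E := (decays_oseenFlow a).mono ha le_rfl
    have hv : Decays 0 (R + 8 * R) fun q => E q + ρ q := hE.add (hρ.mono le_rfl hμ0)
    have hL : Decays μ _ L := decays_heatFlow_meanFree hμ0 hμ hv₀ hr
    have b0 := eLpNorm_heatFlow_meanFree_le hμ0 hμ hv₀ hr hp1 hp2 h0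
    have b1 := hρ.eLpNorm_duhamel_le hα hv hμ0 le_rfl (by linarith) hp1 hp2 h0
    have b2 := hE.eLpNorm_duhamel_le hα hρ le_rfl hμ0 (by linarith) hp1 hp2 h0
    have m0 := (hL.integrable h0).aestronglyMeasurable
    have m1 := ((hρ.duhamel hα hv hμ0 le_rfl (by linarith)).integrable h0).aestronglyMeasurable
    have m2 := ((hE.duhamel hα hρ le_rfl hμ0 (by linarith)).integrable h0).aestronglyMeasurable
    simp only [add_zero, zero_add] at b1 b2
    refine hsum ((m0.sub m1).sub m2) ?_ ?_
    · refine (eLpNorm_sub_le (m0.sub m1) m2 hp).trans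
        ((add_le_add ((eLpNorm_sub_le m0 m1 hp).trans (add_le_add b0 b1)) b2).trans ?_)
      rw [← ENNReal.ofReal_add (by positivity) (by positivity),
        ← ENNReal.ofReal_add (by positivity) (by positivity)]
      -- The coefficient `80` is `8 * 9 + 8`: `ρ` of size `8R` against `E + ρ` of size `9R`, and `E`
      -- of size `R` against `ρ`.
      refine ENNReal.ofReal_le_ofReal (le_of_eq ?_)
      simp only [K, T, R]
      ring
    · filter_upwards [hV h0] with x hx
      simp only [Pi.add_apply, Pi.sub_apply, hx, hfix t h0 x, picard, unfilteredOseen, E, oseenFlow]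
      ring

end VCHE

/-! ### The theorem: smallness threshold, existence, and transfer to all solutions -/

theorem theorem2 (α : ℝ) (hα : 0 < α) (μ : ℝ) (hμ : μ ∈ Set.Ioo (0 : ℝ) (1 / 2)) :
    ∃ r₀ : ℝ, 0 < r₀ ∧ ∃ C : ℝ, ∀ v₀ : VCHE.Plane → ℝ,
      VCHE.MemWeightedL2 2 v₀ → VCHE.weightedNorm 2 v₀ ≤ r₀ →
        (∃ v : ℝ → VCHE.Plane → ℝ, VCHE.IsMildSolution α v₀ v) ∧
        ∀ v : ℝ → VCHE.Plane → ℝ, VCHE.IsMildSolution α v₀ v →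
          ∀ p : ℝ, 1 ≤ p → p ≤ 2 → ∀ t : ℝ, 0 ≤ t →
            eLpNorm (fun x => v t x - (∫ y, v₀ y) * VCHE.unfilteredOseen α t x)
                (ENNReal.ofReal p) volume
              ≤ ENNReal.ofReal (C * (1 + t) ^ (-1 - μ + 1 / p)) := by
  obtain ⟨hμ0, hμ⟩ := hμ
  set K := VCHE.Decays.duhamelConst α μ
  have hK : 0 ≤ K := VCHE.Decays.duhamelConst_nonneg hα hμ
  have hd := VCHE.dataConst_pos μ
  -- Chosen so that `18 K * dataConst μ * r = K / (2(K + 1))`, which is below the contraction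
  -- threshold `1/2` even without knowing that `K` is positive.
  set r := 1 / (36 * (K + 1) * VCHE.dataConst μ) with hr
  have hr0 : 0 < r := by positivity
  have hsmall : K * (18 * (VCHE.dataConst μ * r)) ≤ 1 / 2 := by
    rw [show K * (18 * (VCHE.dataConst μ * r)) = K / (2 * (K + 1)) by rw [hr]; field_simp; ring,
      div_le_div_iff₀ (by positivity) (by norm_num)]
    linarith
  refine ⟨r, hr0, 8 * (VCHE.dataConst μ * r) + 80 * K * (VCHE.dataConst μ * r) ^ 2 +
    10 * α ^ 2 * (VCHE.dataConst μ * r), fun v₀ hv₀ hvr => ?_⟩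
  obtain ⟨ρ, hρ, hfix, hsol⟩ := VCHE.exists_duhamel_solution hα hμ0.le hμ hv₀ hvr hsmall
  have hf := (VCHE.decays_oseenFlow (∫ y, v₀ y)).add (hρ.mono le_rfl hμ0.le)
  refine ⟨⟨_, VCHE.isMildSolution_of_duhamel hα hv₀.integrable hf hsol⟩,
    fun v hv p hp1 hp2 t ht => ?_⟩
  obtain ⟨g, M, hgm, hgM, hvg, hg⟩ := hv.exists_duhamel_version hα hv₀.integrable
  refine VCHE.eLpNorm_sub_unfilteredOseen_le hα hμ0.le hμ hv₀ hvr hρ hfix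
    (fun h => h ▸ hv.initial) (fun h0 => (hvg t h0).trans ?_) hp1 hp2 ht
  exact VCHE.duhamel_solution_unique hα hgm hf.measurable hgM
    (fun s hs => by simpa only [neg_zero, Real.rpow_zero, mul_one] using hf.lintegral_le s hs)
    (fun s _ x => hg s x) hsol h0
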